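/- Let $M,\kappa_{\rm di}\in\mathbb R^{3\times3}$ be symmetric positive definite. Consider the attitude error dynamics $$\dot\varepsilon_0=\tfrac12S(\omega)\varepsilon_0+\tfrac12\varepsilon_r\,\omega,\qquad \dot\varepsilon_r=-\tfrac12\omega^\top\varepsilon_0,\qquad M\dot\omega=S(\omega)M\omega+u,$$ where $S(\omega)=\begin{pmatrix}0&-\omega_z&\omega_y\\ \omega_z&0&-\omega_x\\-\omega_y&\omega_x&0\end{pmatrix}$, with state $\zeta=(\varepsilon_0,\varepsilon_r,\omega)\in\mathbb R^3\times\mathbb R\times\mathbb R^3$ and desired equilibrium $\zeta^\star=(0,1,0)$. Let $X=\{\zeta:\varepsilon_0^\top\varepsilon_0+\varepsilon_r^2=1\}$ be the set of states with unit quaternion, $P=\mathrm{diag}(I_4,M)$ and $H_d(\zeta)=\frac12(\zeta-\zeta^\star)^\top P(\zeta-\zeta^\star)$. For $\delta\ge0$ and a constant input $u$ let $\zeta^+(u)$ be the state reached from $\zeta$ after time $\delta$, and let $F^\delta(\zeta,u)$ be the average over $[0,\delta]$ of the velocity along this motion (the velocity at $\zeta$ if $\delta=0$), so that $\zeta^+(u)=\zeta+\delta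 F^\delta(\zeta,u)$. Write $\bar\nabla H_d|_{a}^{b}=\frac12P(a+b-2\zeta^\star)$. Let $D$ be an open neighbourhood of $\zeta^\star$. An *energy-shaping feedback on $D$* is a pair $(u_{\rm es}^\delta(\zeta),J_d^\delta(\zeta))\in\mathbb R^3\times\mathbb R^{7\times7}$ such that, for each $\zeta_0\in D\cap X$, the map $(\delta,\zeta)\mapsto u_{\rm es}^\delta(\zeta)$ is real-analytic at $(0,\zeta_0)$ (so it has a convergent expansion in powers of $\delta$), and for all $(\delta,\zeta)$ with $\delta\ge0$ and $\zeta\in X$ close enough to $(0,\zeta_0)$ the discrete matching equation holds: $$J_d^\delta(\zeta)^\top=-J_d^\delta(\zeta),\qquad J_d^\delta(\zeta)\,P\Big(\zeta-\zeta^\star+\tfrac\delta2F^\delta(\zeta,u_{\rm es}^\delta(\zeta))\Big)=F^\delta(\zeta,u_{\rm es}^\delta(\zeta)).$$ Put $g_d^\delta(\zeta,v)=\int_0^1\frac{\partial F^\delta}{\partial u}(\zeta,u_{\rm es}^\delta(\zeta)+sv)\,ds$, so that $g_d^\delta(\zeta,v)v=F^\delta(\zeta,u_{\rm es}^\delta(\zeta)+v)-F^\delta(\zeta,u_{\rm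 es}^\delta(\zeta))$, and $$Y_d^\delta(\zeta,v)=g_d^\delta(\zeta,v)^\top\,\bar\nabla H_d\big|_{\zeta^+(u_{\rm es}^\delta(\zeta))}^{\zeta^+(u_{\rm es}^\delta(\zeta)+v)} .$$ **Theorem.** On some open neighbourhood $D$ of $\zeta^\star$ there is an energy-shaping feedback with $u_{\rm es}^0(\zeta)=-\frac12\varepsilon_0$. Moreover, for every open neighbourhood $D$ of $\zeta^\star$ and every energy-shaping feedback on $D$: (i) At all $\delta\ge 0$, $\zeta$ at which the matching equation holds, and for all $v\in\mathbb R^3$, $$\zeta^+(u_{\rm es}^\delta(\zeta)+v)=\zeta+\delta J_d^\delta(\zeta)\bar\nabla H_d\big|_{\zeta}^{\zeta^+(u_{\rm es}^\delta(\zeta))}+\delta g_d^\delta(\zeta,v)v ,$$ and this system is lossless with storage function $H_d$ and output $Y_d^\delta$: $$H_d(\zeta^+(u_{\rm es}^\delta(\zeta)+v))-H_d(\zeta)=\delta\,v^\top Y_d^\delta(\zeta,v).$$ (ii) For each $\zeta\in D\cap X$ there is $T^\star>0$ such that for all $\delta\in[0,T^\star)$ the damping equality $v+\kappa_{\rm di}Y_d^\delta(\zeta,v)=0$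 has exactly one solution $v=u_{\rm di}^\delta(\zeta)\in\mathbb R^3$, and it is the sum of a convergent series $$u_{\rm di}^\delta(\zeta)=-\kappa_{\rm di}\,\omega+\sum_{i>0}\frac{\delta^i}{(i+1)!}u_{\rm di}^i(\zeta).$$ (iii) There is $T^\star>0$ such that for each $\delta\in(0,T^\star)$ the damping equality has the unique solution $u_{\rm di}^\delta(\zeta)$ for all $\zeta\in X$ near $\zeta^\star$, and $\zeta^\star$ is a (locally) asymptotically stable equilibrium, on the state space $X$, of the closed loop $\zeta\mapsto\zeta^+\big(u_{\rm es}^\delta(\zeta)+u_{\rm di}^\delta(\zeta)\big)$ (away from $\zeta^\star$, where the damping equality need not be uniquely solvable for this $\delta$, $u_{\rm di}^\delta(\zeta)$ is assigned some value; this does not affect the local statement). -/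

import Mathlib

open Filter Topology Set Matrix

/-- Vectors of `ℝ³`. -/
abbrev Vec3 : Type := Fin 3 → ℝ

/-- Index set of the seven coordinates of `ζ = col(ε₀, ε_r, ω)`. -/
abbrev Idx : Type := Fin 3 ⊕ Fin 1 ⊕ Fin 3

/-- States `ζ = col(ε₀, ε_r, ω) ∈ ℝ⁷`. -/
abbrev State : Type := Idx → ℝ

/-- The state with vector part `e`, scalar part `r` and angular velocity `w`. -/
def mkState (e : Vec3) (r : ℝ) (w : Vec3) : State :=
  Sum.elim e (Sum.elim (fun _ => r) w)

/-- Vector part `ε₀` of the error quaternion. -/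
def qvec (ζ : State) : Vec3 := fun i => ζ (Sum.inl i)

/-- Scalar part `ε_r` of the error quaternion. -/
def qscal (ζ : State) : ℝ := ζ (Sum.inr (Sum.inl 0))

/-- Angular velocity `ω`. -/
def angvel (ζ : State) : Vec3 := fun i => ζ (Sum.inr (Sum.inr i))

/-- The desired equilibrium `ζ⋆`: `ε₀ = 0`, `ε_r = 1`, `ω = 0`. -/
def zetaStar : State := mkState 0 1 0

/-- The states whose quaternion part is a unit quaternion. -/
def unitStates : Set State := {ζ | qvec ζ ⬝ᵥ qvec ζ + qscal ζ ^ 2 = 1}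

/-- The skew-symmetric matrix `S(ω)`. -/
def skewS (w : Vec3) : Matrix (Fin 3) (Fin 3) ℝ :=
  !![0, -w 2, w 1;
     w 2, 0, -w 0;
     -w 1, w 0, 0]

/-- Right-hand side of the error dynamics
`ε₀' = ½ S(ω) ε₀ + ½ ε_r ω`, `ε_r' = -½ ωᵀ ε₀`, `M ω' = S(ω) M ω + u`,
for an invertible inertia matrix `M` and the input value `u`. -/
noncomputable def errField (M : Matrix (Fin 3) (Fin 3) ℝ) (u : Vec3) (ζ : State) : State :=
  mkState
    ((1 / 2 : ℝ) • (skewS (angvel ζ) *ᵥ qvec ζ) + (1 / 2 : ℝ) • (qscal ζ • angvel ζ))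
    (-(1 / 2 : ℝ) * (angvel ζ ⬝ᵥ qvec ζ))
    (M⁻¹ *ᵥ (skewS (angvel ζ) *ᵥ (M *ᵥ angvel ζ) + u))

/-- `x` is a trajectory of the error dynamics under the constant input `u`. -/
def IsTrajectory (M : Matrix (Fin 3) (Fin 3) ℝ) (u : Vec3) (x : ℝ → State) : Prop :=
  ∀ t : ℝ, HasDerivAt x (errField M u (x t)) t

open Classical in
/-- State reached at time `t` from `ζ` under the constant input `u`. For `M` positive definite the
trajectory exists for all times, because `½ ωᵀ M ω` has derivative `ωᵀ u` and `|ε|` is constant,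
and it is unique, because the vector field is polynomial. -/
noncomputable def flow (M : Matrix (Fin 3) (Fin 3) ℝ) (u : Vec3) (ζ : State) (t : ℝ) : State :=
  if h : ∃ x : ℝ → State, x 0 = ζ ∧ IsTrajectory M u x then Classical.choose h t else ζ

/-- Sampled-data equivalent model: `ζ⁺(u)`, the state one sampling period `δ` later. -/
noncomputable def nextState (M : Matrix (Fin 3) (Fin 3) ℝ) (δ : ℝ) (ζ : State) (u : Vec3) : State :=
  flow M u ζ δ

/-- The map `F^δ(ζ, u)` with `ζ⁺(u) = ζ + δ F^δ(ζ, u)`: the velocity averaged over a sampling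
period, also meaningful at `δ = 0`, where it is `f(ζ) + B u`. Its Taylor expansion in `δ` is
`f + B u + ∑_{i>0} δ^i / (i+1)! L_{f+Bu}^i (f + B u)`. -/
noncomputable def sampledF (M : Matrix (Fin 3) (Fin 3) ℝ) (δ : ℝ) (ζ : State) (u : Vec3) : State :=
  ∫ τ in (0 : ℝ)..1, errField M u (flow M u ζ (δ * τ))

/-- The weight `P = diag(I, M)`. -/
def weightP (M : Matrix (Fin 3) (Fin 3) ℝ) : Matrix Idx Idx ℝ :=
  Matrix.fromBlocks 1 0 0 (Matrix.fromBlocks 1 0 0 M)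

/-- Desired Hamiltonian `H_d = ½ (ε₀ᵀ ε₀ + (ε_r - 1)² + ωᵀ M ω)`. -/
noncomputable def hamD (M : Matrix (Fin 3) (Fin 3) ℝ) (ζ : State) : ℝ :=
  (1 / 2 : ℝ) * (qvec ζ ⬝ᵥ qvec ζ + (qscal ζ - 1) ^ 2 + angvel ζ ⬝ᵥ (M *ᵥ angvel ζ))

/-- Discrete gradient of `H_d` from `v` to `w`: `½ P (w + v - 2 ζ⋆)`. -/
noncomputable def discGrad (M : Matrix (Fin 3) (Fin 3) ℝ) (v w : State) : State :=
  (1 / 2 : ℝ) • (weightP M *ᵥ (w + v - (2 : ℝ) • zetaStar))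

/-- Discrete-time matching equation at `ζ`, for the period `δ`, the control value `ues` and the
interconnection matrix `J`: `Jᵀ = -J` and `J P (ζ - ζ⋆ + (δ/2) F^δ(ζ, ues)) = F^δ(ζ, ues)`. -/
def SolvesMatching (M : Matrix (Fin 3) (Fin 3) ℝ) (δ : ℝ) (ζ : State) (ues : Vec3)
    (J : Matrix Idx Idx ℝ) : Prop :=
  Jᵀ = -J ∧
    J *ᵥ (weightP M *ᵥ (ζ - zetaStar + (δ / 2) • sampledF M δ ζ ues)) = sampledF M δ ζ ues

/-- The control matrix `g_d^δ(ζ, v)`, factoring `F^δ(ζ, ues + v) - F^δ(ζ, ues) = g_d^δ(ζ, v) v`: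
the Jacobian of `F^δ(ζ, ·)` averaged over the segment from `ues` to `ues + v`. -/
noncomputable def gD (M : Matrix (Fin 3) (Fin 3) ℝ) (δ : ℝ) (ζ : State) (ues v : Vec3) :
    Matrix Idx (Fin 3) ℝ :=
  Matrix.of fun i j =>
    ∫ s in (0 : ℝ)..1,
      (fderiv ℝ (fun u : Vec3 => sampledF M δ ζ u) (ues + s • v)) (Pi.single j 1) i

/-- Conjugate output `Y_d^δ(ζ, v)`: the transpose of `g_d^δ(ζ, v)` applied to the discrete gradient
of `H_d` from `ζ⁺(ues)` to `ζ⁺(ues + v)`. -/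
noncomputable def outputY (M : Matrix (Fin 3) (Fin 3) ℝ) (δ : ℝ) (ζ : State) (ues v : Vec3) :
    Vec3 :=
  (gD M δ ζ ues v)ᵀ *ᵥ discGrad M (nextState M δ ζ ues) (nextState M δ ζ (ues + v))

/-- Damping equality `v + κ_di Y_d^δ(ζ, v) = 0`. -/
def DampingEq (M κ : Matrix (Fin 3) (Fin 3) ℝ) (δ : ℝ) (ζ : State) (ues v : Vec3) : Prop :=
  v + κ *ᵥ outputY M δ ζ ues v = 0

/-- `uEs` is an energy-shaping feedback with interconnection matrix `Jd` on the part of the state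
space lying in `D`: around every such state `ζ₀` it is given by a convergent expansion in powers of
`δ` with coefficients analytic in `ζ` (joint analyticity at `(0, ζ₀)`), and it solves the matching
equation for all small sampling periods, locally uniformly in the state. -/
structure IsEnergyShaping (M : Matrix (Fin 3) (Fin 3) ℝ) (D : Set State)
    (uEs : ℝ → State → Vec3) (Jd : ℝ → State → Matrix Idx Idx ℝ) : Prop where
  analytic : ∀ ζ₀ ∈ D ∩ unitStates, AnalyticAt ℝ (fun p : ℝ × State => uEs p.1 p.2) (0, ζ₀)
  matching : ∀ ζ₀ ∈ D ∩ unitStates,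
    ∀ᶠ p in 𝓝[Ici (0 : ℝ) ×ˢ unitStates] ((0 : ℝ), ζ₀),
      SolvesMatching M p.1 p.2 (uEs p.1 p.2) (Jd p.1 p.2)

/-- Local asymptotic stability of the fixed point `z` of the discrete-time system `ζ ↦ T ζ` on the
state space `X`: stability in the sense of Lyapunov together with local attractivity. -/
def AsympStableOn (X : Set State) (T : State → State) (z : State) : Prop :=
  z ∈ X ∧ MapsTo T X X ∧ T z = z ∧
    (∀ ε > 0, ∃ η > 0, ∀ ζ ∈ X, dist ζ z < η → ∀ k : ℕ, dist (T^[k] ζ) z < ε) ∧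
    (∃ η > 0, ∀ ζ ∈ X, dist ζ z < η → Tendsto (fun k : ℕ => T^[k] ζ) atTop (𝓝 z))

/-!
Everything rests on one parametrization of the sampled dynamics: `F^δ(ζ, u) = Q(δ, δ u, ζ) + B u`
with `Q` analytic on the whole space (`exists_contDiff_sampledF_eq`), so that apart from an explicit
linear term the input acts only through its impulse `δ u`. The drift is homogeneous quadratic; run
at speed `δ` on `[0, 1]`, a trajectory is the zero of a polynomial map on the Banach space of
continuous curves whose linearization is the identity minus a Volterra operator, and analyticity
follows from the implicit function theorem there (`contDiff_quadEq_solution`). Trajectories are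
global because the quaternion keeps its norm and the kinetic energy grows at most exponentially.

*Energy balance.* The discrete gradient of the quadratic function `H_d` is exact, the part of the
step generated by the skew-symmetric `J_d` does no work, and the rest of the step is `δ g_d v`.

*Damping equality.* The output is an analytic function of `(δ, ζ, δ u_es, δ v)`
(`exists_analyticAt_outputY_eq`), so the implicit function theorem yields an analytic solution `φ`
with value `-κ ω` at `δ = 0`. It is the only solution among all `v ∈ ℝ³`: for any solution the
energy balance bounds `δ ‖v‖²` by the initial energy, hence `δ v` is of order `√δ`, and for such
impulses the equality is a contraction in `v` (`exists_analyticAt_dampingEq_iff`).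

*Stability.* At `δ = 0` the matching equation forces `u_es = -ε₀/2 + g` with `ωᵀ g = 0` and
`g = O(|ω|)`. Along the continuous-time closed loop with such a feedback, `H_d + η ε₀ᵀ M ω`
decreases quadratically for small `η > 0` (`exists_lyapDeriv_errField_le`). The averaged velocity of
the sampled closed loop vanishes at `ζ⋆` for every `δ` and is strictly differentiable there, so
for small `δ` it differs from the continuous-time one by a small multiple of `‖ζ - ζ⋆‖`, and the
same Lyapunov function contracts by a fixed factor at each step (`exists_asympStableOn_closedLoop`).

*Existence of the energy-shaping feedback.* The matching equation is solvable for `J` as soon as the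
step changes no energy. Written in terms of the state `ξ` at the middle of the period, that energy
change vanishes whenever `ω(ξ) = 0`, since reversal of the angular velocity then exchanges the two
half-periods (`midpointPower_eq_zero`). Hence, per unit of time, it equals `ω(ξ)ᵀ E(δ, ξ, u)` with
`E` analytic and `E(0, ξ, u) = u + ε₀/2`, and the implicit function theorem solves `E = 0` for
`u`.
-/

open scoped ContDiff

/-! ### Integrals of analytic families -/

/-- Analyticity of an integral whose parameter enters through an affine family of linear maps: the
power series of the integral is the integral over `s` of the power series of `f` composed with
`A + s • B`. -/
theorem AnalyticAt.intervalIntegral_comp_affine {E F G : Type*}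
    [NormedAddCommGroup E] [NormedSpace ℝ E] [NormedAddCommGroup F] [NormedSpace ℝ F]
    [NormedAddCommGroup G] [NormedSpace ℝ G] [CompleteSpace G]
    (A B : E →L[ℝ] F) {f : F → G} (x₀ : E) {y₀ : F} (hf : AnalyticAt ℝ f y₀) :
    AnalyticAt ℝ (fun x => ∫ s in (0 : ℝ)..1, f (y₀ + (A + s • B) (x - x₀))) x₀ := by
  obtain ⟨p, r, hp⟩ := hf
  obtain ⟨r', hr'0, hr'⟩ := ENNReal.lt_iff_exists_nnreal_btwn.1 hp.r_pos
  have hr'pos : (0 : ℝ) < r' := by exact_mod_cast hr'0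
  have hsum : Summable fun n => ‖p n‖ * (r' : ℝ) ^ n :=
    p.summable_norm_mul_pow (hr'.trans_le hp.r_le)
  set C : ℝ := ‖A‖ + ‖B‖ + 1 with hC
  have hCpos : 0 < C := by positivity
  have hL : ∀ s ∈ Icc (0 : ℝ) 1, ‖A + s • B‖ ≤ C := by
    intro s hs
    calc ‖A + s • B‖ ≤ ‖A‖ + ‖s • B‖ := norm_add_le _ _
      _ = ‖A‖ + |s| * ‖B‖ := by rw [norm_smul, Real.norm_eq_abs]
      _ ≤ ‖A‖ + 1 * ‖B‖ := by
          gcongr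
          rw [abs_of_nonneg hs.1]; exact hs.2
      _ ≤ C := by rw [hC]; linarith
  have hLc : Continuous fun s : ℝ => A + s • B := by fun_prop
  set T : ∀ n, ℝ → ContinuousMultilinearMap ℝ (fun _ : Fin n => E) G := fun n s =>
    (p n).compContinuousLinearMap (fun _ => A + s • B) with hT
  have hTc : ∀ n, Continuous (T n) := by
    intro n
    have h1 : Continuous fun s : ℝ => (fun _ : Fin n => A + s • B) :=
      continuous_pi fun _ => hLc
    have h2 := ((ContinuousMultilinearMap.compContinuousLinearMapContinuousMultilinear ℝ
      (fun _ : Fin n => E) (fun _ : Fin n => F) G).cont.comp h1).clm_apply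
        (continuous_const (y := p n))
    exact h2
  have hTn : ∀ n, ∀ s ∈ Icc (0 : ℝ) 1, ‖T n s‖ ≤ ‖p n‖ * C ^ n := by
    intro n s hs
    refine ((p n).norm_compContinuousLinearMap_le _).trans ?_
    simp only [Finset.prod_const, Finset.card_univ, Fintype.card_fin]
    gcongr
    exact hL s hs
  set q : FormalMultilinearSeries ℝ E G := fun n => ∫ s in (0 : ℝ)..1, T n s with hq
  have hqn : ∀ n, ‖q n‖ ≤ ‖p n‖ * C ^ n := by
    intro n
    have := intervalIntegral.norm_integral_le_of_norm_le_const (a := (0 : ℝ)) (b := 1)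
      (f := T n) (C := ‖p n‖ * C ^ n) (fun s hs => hTn n s (by
        rw [uIoc_of_le zero_le_one] at hs
        exact ⟨hs.1.le, hs.2⟩))
    simpa using this
  set ρ : NNReal := ⟨r' / C, by positivity⟩ with hρ
  have hρv : (ρ : ℝ) = r' / C := rfl
  have hρpos : (0 : ℝ) < ρ := by rw [hρv]; positivity
  refine ⟨q, ρ, ?_, by exact_mod_cast hρpos, ?_⟩
  · refine q.le_radius_of_summable_norm (hsum.of_nonneg_of_le (fun n => by positivity) fun n => ?_)
    calc ‖q n‖ * (ρ : ℝ) ^ n ≤ (‖p n‖ * C ^ n) * (r' / C) ^ n := by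
          rw [hρv]; gcongr; exact hqn n
      _ = ‖p n‖ * (r' : ℝ) ^ n := by
          rw [mul_assoc, ← mul_pow, mul_div_cancel₀ _ hCpos.ne']
  · intro y hy
    have hy' : ‖y‖ ≤ r' / C := by
      have : ‖y‖ < ρ := by
        rw [Metric.mem_eball, edist_zero_right] at hy
        rw [← coe_nnnorm]
        exact_mod_cast hy
      exact this.le
    have hLy : ∀ s ∈ Icc (0 : ℝ) 1, ‖(A + s • B) y‖ ≤ r' := by
      intro s hs
      calc ‖(A + s • B) y‖ ≤ ‖A + s • B‖ * ‖y‖ := ContinuousLinearMap.le_opNorm _ _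
        _ ≤ C * (r' / C) := by
            gcongr
            exact hL s hs
        _ = r' := mul_div_cancel₀ _ hCpos.ne'
    have hqa : ∀ n, (q n fun _ => y) = ∫ s in (0 : ℝ)..1, p n fun _ => (A + s • B) y := by
      intro n
      have := (ContinuousMultilinearMap.apply ℝ (fun _ : Fin n => E) G
        (fun _ => y)).intervalIntegral_comp_comm (μ := MeasureTheory.volume)
        ((hTc n).intervalIntegrable 0 1)
      simp only [hq]
      rw [← ContinuousMultilinearMap.apply_apply (𝕜 := ℝ), ← this]
      rfl
    simp only [hqa, add_sub_cancel_left]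
    refine intervalIntegral.hasSum_integral_of_dominated_convergence
      (fun n _ => ‖p n‖ * (r' : ℝ) ^ n) ?_ ?_ ?_ ?_ ?_
    · intro n
      refine Continuous.aestronglyMeasurable ?_
      exact (p n).cont.comp (continuous_pi fun _ => hLc.clm_apply continuous_const)
    · intro n
      refine Eventually.of_forall fun s hs => ?_
      rw [uIoc_of_le zero_le_one] at hs
      refine ((p n).le_opNorm _).trans ?_
      simp only [Finset.prod_const, Finset.card_univ, Fintype.card_fin]
      gcongr
      exact hLy s ⟨hs.1.le, hs.2⟩
    · exact Eventually.of_forall fun s _ => hsum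
    · exact intervalIntegrable_const
    · refine Eventually.of_forall fun s hs => ?_
      rw [uIoc_of_le zero_le_one] at hs
      refine hp.hasSum ?_
      rw [Metric.mem_eball, edist_zero_right]
      refine lt_of_le_of_lt ?_ hr'
      have := hLy s ⟨hs.1.le, hs.2⟩
      rw [← coe_nnnorm] at this
      exact_mod_cast this

/-! ### Quadratic initial value problems on the space of curves -/

section QuadraticODE

open unitInterval

variable {E : Type*} [NormedAddCommGroup E] [NormedSpace ℝ E]

/-- The Volterra operator `h ↦ (t ↦ ∫₀ᵗ h)` on continuous curves over `[0, 1]`. -/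
noncomputable def volterra (E : Type*) [NormedAddCommGroup E] [NormedSpace ℝ E] :
    C(I, E) →L[ℝ] C(I, E) :=
  LinearMap.mkContinuous
    { toFun := fun h => ⟨fun t => ∫ s in (0 : ℝ)..t, IccExtend zero_le_one h s, by
        have : Continuous (IccExtend (zero_le_one (α := ℝ)) h) := h.continuous.Icc_extend'
        exact (intervalIntegral.continuous_primitive
          (fun a b => this.intervalIntegrable a b) 0).comp continuous_subtype_val⟩
      map_add' := fun h k => by
        ext t
        have hh : Continuous (IccExtend (zero_le_one (α := ℝ)) h) := h.continuous.Icc_extend'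
        have hk : Continuous (IccExtend (zero_le_one (α := ℝ)) k) := k.continuous.Icc_extend'
        exact intervalIntegral.integral_add (hh.intervalIntegrable _ _) (hk.intervalIntegrable _ _)
      map_smul' := fun c h => by
        ext t
        exact intervalIntegral.integral_smul c _ }
    1 (fun h => by
      rw [one_mul]
      refine (ContinuousMap.norm_le _ (norm_nonneg h)).2 fun t => ?_
      have := intervalIntegral.norm_integral_le_of_norm_le_const (a := (0 : ℝ)) (b := t)
        (f := IccExtend zero_le_one h) (C := ‖h‖) (fun s _ => h.norm_coe_le_norm _)
      refine this.trans ?_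
      rw [sub_zero, abs_of_nonneg t.2.1]
      exact mul_le_of_le_one_right (norm_nonneg h) t.2.2)

theorem volterra_apply (h : C(I, E)) (t : I) :
    volterra E h t = ∫ s in (0 : ℝ)..t, IccExtend zero_le_one h s := rfl

/-- The curve `t ↦ b (y t) (z t)` as a bounded bilinear map on curves. -/
noncomputable def curveBilin (b : E →L[ℝ] E →L[ℝ] E) : C(I, E) →L[ℝ] C(I, E) →L[ℝ] C(I, E) :=
  LinearMap.mkContinuous₂
    (LinearMap.mk₂ ℝ (fun y z : C(I, E) => (⟨fun t => b (y t) (z t), by fun_prop⟩ : C(I, E)))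
      (fun _ _ _ => by ext; simp) (fun _ _ _ => by ext; simp)
      (fun _ _ _ => by ext; simp) (fun _ _ _ => by ext; simp))
    ‖b‖ (fun y z => by
      refine (ContinuousMap.norm_le _ (by positivity)).2 fun t => ?_
      refine (b.le_opNorm₂ (y t) (z t)).trans ?_
      gcongr
      · exact y.norm_coe_le_norm t
      · exact z.norm_coe_le_norm t)

@[simp]
theorem curveBilin_apply (b : E →L[ℝ] E →L[ℝ] E) (y z : C(I, E)) (t : I) :
    curveBilin b y z t = b (y t) (z t) := rfl

/-- Iterates of a Volterra operator with a pointwise bounded kernel decay factorially. -/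
theorem norm_volterra_comp_pow_le (A : C(I, E) →L[ℝ] C(I, E)) {C : ℝ} (hC : 0 ≤ C)
    (hA : ∀ h t, ‖A h t‖ ≤ C * ‖h t‖) (n : ℕ) (h : C(I, E)) (t : I) :
    ‖((volterra E ∘L A) ^ n) h t‖ ≤ (C * t) ^ n / n.factorial * ‖h‖ := by
  induction n generalizing t with
  | zero => simpa using h.norm_coe_le_norm t
  | succ n ih =>
    rw [pow_succ']
    change ‖volterra E (A (((volterra E ∘L A) ^ n) h)) t‖ ≤ _
    set k := ((volterra E ∘L A) ^ n) h
    rw [volterra_apply]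
    have hint : ∫ s in (0 : ℝ)..t, C * ((C * s) ^ n / n.factorial * ‖h‖) =
        (C * t) ^ (n + 1) / (n + 1).factorial * ‖h‖ := by
      have : (fun s : ℝ => C * ((C * s) ^ n / n.factorial * ‖h‖)) =
          fun s => (C ^ (n + 1) / n.factorial * ‖h‖) * s ^ n := by
        funext s; rw [mul_pow]; ring
      rw [this, intervalIntegral.integral_const_mul, integral_pow]
      have h1 : ((n + 1).factorial : ℝ) = (n + 1) * n.factorial := by
        rw [Nat.factorial_succ]; push_cast; ring
      rw [h1, mul_pow]
      have h2 : (n.factorial : ℝ) ≠ 0 := by positivity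
      field_simp
      simp
    rw [← hint]
    refine intervalIntegral.norm_integral_le_of_norm_le t.2.1 ?_ ?_
    · refine Eventually.of_forall fun s hs => ?_
      have hs' : s ∈ Icc (0 : ℝ) 1 := ⟨hs.1.le, hs.2.trans t.2.2⟩
      rw [IccExtend_of_mem _ _ hs']
      refine (hA k _).trans ?_
      gcongr
      exact ih ⟨s, hs'⟩
    · apply Continuous.intervalIntegrable
      fun_prop

theorem exists_norm_volterra_comp_pow_lt_one (A : C(I, E) →L[ℝ] C(I, E)) {C : ℝ} (hC : 0 ≤ C)
    (hA : ∀ h t, ‖A h t‖ ≤ C * ‖h t‖) : ∃ n : ℕ, ‖(volterra E ∘L A) ^ n‖ < 1 := by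
  obtain ⟨n, hn⟩ := ((FloorSemiring.tendsto_pow_div_factorial_atTop C).eventually
    (gt_mem_nhds (show (0 : ℝ) < 1 by norm_num))).exists
  refine ⟨n, lt_of_le_of_lt (ContinuousLinearMap.opNorm_le_bound _ (by positivity) fun h => ?_) hn⟩
  refine (ContinuousMap.norm_le _ (by positivity)).2 fun t => ?_
  refine (norm_volterra_comp_pow_le A hC hA n h t).trans ?_
  have h0 : 0 ≤ C * (t : ℝ) := mul_nonneg hC t.2.1
  have h1 : C * (t : ℝ) ≤ C := mul_le_of_le_one_right hC t.2.2
  gcongr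

/-- Only the zero curve solves a homogeneous linear Volterra equation. -/
theorem eq_zero_of_volterra_comp_eq (A : C(I, E) →L[ℝ] C(I, E)) {C : ℝ} (hC : 0 ≤ C)
    (hA : ∀ h t, ‖A h t‖ ≤ C * ‖h t‖) {h : C(I, E)} (hh : volterra E (A h) = h) : h = 0 := by
  obtain ⟨n, hn⟩ := exists_norm_volterra_comp_pow_lt_one A hC hA
  have hfix : ∀ m : ℕ, ((volterra E ∘L A) ^ m) h = h := by
    intro m
    induction m with
    | zero => simp
    | succ m ih => rw [pow_succ]; change ((volterra E ∘L A) ^ m) (volterra E (A h)) = h; rw [hh, ih]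
  have h1 : ‖h‖ ≤ ‖(volterra E ∘L A) ^ n‖ * ‖h‖ := by
    conv_lhs => rw [← hfix n]
    exact ContinuousLinearMap.le_opNorm _ _
  by_contra hne
  have := norm_pos_iff.2 hne
  nlinarith

theorem isInvertible_id_sub_volterra_comp [CompleteSpace E] (A : C(I, E) →L[ℝ] C(I, E)) {C : ℝ}
    (hC : 0 ≤ C) (hA : ∀ h t, ‖A h t‖ ≤ C * ‖h t‖) :
    (ContinuousLinearMap.id ℝ C(I, E) - volterra E ∘L A).IsInvertible := by
  obtain ⟨n, hn⟩ := exists_norm_volterra_comp_pow_lt_one A hC hA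
  set K := volterra E ∘L A
  have h1 : IsUnit (1 - K ^ n) := isUnit_one_sub_of_norm_lt_one (R := C(I, E) →L[ℝ] C(I, E)) hn
  have h2 : IsUnit (1 - K) := by
    have hc : Commute (1 - K) (∑ i ∈ Finset.range n, K ^ i) :=
      Commute.sum_right _ _ _ fun i _ =>
        ((Commute.one_left _).sub_left ((Commute.refl K).pow_right i))
    have := mul_neg_geom_sum K n
    rw [← this] at h1
    exact (hc.isUnit_mul_iff.1 h1).1
  obtain ⟨u, hu⟩ := h2
  exact ⟨ContinuousLinearEquiv.ofUnit u, by rw [← ContinuousLinearMap.one_def, ← hu]; rfl⟩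

/-- The integral equation of `y' = δ b(y, y) + c`, `y 0 = ζ`, on `[0, 1]`: the curve `y` solves the
initial value problem iff `quadEq b ((δ, c, ζ), y) = 0`. -/
noncomputable def quadEq (b : E →L[ℝ] E →L[ℝ] E) (q : (ℝ × E × E) × C(I, E)) : C(I, E) :=
  q.2 - ContinuousLinearMap.const ℝ I q.1.2.2
    - volterra E (q.1.1 • curveBilin b q.2 q.2 + ContinuousLinearMap.const ℝ I q.1.2.1)

/-- The linear operator `h ↦ b(y, h) + b(h, z)` on curves. -/
noncomputable def curveLin (b : E →L[ℝ] E →L[ℝ] E) (y z : C(I, E)) : C(I, E) →L[ℝ] C(I, E) :=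
  curveBilin b y + (curveBilin b).flip z

theorem norm_smul_curveLin_le (b : E →L[ℝ] E →L[ℝ] E) (δ : ℝ) (y z h : C(I, E)) (t : I) :
    ‖(δ • curveLin b y z) h t‖ ≤ (|δ| * (‖b‖ * ‖y‖ + ‖b‖ * ‖z‖)) * ‖h t‖ := by
  have h1 : (δ • curveLin b y z) h t = δ • (b (y t) (h t) + b (h t) (z t)) := rfl
  rw [h1, norm_smul, Real.norm_eq_abs, mul_assoc]
  gcongr
  refine (norm_add_le _ _).trans ?_
  have h2 := b.le_opNorm₂ (y t) (h t)
  have h3 := b.le_opNorm₂ (h t) (z t)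
  have h4 := y.norm_coe_le_norm t
  have h5 := z.norm_coe_le_norm t
  calc ‖b (y t) (h t)‖ + ‖b (h t) (z t)‖ ≤ ‖b‖ * ‖y t‖ * ‖h t‖ + ‖b‖ * ‖h t‖ * ‖z t‖ := by gcongr
    _ = (‖b‖ * ‖y t‖ + ‖b‖ * ‖z t‖) * ‖h t‖ := by ring
    _ ≤ _ := by gcongr

theorem quadEq_unique (b : E →L[ℝ] E →L[ℝ] E) {p : ℝ × E × E} {y z : C(I, E)}
    (hy : quadEq b (p, y) = 0) (hz : quadEq b (p, z) = 0) : y = z := by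
  rw [← sub_eq_zero]
  refine eq_zero_of_volterra_comp_eq (p.1 • curveLin b y z) (by positivity)
    (fun h t => norm_smul_curveLin_le b p.1 y z h t) ?_
  have h1 : (p.1 • curveLin b y z) (y - z) =
      (p.1 • curveBilin b y y + ContinuousLinearMap.const ℝ I p.2.1) -
        (p.1 • curveBilin b z z + ContinuousLinearMap.const ℝ I p.2.1) := by
    ext t
    simp [curveLin, smul_sub]
  rw [h1, map_sub]
  have h2 := sub_eq_zero.1 hy
  have h3 := sub_eq_zero.1 hz
  simp only at h2 h3
  rw [← h2, ← h3]
  abel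

theorem contDiff_quadEq (b : E →L[ℝ] E →L[ℝ] E) : ContDiff ℝ ω (quadEq b) := by
  unfold quadEq
  have h1 : ContDiff ℝ ω fun q : (ℝ × E × E) × C(I, E) => curveBilin b q.2 q.2 := by fun_prop
  fun_prop

/-- Solutions of a quadratic initial value problem depend analytically on the time scale, on the
constant term and on the initial state: the integral equation is polynomial on the Banach space of
curves and its linearization is the identity minus a Volterra operator. -/
theorem contDiff_quadEq_solution [CompleteSpace E] (b : E →L[ℝ] E →L[ℝ] E)
    {P : Type*} [NormedAddCommGroup P] [NormedSpace ℝ P] {par : P → ℝ × E × E}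
    (hpar : ContDiff ℝ ω par) {Y : P → C(I, E)} (hY : ∀ p, quadEq b (par p, Y p) = 0) :
    ContDiff ℝ ω Y := by
  rw [contDiff_iff_contDiffAt]
  intro p
  have hcd : ContDiffAt ℝ ω (quadEq b) (par p, Y p) := (contDiff_quadEq b).contDiffAt
  have hinv : (fderiv ℝ (quadEq b) (par p, Y p) ∘L .inr ℝ (ℝ × E × E) C(I, E)).IsInvertible := by
    have hd : HasFDerivAt (fun y => quadEq b (par p, y)) (ContinuousLinearMap.id ℝ C(I, E) -
        volterra E ∘L ((par p).1 • curveLin b (Y p) (Y p))) (Y p) := by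
      have h1 : HasFDerivAt (fun y => curveBilin b y y) (curveLin b (Y p) (Y p)) (Y p) := by
        have := (curveBilin b).hasFDerivAt_of_bilinear (hasFDerivAt_id (Y p)) (hasFDerivAt_id (Y p))
        convert! this using 1
      have h2 := ((volterra E).hasFDerivAt.comp (Y p)
        ((h1.const_smul (par p).1).add_const (ContinuousLinearMap.const ℝ I (par p).2.1)))
      exact ((hasFDerivAt_id (Y p)).sub_const (ContinuousLinearMap.const ℝ I (par p).2.2)).sub h2
    have hd2 : HasFDerivAt (fun y => quadEq b (par p, y))
        (fderiv ℝ (quadEq b) (par p, Y p) ∘L .inr ℝ (ℝ × E × E) C(I, E)) (Y p) :=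
      HasFDerivAt.comp (g := quadEq b) (Y p)
        (hcd.differentiableAt (by simp)).hasFDerivAt (hasFDerivAt_prodMk_right (par p) (Y p))
    rw [hd2.unique hd]
    exact isInvertible_id_sub_volterra_comp _ (by positivity)
      (fun h t => norm_smul_curveLin_le b (par p).1 (Y p) (Y p) h t)
  have hev := hpar.continuous.continuousAt.eventually
    (hcd.eventually_apply_implicitFunction (by simp) hinv)
  have himp : ContDiffAt ℝ ω (hcd.implicitFunction (by simp) hinv ∘ par) p :=
    (hcd.contDiffAt_implicitFunction (by simp) hinv).comp p hpar.contDiffAt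
  refine himp.congr_of_eventuallyEq ?_
  filter_upwards [hev] with x hx
  rw [hY p] at hx
  exact quadEq_unique b (hY x) hx

end QuadraticODE

/-! ### Global existence of integral curves -/

open unitInterval in
theorem quadEq_of_hasDerivAt {E : Type*} [NormedAddCommGroup E] [NormedSpace ℝ E] [CompleteSpace E]
    (b : E →L[ℝ] E →L[ℝ] E) {δ : ℝ} {c : E} {x : ℝ → E}
    (hx : ∀ t, HasDerivAt x (δ • b (x t) (x t) + c) t) (y : C(I, E)) (hy : ∀ t : I, y t = x t) :
    quadEq b ((δ, c, x 0), y) = 0 := by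
  have hxc : Continuous x := continuous_iff_continuousAt.2 fun t => (hx t).continuousAt
  ext t
  have h1 : ∫ s in (0 : ℝ)..t, (δ • b (x s) (x s) + c) = x t - x 0 :=
    intervalIntegral.integral_eq_sub_of_hasDerivAt (fun s _ => hx s)
      (Continuous.intervalIntegrable (by fun_prop) _ _)
  have h2 : volterra E (δ • curveBilin b y y + ContinuousLinearMap.const ℝ I c) t =
      ∫ s in (0 : ℝ)..t, (δ • b (x s) (x s) + c) := by
    rw [volterra_apply]
    refine intervalIntegral.integral_congr fun s hs => ?_
    rw [uIcc_of_le t.2.1] at hs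
    have hs' : s ∈ Icc (0 : ℝ) 1 := ⟨hs.1, hs.2.trans t.2.2⟩
    simp only [IccExtend_of_mem _ _ hs']
    simp [hy]
  simp only [quadEq, ContinuousMap.sub_apply, h2, h1, hy]
  simp

/-- Two integral curves that agree at time `0` and stay in a ball agree on an interval, since a
continuously differentiable vector field is Lipschitz on balls. -/
theorem eqOn_Ioo_of_hasDerivAt_of_norm_le {E : Type*} [NormedAddCommGroup E] [NormedSpace ℝ E]
    [FiniteDimensional ℝ E] {f : E → E} (hf : ContDiff ℝ 1 f) {x y : ℝ → E} {T R : ℝ} (hT : 0 < T)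
    (hx : ∀ t ∈ Ioo (-T) T, HasDerivAt x (f (x t)) t ∧ ‖x t‖ ≤ R)
    (hy : ∀ t ∈ Ioo (-T) T, HasDerivAt y (f (y t)) t ∧ ‖y t‖ ≤ R) (h0 : x 0 = y 0) :
    EqOn x y (Ioo (-T) T) := by
  obtain ⟨K, hK⟩ := hf.contDiffOn.exists_lipschitzOnWith (s := Metric.closedBall 0 R) one_ne_zero
    (convex_closedBall 0 R) (isCompact_closedBall 0 R)
  refine ODE_solution_unique_of_mem_Ioo (v := fun _ => f) (s := fun _ => Metric.closedBall 0 R)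
    (fun _ _ => hK) ⟨neg_lt_zero.2 hT, hT⟩ ?_ ?_ h0
  · exact fun t ht => ⟨(hx t ht).1, by simpa using (hx t ht).2⟩
  · exact fun t ht => ⟨(hy t ht).1, by simpa using (hy t ht).2⟩

/-- Integral curves of a bounded Lipschitz vector field exist on any bounded time interval. -/
theorem exists_hasDerivAt_Ioo_of_bounded {E : Type*} [NormedAddCommGroup E] [NormedSpace ℝ E]
    [CompleteSpace E] {f : E → E} {K : NNReal} (hK : LipschitzWith K f) {L : NNReal}
    (hL : ∀ x, ‖f x‖ ≤ L) (x₀ : E) {T : ℝ} (hT : 0 < T) :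
    ∃ x : ℝ → E, x 0 = x₀ ∧ ∀ t ∈ Ioo (-T) T, HasDerivAt x (f (x t)) t := by
  have hpl : IsPicardLindelof (fun _ : ℝ => f) (tmin := -T) (tmax := T)
      ⟨0, by constructor <;> linarith⟩ x₀ (L * ⟨T, hT.le⟩) 0 L K := by
    refine IsPicardLindelof.of_time_independent (fun x _ => hL x) hK.lipschitzOnWith ?_
    simp only [sub_zero, zero_sub, neg_neg, max_self, NNReal.coe_zero]
    exact le_rfl
  obtain ⟨x, hx0, hx⟩ := hpl.exists_eq_forall_mem_Icc_hasDerivWithinAt₀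
  exact ⟨x, hx0, fun t ht => (hx t (Ioo_subset_Icc_self ht)).hasDerivAt (Icc_mem_nhds ht.1 ht.2)⟩

/-- Exponential a priori bound: along a curve on which `|g'| ≤ C g`, the positive quantity `g` grows
at most like `exp (C |t|)`. -/
theorem le_mul_exp_of_abs_deriv_le {g g' : ℝ → ℝ} {C T : ℝ} (hT : 0 < T)
    (hg : ∀ t ∈ Ioo (-T) T, HasDerivAt g (g' t) t) (hC : ∀ t ∈ Ioo (-T) T, |g' t| ≤ C * g t)
    {t : ℝ} (ht : t ∈ Ioo (-T) T) : g t ≤ g 0 * Real.exp (C * |t|) := by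
  have h0 : (0 : ℝ) ∈ Ioo (-T) T := ⟨neg_lt_zero.2 hT, hT⟩
  have hd : ∀ (a : ℝ), ∀ s ∈ Ioo (-T) T, HasDerivAt (fun s => g s * Real.exp (a * s))
      ((g' s + a * g s) * Real.exp (a * s)) s := by
    intro a s hs
    have h1 : HasDerivAt (fun s : ℝ => Real.exp (a * s)) (Real.exp (a * s) * a) s := by
      simpa using ((hasDerivAt_id s).const_mul a).exp
    convert! (hg s hs).mul h1 using 1
    ring
  have key : ∀ a b : ℝ, a ∈ Ioo (-T) T → b ∈ Ioo (-T) T → a ≤ b →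
      g b * Real.exp (-C * b) ≤ g a * Real.exp (-C * a) ∧
      g a * Real.exp (C * a) ≤ g b * Real.exp (C * b) := by
    intro a b ha hb hab
    constructor
    · refine antitoneOn_of_deriv_nonpos (convex_Ioo (-T) T)
        (fun s hs => (hd (-C) s hs).continuousAt.continuousWithinAt)
        (fun s hs => (hd (-C) s (interior_subset hs)).differentiableAt.differentiableWithinAt)
        (fun s hs => ?_) ha hb hab
      rw [(hd (-C) s (interior_subset hs)).deriv]
      have := (abs_le.1 (hC s (interior_subset hs))).2
      exact mul_nonpos_of_nonpos_of_nonneg (by linarith) (Real.exp_pos _).le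
    · refine monotoneOn_of_deriv_nonneg (convex_Ioo (-T) T)
        (fun s hs => (hd C s hs).continuousAt.continuousWithinAt)
        (fun s hs => (hd C s (interior_subset hs)).differentiableAt.differentiableWithinAt)
        (fun s hs => ?_) ha hb hab
      rw [(hd C s (interior_subset hs)).deriv]
      have := (abs_le.1 (hC s (interior_subset hs))).1
      exact mul_nonneg (by linarith) (Real.exp_pos _).le
  rcases le_total 0 t with h | h
  · have := (key 0 t h0 ht h).1
    rw [abs_of_nonneg h]
    have h2 : g t = g t * Real.exp (-C * t) * Real.exp (C * t) := by
      rw [mul_assoc, ← Real.exp_add]; simp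
    rw [h2]
    gcongr
    simpa using this
  · have := (key t 0 ht h0 h).2
    rw [abs_of_nonpos h]
    have h2 : g t = g t * Real.exp (C * t) * Real.exp (C * -t) := by
      rw [mul_assoc, ← Real.exp_add]; simp
    rw [h2]
    gcongr
    simpa using this

/-- Completeness criterion: a `C¹` vector field is complete if some function `G` with bounded
sublevel sets grows at most exponentially along it. -/
theorem exists_hasDerivAt_of_proper_bound {E : Type*} [NormedAddCommGroup E] [NormedSpace ℝ E]
    [FiniteDimensional ℝ E] {f : E → E} (hf : ContDiff ℝ 1 f) {G : E → ℝ} (hG : Differentiable ℝ G)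
    {C : ℝ} (hC0 : 0 ≤ C) (hG0 : ∀ x, 0 ≤ G x)
    (hC : ∀ x, |fderiv ℝ G x (f x)| ≤ C * G x) (hb : ∀ A, ∃ R, ∀ x, G x ≤ A → ‖x‖ ≤ R) (x₀ : E) :
    ∃ x : ℝ → E, x 0 = x₀ ∧ ∀ t, HasDerivAt x (f (x t)) t := by
  have hloc : ∀ T > 0, ∃ R, ∃ x : ℝ → E, x 0 = x₀ ∧
      ∀ t ∈ Ioo (-T) T, HasDerivAt x (f (x t)) t ∧ ‖x t‖ ≤ R := by
    intro T hT
    obtain ⟨R, hR⟩ := hb (G x₀ * Real.exp (C * T))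
    -- the field is cut off outside a ball that its integral curves cannot leave before time `T`
    let χ : ContDiffBump (0 : E) := ⟨|R| + 1, |R| + 2, by positivity, by linarith⟩
    have hcd : ContDiff ℝ 1 fun x => χ x • f x := χ.contDiff.smul hf
    have hcs : HasCompactSupport fun x => χ x • f x := χ.hasCompactSupport.smul_right
    obtain ⟨K, hK⟩ := hcd.lipschitzWith_of_hasCompactSupport hcs one_ne_zero
    obtain ⟨L, hL⟩ := hcd.continuous.bounded_above_of_compact_support hcs
    obtain ⟨x, hx0, hx⟩ := exists_hasDerivAt_Ioo_of_bounded hK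
      (L := L.toNNReal) (fun x => (hL x).trans (Real.le_coe_toNNReal L)) x₀ hT
    have hbd : ∀ t ∈ Ioo (-T) T, ‖x t‖ ≤ R := by
      intro t ht
      apply hR
      have h1 := le_mul_exp_of_abs_deriv_le (g := fun t => G (x t)) hT
        (fun t ht => (hG (x t)).hasFDerivAt.comp_hasDerivAt t (hx t ht)) (C := C) (fun t _ => by
          rw [map_smul, smul_eq_mul, abs_mul, abs_of_nonneg χ.nonneg]
          calc _ ≤ 1 * |fderiv ℝ G (x t) (f (x t))| := by gcongr; exact χ.le_one
            _ ≤ _ := by rw [one_mul]; exact hC _) ht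
      rw [hx0] at h1
      refine h1.trans ?_
      have := hG0 x₀
      have : |t| ≤ T := (abs_lt.2 ht).le
      gcongr
    refine ⟨R, x, hx0, fun t ht => ⟨?_, hbd t ht⟩⟩
    have h1 : χ (x t) = 1 := χ.one_of_mem_closedBall (by
      rw [mem_closedBall_zero_iff]
      exact (hbd t ht).trans ((le_abs_self R).trans (by change |R| ≤ |R| + 1; linarith)))
    simpa [h1] using hx t ht
  choose! R x hx0 hx using hloc
  have hagree : ∀ S T, 0 < S → S ≤ T → EqOn (x S) (x T) (Ioo (-S) S) := by
    intro S T hS hST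
    have hsub : Ioo (-S) S ⊆ Ioo (-T) T := Ioo_subset_Ioo (by linarith) hST
    exact eqOn_Ioo_of_hasDerivAt_of_norm_le hf (R := max (R S) (R T)) hS
      (fun t ht => ⟨(hx S hS t ht).1, (hx S hS t ht).2.trans (le_max_left _ _)⟩)
      (fun t ht => ⟨(hx T (hS.trans_le hST) t (hsub ht)).1,
        (hx T (hS.trans_le hST) t (hsub ht)).2.trans (le_max_right _ _)⟩)
      (by rw [hx0 S hS, hx0 T (hS.trans_le hST)])
  refine ⟨fun t => x (|t| + 1) t, hx0 _ (by positivity), fun t => ?_⟩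
  have hpos : 0 < |t| + 2 := by positivity
  have hmem : t ∈ Ioo (-(|t| + 2)) (|t| + 2) := abs_lt.1 (by linarith)
  have ht1 : t ∈ Ioo (-(|t| + 1)) (|t| + 1) := abs_lt.1 (by linarith)
  have hev : (fun s => x (|s| + 1) s) =ᶠ[𝓝 t] x (|t| + 2) := by
    filter_upwards [isOpen_Ioo.mem_nhds ht1] with s hs
    have hs1 : |s| < |t| + 1 := abs_lt.2 hs
    exact hagree _ _ (by positivity) (by linarith) (abs_lt.1 (by linarith))
  have := ((hx _ hpos t hmem).1.congr_of_eventuallyEq hev)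
  rwa [← hev.self_of_nhds] at this

/-! ### Coordinates of the state space -/

@[simp] theorem qvec_mkState (e : Vec3) (r : ℝ) (w : Vec3) : qvec (mkState e r w) = e := rfl
@[simp] theorem qscal_mkState (e : Vec3) (r : ℝ) (w : Vec3) : qscal (mkState e r w) = r := rfl
@[simp] theorem angvel_mkState (e : Vec3) (r : ℝ) (w : Vec3) : angvel (mkState e r w) = w := rfl
@[simp] theorem qvec_add (x y : State) : qvec (x + y) = qvec x + qvec y := rfl
@[simp] theorem qscal_add (x y : State) : qscal (x + y) = qscal x + qscal y := rfl
@[simp] theorem angvel_add (x y : State) : angvel (x + y) = angvel x + angvel y := rfl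
@[simp] theorem qvec_sub (x y : State) : qvec (x - y) = qvec x - qvec y := rfl
@[simp] theorem qscal_sub (x y : State) : qscal (x - y) = qscal x - qscal y := rfl
@[simp] theorem angvel_sub (x y : State) : angvel (x - y) = angvel x - angvel y := rfl
@[simp] theorem qvec_smul (c : ℝ) (x : State) : qvec (c • x) = c • qvec x := rfl
@[simp] theorem qscal_smul (c : ℝ) (x : State) : qscal (c • x) = c * qscal x := rfl
@[simp] theorem angvel_smul (c : ℝ) (x : State) : angvel (c • x) = c • angvel x := rfl
@[simp] theorem qvec_zero : qvec 0 = 0 := rfl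
@[simp] theorem qscal_zero : qscal 0 = 0 := rfl
@[simp] theorem angvel_zero : angvel 0 = 0 := rfl
@[simp] theorem qvec_zetaStar : qvec zetaStar = 0 := rfl
@[simp] theorem qscal_zetaStar : qscal zetaStar = 1 := rfl
@[simp] theorem angvel_zetaStar : angvel zetaStar = 0 := rfl

theorem state_ext {x y : State} (h₁ : qvec x = qvec y) (h₂ : qscal x = qscal y)
    (h₃ : angvel x = angvel y) : x = y := by
  funext i
  rcases i with i | i | i
  · exact congrFun h₁ i
  · rw [Subsingleton.elim i 0]; exact h₂
  · exact congrFun h₃ i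

theorem mkState_eta (x : State) : mkState (qvec x) (qscal x) (angvel x) = x :=
  state_ext rfl rfl rfl

/-- The vector part of the quaternion, as a continuous linear map. -/
noncomputable def qvecL : State →L[ℝ] Vec3 :=
  ContinuousLinearMap.pi fun i => ContinuousLinearMap.proj (Sum.inl i)

/-- The scalar part of the quaternion, as a continuous linear map. -/
noncomputable def qscalL : State →L[ℝ] ℝ := ContinuousLinearMap.proj (Sum.inr (Sum.inl 0))

/-- The angular velocity, as a continuous linear map. -/
noncomputable def angvelL : State →L[ℝ] Vec3 :=
  ContinuousLinearMap.pi fun i => ContinuousLinearMap.proj (Sum.inr (Sum.inr i))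

@[fun_prop]
theorem contDiff_qvec {n : ℕ∞ω} : ContDiff ℝ n qvec := qvecL.contDiff
@[fun_prop]
theorem contDiff_qscal {n : ℕ∞ω} : ContDiff ℝ n qscal := qscalL.contDiff
@[fun_prop]
theorem contDiff_angvel {n : ℕ∞ω} : ContDiff ℝ n angvel := angvelL.contDiff

theorem dotProduct_state (x y : State) :
    x ⬝ᵥ y = qvec x ⬝ᵥ qvec y + qscal x * qscal y + angvel x ⬝ᵥ angvel y := by
  simp only [dotProduct, Fintype.sum_sum_type, Finset.univ_unique, Finset.sum_singleton]
  simp only [qvec, qscal, angvel]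
  rw [← add_assoc]
  rfl

theorem weightP_mulVec (M : Matrix (Fin 3) (Fin 3) ℝ) (x : State) :
    weightP M *ᵥ x = mkState (qvec x) (qscal x) (M *ᵥ angvel x) := by
  refine state_ext ?_ ?_ ?_
  · ext i
    simp [qvec, mkState, weightP, Matrix.mulVec, dotProduct, Matrix.one_apply]
  · simp [qscal, mkState, weightP, Matrix.mulVec, dotProduct]
  · ext i
    simp [angvel, mkState, weightP, Matrix.mulVec, dotProduct]

theorem norm_qvec_le (x : State) : ‖qvec x‖ ≤ ‖x‖ :=
  (pi_norm_le_iff_of_nonneg (norm_nonneg x)).2 fun i => norm_le_pi_norm x (Sum.inl i)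

theorem abs_qscal_le (x : State) : |qscal x| ≤ ‖x‖ := norm_le_pi_norm x (Sum.inr (Sum.inl 0))

theorem norm_angvel_le (x : State) : ‖angvel x‖ ≤ ‖x‖ :=
  (pi_norm_le_iff_of_nonneg (norm_nonneg x)).2 fun i => norm_le_pi_norm x (Sum.inr (Sum.inr i))

theorem norm_state_le {x : State} {a : ℝ} (ha : 0 ≤ a) (h₁ : ‖qvec x‖ ≤ a) (h₂ : |qscal x| ≤ a)
    (h₃ : ‖angvel x‖ ≤ a) : ‖x‖ ≤ a := by
  refine (pi_norm_le_iff_of_nonneg ha).2 fun i => ?_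
  rcases i with i | i | i
  · exact (norm_le_pi_norm (qvec x) i).trans h₁
  · rw [Subsingleton.elim i 0]; exact h₂
  · exact (norm_le_pi_norm (angvel x) i).trans h₃

/-! ### Quadratic forms on `ℝ³` -/

theorem abs_dotProduct_le (a b : Vec3) : |a ⬝ᵥ b| ≤ 3 * ‖a‖ * ‖b‖ := by
  calc |a ⬝ᵥ b| ≤ ∑ i, |a i * b i| := Finset.abs_sum_le_sum_abs _ _
    _ ≤ ∑ _i : Fin 3, ‖a‖ * ‖b‖ := by
        refine Finset.sum_le_sum fun i _ => ?_
        rw [abs_mul]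
        gcongr
        · exact norm_le_pi_norm a i
        · exact norm_le_pi_norm b i
    _ = 3 * ‖a‖ * ‖b‖ := by simp; ring

theorem sq_norm_le_dotProduct (a : Vec3) : ‖a‖ ^ 2 ≤ a ⬝ᵥ a := by
  have h0 : 0 ≤ a ⬝ᵥ a := Finset.sum_nonneg fun i _ => mul_self_nonneg (a i)
  have h : ‖a‖ ≤ Real.sqrt (a ⬝ᵥ a) := by
    refine (pi_norm_le_iff_of_nonneg (Real.sqrt_nonneg _)).2 fun i => ?_
    rw [Real.norm_eq_abs]
    refine Real.abs_le_sqrt ?_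
    rw [pow_two]
    exact Finset.single_le_sum (f := fun i => a i * a i) (fun i _ => mul_self_nonneg _)
      (Finset.mem_univ i)
  calc ‖a‖ ^ 2 ≤ Real.sqrt (a ⬝ᵥ a) ^ 2 := by gcongr
    _ = a ⬝ᵥ a := Real.sq_sqrt h0

theorem exists_norm_mulVec_le (A : Matrix (Fin 3) (Fin 3) ℝ) :
    ∃ C, 0 ≤ C ∧ ∀ v : Vec3, ‖A *ᵥ v‖ ≤ C * ‖v‖ :=
  ⟨_, norm_nonneg _, fun v => (A.mulVecLin.toContinuousLinearMap).le_opNorm v⟩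

theorem Matrix.PosDef.exists_pos_mul_sq_norm_le {A : Matrix (Fin 3) (Fin 3) ℝ} (hA : A.PosDef) :
    ∃ c > 0, ∀ v : Vec3, c * ‖v‖ ^ 2 ≤ v ⬝ᵥ A *ᵥ v := by
  have hcont : Continuous fun v : Vec3 => v ⬝ᵥ A *ᵥ v := by fun_prop
  obtain ⟨v₀, hv₀, hmin⟩ := (isCompact_sphere (0 : Vec3) 1).exists_isMinOn
    (NormedSpace.sphere_nonempty.2 zero_le_one) hcont.continuousOn
  have hv₀' : ‖v₀‖ = 1 := by simpa using hv₀
  have hne : v₀ ≠ 0 := by intro h; simp [h] at hv₀'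
  refine ⟨v₀ ⬝ᵥ A *ᵥ v₀, by simpa using hA.dotProduct_mulVec_pos hne, fun v => ?_⟩
  by_cases hv : v = 0
  · simp [hv]
  · have hn : ‖v‖ ≠ 0 := norm_ne_zero_iff.2 hv
    have h1 := hmin (show ‖v‖⁻¹ • v ∈ Metric.sphere (0 : Vec3) 1 by
      simp [norm_smul, inv_mul_cancel₀ hn])
    simp only [mem_ofPred, Matrix.mulVec_smul, dotProduct_smul, smul_dotProduct, smul_eq_mul] at h1
    have h2 : v ⬝ᵥ A *ᵥ v = ‖v‖ ^ 2 * (‖v‖⁻¹ * (‖v‖⁻¹ * (v ⬝ᵥ A *ᵥ v))) := by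
      field_simp
    rw [h2, mul_comm]
    gcongr

theorem Matrix.PosDef.dotProduct_mulVec_comm {A : Matrix (Fin 3) (Fin 3) ℝ} (hA : A.PosDef)
    (v w : Vec3) : v ⬝ᵥ A *ᵥ w = w ⬝ᵥ A *ᵥ v := by
  have h : Aᵀ = A := by simpa [Matrix.IsHermitian] using hA.isHermitian.eq
  rw [Matrix.dotProduct_mulVec, dotProduct_comm, ← Matrix.mulVec_transpose, h]

theorem Matrix.PosDef.mulVec_inv_mulVec {A : Matrix (Fin 3) (Fin 3) ℝ} (hA : A.PosDef) (v : Vec3) :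
    A *ᵥ (A⁻¹ *ᵥ v) = v := by
  rw [Matrix.mulVec_mulVec, Matrix.mul_nonsing_inv _ ((Matrix.isUnit_iff_isUnit_det _).1 hA.isUnit),
    Matrix.one_mulVec]

/-! ### The error dynamics and the Hamiltonian -/

theorem dotProduct_skewS_mulVec_self (w x : Vec3) : w ⬝ᵥ skewS w *ᵥ x = 0 := by
  simp [dotProduct, Matrix.mulVec, skewS, Fin.sum_univ_three]
  ring

/-- The quaternion part of the dynamics is tangent to spheres. -/
theorem qvec_dotProduct_errField (M : Matrix (Fin 3) (Fin 3) ℝ) (u : Vec3) (x : State) :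
    qvec x ⬝ᵥ qvec (errField M u x) + qscal x * qscal (errField M u x) = 0 := by
  simp [errField, dotProduct, skewS, Fin.sum_univ_three, vecHead, vecTail]
  ring

/-- The kinetic energy changes by the power of the torque, the gyroscopic term being workless. -/
theorem angvel_dotProduct_errField {M : Matrix (Fin 3) (Fin 3) ℝ} (hM : M.PosDef) (u : Vec3)
    (x : State) : angvel x ⬝ᵥ M *ᵥ angvel (errField M u x) = angvel x ⬝ᵥ u := by
  rw [errField, angvel_mkState, hM.mulVec_inv_mulVec, dotProduct_add, dotProduct_skewS_mulVec_self,
    zero_add]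

theorem qscal_errField (M : Matrix (Fin 3) (Fin 3) ℝ) (u : Vec3) (x : State) :
    qscal (errField M u x) = -(1 / 2 : ℝ) * (angvel x ⬝ᵥ qvec x) := rfl

theorem hamD_eq (M : Matrix (Fin 3) (Fin 3) ℝ) (x : State) :
    hamD M x = (1 / 2 : ℝ) * ((x - zetaStar) ⬝ᵥ weightP M *ᵥ (x - zetaStar)) := by
  rw [hamD, weightP_mulVec, dotProduct_state]
  simp [pow_two]

theorem weightP_dotProduct_comm {M : Matrix (Fin 3) (Fin 3) ℝ} (hM : M.PosDef) (x y : State) :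
    x ⬝ᵥ weightP M *ᵥ y = y ⬝ᵥ weightP M *ᵥ x := by
  rw [weightP_mulVec, weightP_mulVec, dotProduct_state, dotProduct_state]
  simp only [qvec_mkState, qscal_mkState, angvel_mkState]
  rw [hM.dotProduct_mulVec_comm, dotProduct_comm, mul_comm]

/-- The discrete gradient of the quadratic function `hamD` reproduces its increments exactly. -/
theorem hamD_sub_hamD {M : Matrix (Fin 3) (Fin 3) ℝ} (hM : M.PosDef) (x y : State) :
    hamD M y - hamD M x = (y - x) ⬝ᵥ discGrad M x y := by
  obtain ⟨a, rfl⟩ : ∃ a, x = a + zetaStar := ⟨x - zetaStar, by abel⟩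
  obtain ⟨b, rfl⟩ : ∃ b, y = b + zetaStar := ⟨y - zetaStar, by abel⟩
  have h1 : b + zetaStar + (a + zetaStar) - (2 : ℝ) • zetaStar = b + a := by
    rw [two_smul]; abel
  rw [hamD_eq, hamD_eq, discGrad, h1, dotProduct_smul]
  simp only [add_sub_cancel_right, add_sub_add_right_eq_sub, Matrix.mulVec_add, dotProduct_add,
    sub_dotProduct, smul_eq_mul]
  rw [weightP_dotProduct_comm hM a b]
  ring

theorem exists_pos_mul_sq_norm_le_weightP {M : Matrix (Fin 3) (Fin 3) ℝ} (hM : M.PosDef) :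
    ∃ c > 0, ∀ x : State, c * ‖x‖ ^ 2 ≤ x ⬝ᵥ weightP M *ᵥ x := by
  obtain ⟨c, hc, h⟩ := hM.exists_pos_mul_sq_norm_le
  refine ⟨min c 1, by positivity, fun x => ?_⟩
  rw [weightP_mulVec, dotProduct_state]
  simp only [qvec_mkState, qscal_mkState, angvel_mkState]
  have h1 := sq_norm_le_dotProduct (qvec x)
  have h2 := h (angvel x)
  have h3 : min c 1 * ‖angvel x‖ ^ 2 ≤ c * ‖angvel x‖ ^ 2 := by gcongr; exact min_le_left _ _
  have h4 : min c 1 * ‖qvec x‖ ^ 2 ≤ 1 * ‖qvec x‖ ^ 2 := by gcongr; exact min_le_right _ _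
  have h5 : min c 1 * |qscal x| ^ 2 ≤ 1 * |qscal x| ^ 2 := by gcongr; exact min_le_right _ _
  rw [sq_abs] at h5
  have h6 : (0 : ℝ) ≤ min c 1 := by positivity
  have p1 : 0 ≤ min c 1 * ‖qvec x‖ ^ 2 := by positivity
  have p2 : 0 ≤ min c 1 * qscal x ^ 2 := by positivity
  have p3 : 0 ≤ min c 1 * ‖angvel x‖ ^ 2 := by positivity
  have hx : ‖x‖ ≤ max ‖qvec x‖ (max |qscal x| ‖angvel x‖) :=
    norm_state_le (by positivity) (le_max_left _ _)
      ((le_max_left _ _).trans (le_max_right _ _)) ((le_max_right _ _).trans (le_max_right _ _))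
  have hx2 : ‖x‖ ^ 2 ≤ ‖qvec x‖ ^ 2 + qscal x ^ 2 + ‖angvel x‖ ^ 2 := by
    have e1 := sq_nonneg ‖qvec x‖
    have e2 := sq_nonneg (qscal x)
    have e3 := sq_nonneg ‖angvel x‖
    rcases le_max_iff.1 hx with h | h
    · have : ‖x‖ ^ 2 ≤ ‖qvec x‖ ^ 2 := by gcongr
      linarith
    · rcases le_max_iff.1 h with h | h
      · have : ‖x‖ ^ 2 ≤ |qscal x| ^ 2 := by gcongr
        rw [sq_abs] at this
        linarith
      · have : ‖x‖ ^ 2 ≤ ‖angvel x‖ ^ 2 := by gcongr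
        linarith
  nlinarith

theorem exists_dotProduct_weightP_le (M : Matrix (Fin 3) (Fin 3) ℝ) :
    ∃ C > 0, ∀ x y : State, |x ⬝ᵥ weightP M *ᵥ y| ≤ C * ‖x‖ * ‖y‖ := by
  obtain ⟨C, hC, h⟩ := exists_norm_mulVec_le M
  refine ⟨4 + 3 * C, by positivity, fun x y => ?_⟩
  rw [weightP_mulVec, dotProduct_state]
  simp only [qvec_mkState, qscal_mkState, angvel_mkState]
  have h1 := abs_dotProduct_le (qvec x) (qvec y)
  have h2 := abs_dotProduct_le (angvel x) (M *ᵥ angvel y)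
  have h3 : |qvec x ⬝ᵥ qvec y| ≤ 3 * ‖x‖ * ‖y‖ := h1.trans (by
    gcongr
    · exact norm_qvec_le x
    · exact norm_qvec_le y)
  have h4 : |angvel x ⬝ᵥ M *ᵥ angvel y| ≤ 3 * ‖x‖ * (C * ‖y‖) := h2.trans (by
    gcongr
    · exact norm_angvel_le x
    · exact (h _).trans (by gcongr; exact norm_angvel_le y))
  have h5 : |qscal x * qscal y| ≤ ‖x‖ * ‖y‖ := by
    rw [abs_mul]
    gcongr
    · exact abs_qscal_le x
    · exact abs_qscal_le y
  calc _ ≤ |qvec x ⬝ᵥ qvec y + qscal x * qscal y| + |angvel x ⬝ᵥ M *ᵥ angvel y| := abs_add_le _ _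
    _ ≤ |qvec x ⬝ᵥ qvec y| + |qscal x * qscal y| + |angvel x ⬝ᵥ M *ᵥ angvel y| := by
        gcongr; exact abs_add_le _ _
    _ ≤ 3 * ‖x‖ * ‖y‖ + ‖x‖ * ‖y‖ + 3 * ‖x‖ * (C * ‖y‖) := by gcongr
    _ = _ := by ring

theorem hamD_nonneg {M : Matrix (Fin 3) (Fin 3) ℝ} (hM : M.PosDef) (x : State) : 0 ≤ hamD M x := by
  obtain ⟨c, hc, h⟩ := exists_pos_mul_sq_norm_le_weightP hM
  rw [hamD_eq]
  have := h (x - zetaStar)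
  have : 0 ≤ c * ‖x - zetaStar‖ ^ 2 := by positivity
  linarith

/-! ### The flow of the error dynamics -/

/-- The drift of the error dynamics as a bilinear map evaluated on the diagonal: the drift is
homogeneous quadratic. -/
noncomputable def driftBilin (M : Matrix (Fin 3) (Fin 3) ℝ) : State →L[ℝ] State →L[ℝ] State :=
  LinearMap.toContinuousBilinearMap <| LinearMap.mk₂ ℝ
    (fun x y => mkState
      ((1 / 2 : ℝ) • (skewS (angvel x) *ᵥ qvec y) + (1 / 2 : ℝ) • (qscal y • angvel x))
      (-(1 / 2 : ℝ) * (angvel x ⬝ᵥ qvec y))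
      (M⁻¹ *ᵥ (skewS (angvel x) *ᵥ (M *ᵥ angvel y))))
    (fun x x' y => by
      have h : skewS (angvel x + angvel x') = skewS (angvel x) + skewS (angvel x') := by
        ext i j; fin_cases i <;> fin_cases j <;> simp [skewS] <;> ring
      refine state_ext ?_ ?_ ?_ <;>
        simp only [qvec_add, qscal_add, angvel_add, qvec_mkState, qscal_mkState, angvel_mkState, h,
          Matrix.add_mulVec, Matrix.mulVec_add, smul_add, add_dotProduct]
      · abel
      · ring)
    (fun c x y => by
      have h : skewS (c • angvel x) = c • skewS (angvel x) := by
        ext i j; fin_cases i <;> fin_cases j <;> simp [skewS]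
      refine state_ext ?_ ?_ ?_ <;>
        simp only [qvec_smul, qscal_smul, angvel_smul, qvec_mkState, qscal_mkState, angvel_mkState,
          h, Matrix.smul_mulVec, Matrix.mulVec_smul, smul_dotProduct, smul_eq_mul]
      · module
      · ring)
    (fun x y y' => by
      refine state_ext ?_ ?_ ?_ <;>
        simp only [qvec_add, qscal_add, angvel_add, qvec_mkState, qscal_mkState, angvel_mkState,
          Matrix.mulVec_add, dotProduct_add]
      · module
      · ring)
    (fun c x y => by
      refine state_ext ?_ ?_ ?_ <;>
        simp only [qvec_smul, qscal_smul, angvel_smul, qvec_mkState, qscal_mkState, angvel_mkState,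
          Matrix.mulVec_smul, dotProduct_smul, smul_eq_mul]
      · module
      · ring)

/-- The input vector fields of the error dynamics, as a linear map from torques to velocities. -/
noncomputable def inputMap (M : Matrix (Fin 3) (Fin 3) ℝ) : Vec3 →L[ℝ] State :=
  LinearMap.toContinuousLinearMap
    { toFun := fun u => mkState 0 0 (M⁻¹ *ᵥ u)
      map_add' := fun u v => state_ext (by simp) (by simp) (by simp [Matrix.mulVec_add])
      map_smul' := fun c u => state_ext (by simp) (by simp) (by simp [Matrix.mulVec_smul]) }

theorem inputMap_apply (M : Matrix (Fin 3) (Fin 3) ℝ) (u : Vec3) :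
    inputMap M u = mkState 0 0 (M⁻¹ *ᵥ u) := rfl

theorem errField_eq_add (M : Matrix (Fin 3) (Fin 3) ℝ) (u : Vec3) (x : State) :
    errField M u x = driftBilin M x x + inputMap M u := by
  refine state_ext ?_ ?_ ?_
  · simp [errField, driftBilin, inputMap_apply]
  · simp [errField, driftBilin, inputMap_apply]
  · change M⁻¹ *ᵥ _ = M⁻¹ *ᵥ _ + M⁻¹ *ᵥ _
    rw [Matrix.mulVec_add]

theorem contDiff_errField (M : Matrix (Fin 3) (Fin 3) ℝ) (u : Vec3) {n : ℕ∞ω} :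
    ContDiff ℝ n (errField M u) := by
  have : errField M u = fun x => driftBilin M x x + inputMap M u :=
    funext fun x => errField_eq_add M u x
  rw [this]
  fun_prop

/-- Trajectories exist for all times: along them the kinetic energy grows at most exponentially and
the quaternion keeps its norm. -/
theorem exists_isTrajectory {M : Matrix (Fin 3) (Fin 3) ℝ} (hM : M.PosDef) (u : Vec3) (ζ : State) :
    ∃ x : ℝ → State, x 0 = ζ ∧ IsTrajectory M u x := by
  obtain ⟨c, hc, hcM⟩ := hM.exists_pos_mul_sq_norm_le
  set G : State → ℝ := fun x =>
    1 + (qvec x ⬝ᵥ qvec x + qscal x ^ 2) + angvel x ⬝ᵥ M *ᵥ angvel x with hG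
  have hGd : ∀ x y, HasFDerivAt G (fderiv ℝ G x) x ∧ fderiv ℝ G x y =
      2 * (qvec x ⬝ᵥ qvec y + qscal x * qscal y) + 2 * (angvel x ⬝ᵥ M *ᵥ angvel y) := by
    intro x y
    have hd : Differentiable ℝ G := by
      have : ContDiff ℝ 1 G := by
        have h1 : ContDiff ℝ 1 fun x : State => qvec x ⬝ᵥ qvec x := by
          simp only [dotProduct]; fun_prop
        have h2 : ContDiff ℝ 1 fun x : State => angvel x ⬝ᵥ M *ᵥ angvel x := by
          simp only [dotProduct, Matrix.mulVec]; fun_prop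
        fun_prop
      exact this.differentiable one_ne_zero
    refine ⟨(hd x).hasFDerivAt, ?_⟩
    have h1 : HasDerivAt (fun t : ℝ => G (x + t • y)) (fderiv ℝ G x y) 0 := by
      have h0 : HasDerivAt (fun t : ℝ => x + t • y) y 0 := by
        simpa using ((hasDerivAt_id (0 : ℝ)).smul_const y).const_add x
      have := (hd (x + (0 : ℝ) • y)).hasFDerivAt.comp_hasDerivAt (0 : ℝ) h0
      rw [zero_smul, add_zero] at this
      exact this
    have h2 : (fun t : ℝ => G (x + t • y)) = fun t => G x + t * (2 * (qvec x ⬝ᵥ qvec y +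
        qscal x * qscal y) + 2 * (angvel x ⬝ᵥ M *ᵥ angvel y)) + t ^ 2 * (qvec y ⬝ᵥ qvec y +
        qscal y ^ 2 + angvel y ⬝ᵥ M *ᵥ angvel y) := by
      funext t
      simp only [hG, qvec_add, qvec_smul, qscal_add, qscal_smul, angvel_add, angvel_smul,
        Matrix.mulVec_add, Matrix.mulVec_smul, dotProduct_add, add_dotProduct, smul_dotProduct,
        dotProduct_smul, smul_eq_mul]
      rw [hM.dotProduct_mulVec_comm (angvel y) (angvel x), dotProduct_comm (qvec y) (qvec x)]
      ring
    rw [h2] at h1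
    refine h1.unique ?_
    have h3 := (((hasDerivAt_id (0 : ℝ)).mul_const (2 * (qvec x ⬝ᵥ qvec y +
        qscal x * qscal y) + 2 * (angvel x ⬝ᵥ M *ᵥ angvel y))).const_add (G x)).add
        (((hasDerivAt_id (0 : ℝ)).pow 2).mul_const (qvec y ⬝ᵥ qvec y +
        qscal y ^ 2 + angvel y ⬝ᵥ M *ᵥ angvel y))
    convert! h3 using 1
    simp
  have hlow : ∀ x, 1 + ‖qvec x‖ ^ 2 + qscal x ^ 2 + c * ‖angvel x‖ ^ 2 ≤ G x := by
    intro x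
    have h1 := sq_norm_le_dotProduct (qvec x)
    have h2 := hcM (angvel x)
    simp only [hG]
    linarith
  refine exists_hasDerivAt_of_proper_bound (contDiff_errField M u) (G := G)
    (fun x => (hGd x 0).1.differentiableAt) (C := 3 * ‖u‖ * (1 + 1 / c)) (by positivity)
    (fun x => le_trans (by positivity) (hlow x)) ?_ ?_ ζ
  · intro x
    rw [(hGd x _).2, qvec_dotProduct_errField, angvel_dotProduct_errField hM, mul_zero, zero_add,
      abs_mul, abs_two]
    have h1 := abs_dotProduct_le (angvel x) u
    have h2 : 2 * ‖angvel x‖ ≤ 1 + ‖angvel x‖ ^ 2 := by nlinarith [sq_nonneg (‖angvel x‖ - 1)]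
    have h3 : 1 + ‖angvel x‖ ^ 2 ≤ (1 + 1 / c) * G x := by
      have h4 := hlow x
      have h5 : 0 ≤ ‖qvec x‖ ^ 2 := by positivity
      have h6 : 0 ≤ qscal x ^ 2 := by positivity
      have h8 : 0 ≤ c * ‖angvel x‖ ^ 2 := by positivity
      have h7 : 1 / c * (c * ‖angvel x‖ ^ 2) ≤ 1 / c * G x := by gcongr; linarith
      have h9 : 1 / c * (c * ‖angvel x‖ ^ 2) = ‖angvel x‖ ^ 2 := by field_simp
      nlinarith
    calc 2 * |angvel x ⬝ᵥ u| ≤ 2 * (3 * ‖angvel x‖ * ‖u‖) := by gcongr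
      _ = 3 * ‖u‖ * (2 * ‖angvel x‖) := by ring
      _ ≤ 3 * ‖u‖ * ((1 + 1 / c) * G x) :=
          mul_le_mul_of_nonneg_left (h2.trans h3) (by positivity)
      _ = _ := by ring
  · intro A
    refine ⟨|A| * (1 + 1 / c) + 1, fun x hx => ?_⟩
    have h4 := hlow x
    have h5 : 0 ≤ ‖qvec x‖ ^ 2 := by positivity
    have h6 : 0 ≤ qscal x ^ 2 := by positivity
    have h8 : 0 ≤ c * ‖angvel x‖ ^ 2 := by positivity
    have hA := le_abs_self A
    have hA0 := abs_nonneg A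
    have hc1 : 0 < 1 / c := by positivity
    have key : ∀ a : ℝ, 0 ≤ a → a ^ 2 ≤ |A| * (1 + 1 / c) → a ≤ |A| * (1 + 1 / c) + 1 := by
      intro a ha h
      nlinarith [sq_nonneg (a - 1)]
    refine norm_state_le (by positivity) (key _ (norm_nonneg _) ?_) (key _ (abs_nonneg _) ?_)
      (key _ (norm_nonneg _) ?_)
    · nlinarith
    · rw [sq_abs]; nlinarith
    · have h7 : 1 / c * (c * ‖angvel x‖ ^ 2) ≤ 1 / c * |A| := by gcongr; linarith
      have h9 : 1 / c * (c * ‖angvel x‖ ^ 2) = ‖angvel x‖ ^ 2 := by field_simp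
      nlinarith

theorem flow_zero {M : Matrix (Fin 3) (Fin 3) ℝ} (hM : M.PosDef) (u : Vec3) (ζ : State) :
    flow M u ζ 0 = ζ := by
  have h := exists_isTrajectory hM u ζ
  rw [flow, dif_pos h]
  exact (Classical.choose_spec h).1

theorem isTrajectory_flow {M : Matrix (Fin 3) (Fin 3) ℝ} (hM : M.PosDef) (u : Vec3) (ζ : State) :
    IsTrajectory M u (flow M u ζ) := by
  have h := exists_isTrajectory hM u ζ
  have h1 : flow M u ζ = Classical.choose h := by
    funext t; rw [flow, dif_pos h]
  rw [h1]
  exact (Classical.choose_spec h).2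

theorem continuous_flow {M : Matrix (Fin 3) (Fin 3) ℝ} (hM : M.PosDef) (u : Vec3) (ζ : State) :
    Continuous (flow M u ζ) :=
  continuous_iff_continuousAt.2 fun t => (isTrajectory_flow hM u ζ t).continuousAt

/-- A trajectory, run at speed `δ`, solves the quadratic integral equation on `[0, 1]`. -/
theorem IsTrajectory.quadEq_eq_zero {M : Matrix (Fin 3) (Fin 3) ℝ} {u : Vec3} {x : ℝ → State}
    (hx : IsTrajectory M u x) (δ : ℝ) (y : C(unitInterval, State))
    (hy : ∀ t : unitInterval, y t = x (δ * t)) :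
    quadEq (driftBilin M) ((δ, δ • inputMap M u, x 0), y) = 0 := by
  have h : ∀ t, HasDerivAt (fun s => x (δ * s))
      (δ • driftBilin M (x (δ * t)) (x (δ * t)) + δ • inputMap M u) t := by
    intro t
    rw [← smul_add, ← errField_eq_add]
    have h1 : HasDerivAt (fun s : ℝ => δ * s) δ t := by simpa using (hasDerivAt_id t).const_mul δ
    exact (hx (δ * t)).scomp t h1
  have := quadEq_of_hasDerivAt (driftBilin M) h y hy
  simpa using this

theorem IsTrajectory.continuous {M : Matrix (Fin 3) (Fin 3) ℝ} {u : Vec3} {x : ℝ → State}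
    (hx : IsTrajectory M u x) : Continuous x :=
  continuous_iff_continuousAt.2 fun t => (hx t).continuousAt

theorem IsTrajectory.unique {M : Matrix (Fin 3) (Fin 3) ℝ} {u : Vec3} {x y : ℝ → State}
    (hx : IsTrajectory M u x) (hy : IsTrajectory M u y) (h0 : x 0 = y 0) : x = y := by
  funext t
  have hxc := hx.continuous
  have hyc := hy.continuous
  let X : C(unitInterval, State) := ⟨fun s => x (t * s), by fun_prop⟩
  let Y : C(unitInterval, State) := ⟨fun s => y (t * s), by fun_prop⟩
  have h1 := hx.quadEq_eq_zero t X fun _ => rfl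
  have h2 := hy.quadEq_eq_zero t Y fun _ => rfl
  rw [h0] at h1
  have h3 := congrArg (fun Z : C(unitInterval, State) => Z 1) (quadEq_unique _ h1 h2)
  simpa [X, Y] using h3

theorem flow_flow {M : Matrix (Fin 3) (Fin 3) ℝ} (hM : M.PosDef) (u : Vec3) (ζ : State) (s t : ℝ) :
    flow M u (flow M u ζ s) t = flow M u ζ (s + t) := by
  have h : IsTrajectory M u fun t => flow M u ζ (s + t) := fun t =>
    (isTrajectory_flow hM u ζ (s + t)).comp_const_add s t
  exact congrFun ((isTrajectory_flow hM u _).unique h (by simp [flow_zero hM])) t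

/-- The flow preserves the norm of the quaternion. -/
theorem flow_mem_unitStates {M : Matrix (Fin 3) (Fin 3) ℝ} (hM : M.PosDef) (u : Vec3) {ζ : State}
    (hζ : ζ ∈ unitStates) (t : ℝ) : flow M u ζ t ∈ unitStates := by
  have hd : ∀ t, HasDerivAt (fun t => qvec (flow M u ζ t) ⬝ᵥ qvec (flow M u ζ t) +
      qscal (flow M u ζ t) ^ 2) 0 t := by
    intro t
    have h := isTrajectory_flow hM u ζ t
    have h1 : ∀ i, HasDerivAt (fun t => qvec (flow M u ζ t) i)
        (qvec (errField M u (flow M u ζ t)) i) t := fun i => (hasDerivAt_pi.1 h) (Sum.inl i)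
    have h2 : HasDerivAt (fun t => qscal (flow M u ζ t))
        (qscal (errField M u (flow M u ζ t))) t := (hasDerivAt_pi.1 h) (Sum.inr (Sum.inl 0))
    have h3 := (HasDerivAt.fun_sum (u := Finset.univ) fun i _ => (h1 i).mul (h1 i)).add (h2.pow 2)
    convert! h3 using 1
    have h4 := qvec_dotProduct_errField M u (flow M u ζ t)
    simp only [dotProduct] at h4
    simp only [Nat.cast_ofNat, Nat.add_one_sub_one, pow_one]
    rw [mul_assoc, ← mul_zero (2 : ℝ), ← h4, mul_add, Finset.mul_sum]
    congr 1
    exact Finset.sum_congr rfl fun i _ => by ring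
  have h1 := is_const_of_deriv_eq_zero (fun t => (hd t).differentiableAt)
    (fun t => (hd t).deriv) t 0
  simp only [flow_zero hM] at h1
  simp only [unitStates, mem_ofPred] at hζ ⊢
  rw [h1, hζ]

theorem nextState_eq_add_smul_sampledF {M : Matrix (Fin 3) (Fin 3) ℝ} (hM : M.PosDef) (δ : ℝ)
    (ζ : State) (u : Vec3) : nextState M δ ζ u = ζ + δ • sampledF M δ ζ u := by
  have hc : Continuous (flow M u ζ) := continuous_flow hM u ζ
  have he : Continuous (errField M u) := (contDiff_errField M u (n := 0)).continuous
  have h1 : ∀ s ∈ uIcc (0 : ℝ) 1, HasDerivAt (fun s => flow M u ζ (δ * s))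
      (δ • errField M u (flow M u ζ (δ * s))) s := by
    intro s _
    have h1 : HasDerivAt (fun s : ℝ => δ * s) δ s := by simpa using (hasDerivAt_id s).const_mul δ
    exact (isTrajectory_flow hM u ζ (δ * s)).scomp s h1
  have h2 := intervalIntegral.integral_eq_sub_of_hasDerivAt h1
    (Continuous.intervalIntegrable (by fun_prop) _ _)
  rw [intervalIntegral.integral_smul] at h2
  simp only [mul_one, mul_zero, flow_zero hM] at h2
  rw [nextState, sampledF, h2]
  abel

theorem sampledF_zero {M : Matrix (Fin 3) (Fin 3) ℝ} (hM : M.PosDef) (ζ : State) (u : Vec3) :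
    sampledF M 0 ζ u = errField M u ζ := by
  simp [sampledF, flow_zero hM]

/-- The sampled velocity is the input velocity plus an analytic function of the period `δ`, of the
impulse `δ u` and of the state. That the input enters the second term only through `δ u` is what
makes the damping equality uniquely solvable among all inputs, and not only the bounded ones. -/
theorem exists_contDiff_sampledF_eq {M : Matrix (Fin 3) (Fin 3) ℝ} (hM : M.PosDef) :
    ∃ Q : ℝ × Vec3 × State → State, ContDiff ℝ ω Q ∧
      ∀ δ ζ u, sampledF M δ ζ u = Q (δ, δ • u, ζ) + inputMap M u := by
  have hex : ∀ p : ℝ × Vec3 × State, ∃ y : C(unitInterval, State),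
      quadEq (driftBilin M) ((p.1, inputMap M p.2.1, p.2.2), y) = 0 := by
    rintro ⟨δ, β, ζ⟩
    by_cases hδ : δ = 0
    · subst hδ
      have := quadEq_of_hasDerivAt (driftBilin M) (δ := 0) (c := inputMap M β)
        (x := fun t => ζ + t • inputMap M β) (fun t => by
          simpa using ((hasDerivAt_id t).smul_const (inputMap M β)).const_add ζ)
        ⟨fun s => ζ + (s : ℝ) • inputMap M β, by fun_prop⟩ fun _ => rfl
      exact ⟨_, by simpa using this⟩
    · have hc := continuous_flow hM (δ⁻¹ • β) ζ
      have := (isTrajectory_flow hM (δ⁻¹ • β) ζ).quadEq_eq_zero δ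
        ⟨fun s => flow M (δ⁻¹ • β) ζ (δ * s), by fun_prop⟩ fun _ => rfl
      rw [← map_smul, smul_inv_smul₀ hδ, flow_zero hM] at this
      exact ⟨_, this⟩
  choose Y hY using hex
  have hYc : ContDiff ℝ ω Y := contDiff_quadEq_solution (driftBilin M)
    (par := fun p : ℝ × Vec3 × State => (p.1, inputMap M p.2.1, p.2.2)) (by fun_prop) hY
  refine ⟨fun p => ContinuousMap.evalCLM ℝ (1 : unitInterval)
    (volterra State (curveBilin (driftBilin M) (Y p) (Y p))), by fun_prop, fun δ ζ u => ?_⟩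
  have hc := continuous_flow hM u ζ
  let X : C(unitInterval, State) := ⟨fun s => flow M u ζ (δ * s), by fun_prop⟩
  have hX := (isTrajectory_flow hM u ζ).quadEq_eq_zero δ X fun _ => rfl
  rw [flow_zero hM, ← map_smul] at hX
  have hXY : Y (δ, δ • u, ζ) = X := quadEq_unique _ (hY (δ, δ • u, ζ)) hX
  change _ = volterra State (curveBilin (driftBilin M) (Y (δ, δ • u, ζ)) (Y (δ, δ • u, ζ))) 1 + _
  rw [hXY, volterra_apply, sampledF]
  have h1 : ∀ s ∈ uIcc (0 : ℝ) 1, IccExtend zero_le_one (curveBilin (driftBilin M) X X) s =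
      driftBilin M (flow M u ζ (δ * s)) (flow M u ζ (δ * s)) := by
    intro s hs
    rw [uIcc_of_le zero_le_one] at hs
    rw [IccExtend_of_mem _ _ hs]
    rfl
  have h2 : ((1 : unitInterval) : ℝ) = 1 := rfl
  rw [h2, intervalIntegral.integral_congr h1]
  simp only [errField_eq_add]
  rw [intervalIntegral.integral_add (Continuous.intervalIntegrable (by fun_prop) _ _)
    (Continuous.intervalIntegrable (by fun_prop) _ _)]
  simp

theorem contDiff_sampledF {M : Matrix (Fin 3) (Fin 3) ℝ} (hM : M.PosDef) {n : ℕ∞ω} :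
    ContDiff ℝ n fun p : ℝ × State × Vec3 => sampledF M p.1 p.2.1 p.2.2 := by
  obtain ⟨Q, hQ, h⟩ := exists_contDiff_sampledF_eq hM
  simp only [h]
  have : ContDiff ℝ ω fun p : ℝ × State × Vec3 =>
      Q (p.1, p.1 • p.2.2, p.2.1) + inputMap M p.2.2 := by fun_prop
  exact this.of_le le_top

/-! ### Time reversal -/

/-- The reversal of the angular velocity, which conjugates the flow to its inverse. -/
def revVel (x : State) : State := mkState (qvec x) (qscal x) (-angvel x)

/-- The reversal of the angular velocity as a continuous linear map. -/
noncomputable def revVelL : State →L[ℝ] State :=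
  LinearMap.toContinuousLinearMap
    { toFun := revVel
      map_add' := fun x y => state_ext rfl rfl (by simp [revVel]; abel)
      map_smul' := fun c x => state_ext rfl rfl (by simp [revVel]) }

theorem errField_revVel (M : Matrix (Fin 3) (Fin 3) ℝ) (u : Vec3) (x : State) :
    errField M u (revVel x) = -revVel (errField M u x) := by
  have h : skewS (-angvel x) = -skewS (angvel x) := by
    ext i j; fin_cases i <;> fin_cases j <;> simp [skewS]
  refine state_ext ?_ ?_ ?_
  · change _ = -((1 / 2 : ℝ) • _ + (1 / 2 : ℝ) • _)
    simp only [errField, revVel, qvec_mkState, qscal_mkState, angvel_mkState, h, Matrix.neg_mulVec]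
    module
  · change _ = -(-(1 / 2 : ℝ) * _)
    simp only [errField, revVel, qvec_mkState, qscal_mkState, angvel_mkState, neg_dotProduct]
    ring
  · change _ = -(-(M⁻¹ *ᵥ _))
    simp only [errField, revVel, qvec_mkState, qscal_mkState, angvel_mkState, h, Matrix.neg_mulVec,
      Matrix.mulVec_neg, neg_neg]

theorem flow_revVel {M : Matrix (Fin 3) (Fin 3) ℝ} (hM : M.PosDef) (u : Vec3) (ζ : State) (t : ℝ) :
    flow M u (revVel ζ) (-t) = revVel (flow M u ζ t) := by
  have h : IsTrajectory M u fun t => revVelL (flow M u ζ (-t)) := by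
    intro t
    have h1 := (revVelL.hasFDerivAt.comp_hasDerivAt t
      ((isTrajectory_flow hM u ζ (-t)).scomp t (hasDerivAt_neg t)))
    have h2 : errField M u (revVelL (flow M u ζ (-t))) =
        revVelL ((-1 : ℝ) • errField M u (flow M u ζ (-t))) := by
      rw [map_smul, neg_one_smul]
      exact errField_revVel M u _
    rw [h2]
    exact h1
  have := congrFun ((isTrajectory_flow hM u (revVel ζ)).unique h
    (by simp only [neg_zero, flow_zero hM]; rfl)) (-t)
  rw [neg_neg] at this
  exact this

theorem sampledF_revVel {M : Matrix (Fin 3) (Fin 3) ℝ} (hM : M.PosDef) (δ : ℝ) (ζ : State)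
    (u : Vec3) : sampledF M (-δ) (revVel ζ) u = -revVel (sampledF M δ ζ u) := by
  have hc := continuous_flow hM u ζ
  have he : Continuous (errField M u) := (contDiff_errField M u (n := 0)).continuous
  have h1 : revVel (sampledF M δ ζ u) =
      ∫ τ in (0 : ℝ)..1, revVelL (errField M u (flow M u ζ (δ * τ))) :=
    (revVelL.intervalIntegral_comp_comm (μ := MeasureTheory.volume)
      (Continuous.intervalIntegrable (by fun_prop) _ _)).symm
  rw [h1, sampledF, ← intervalIntegral.integral_neg]
  refine intervalIntegral.integral_congr fun τ _ => ?_
  simp only [neg_mul, flow_revVel hM, errField_revVel]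
  rfl

/-! ### Port-Hamiltonian form and energy balance -/

theorem contDiff_sampledF_input {M : Matrix (Fin 3) (Fin 3) ℝ} (hM : M.PosDef) (δ : ℝ) (ζ : State)
    {n : ℕ∞ω} : ContDiff ℝ n fun u => sampledF M δ ζ u := by
  obtain ⟨Q, hQ, h⟩ := exists_contDiff_sampledF_eq hM
  simp only [h]
  have : ContDiff ℝ ω fun u : Vec3 => Q (δ, δ • u, ζ) + inputMap M u := by fun_prop
  exact this.of_le le_top

theorem gD_mulVec_eq {M : Matrix (Fin 3) (Fin 3) ℝ} (hM : M.PosDef) (δ : ℝ) (ζ : State)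
    (ues v w : Vec3) : gD M δ ζ ues v *ᵥ w =
      (∫ s in (0 : ℝ)..1, fderiv ℝ (fun u => sampledF M δ ζ u) (ues + s • v)) w := by
  have hc : Continuous fun s : ℝ => fderiv ℝ (fun u => sampledF M δ ζ u) (ues + s • v) :=
    ((contDiff_sampledF_input hM δ ζ (n := 1)).continuous_fderiv one_ne_zero).comp (by fun_prop)
  set g := ∫ s in (0 : ℝ)..1, fderiv ℝ (fun u => sampledF M δ ζ u) (ues + s • v)
  have h1 : ∀ i j, gD M δ ζ ues v i j = g (Pi.single j 1) i := by
    intro i j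
    have := ((ContinuousLinearMap.proj (R := ℝ) (φ := fun _ : Idx => ℝ) i) ∘L
      (ContinuousLinearMap.apply ℝ State (Pi.single j (1 : ℝ) : Vec3))).intervalIntegral_comp_comm
        (μ := MeasureTheory.volume) (hc.intervalIntegrable 0 1)
    exact this
  ext i
  have hw : w = ∑ j, w j • (Pi.single j 1 : Vec3) := by
    ext k; simp [Finset.sum_apply, Pi.single_apply]
  conv_rhs => rw [hw, map_sum, Finset.sum_apply]
  simp only [Matrix.mulVec, dotProduct, h1, map_smul, Pi.smul_apply, smul_eq_mul]
  exact Finset.sum_congr rfl fun j _ => mul_comm _ _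

/-- The control matrix factors the increments of the sampled velocity. -/
theorem gD_mulVec_self {M : Matrix (Fin 3) (Fin 3) ℝ} (hM : M.PosDef) (δ : ℝ) (ζ : State)
    (ues v : Vec3) : gD M δ ζ ues v *ᵥ v = sampledF M δ ζ (ues + v) - sampledF M δ ζ ues := by
  have hs := contDiff_sampledF_input hM δ ζ (n := 1)
  have hc : Continuous fun s : ℝ => fderiv ℝ (fun u => sampledF M δ ζ u) (ues + s • v) :=
    (hs.continuous_fderiv one_ne_zero).comp (by fun_prop)
  have h1 : ∀ s ∈ uIcc (0 : ℝ) 1, HasDerivAt (fun s : ℝ => sampledF M δ ζ (ues + s • v))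
      (fderiv ℝ (fun u => sampledF M δ ζ u) (ues + s • v) v) s := by
    intro s _
    have h2 : HasDerivAt (fun s : ℝ => ues + s • v) v s := by
      simpa using ((hasDerivAt_id s).smul_const v).const_add ues
    exact ((hs.differentiable one_ne_zero) (ues + s • v)).hasFDerivAt.comp_hasDerivAt s h2
  have h2 := intervalIntegral.integral_eq_sub_of_hasDerivAt h1
    (Continuous.intervalIntegrable (by fun_prop) _ _)
  rw [gD_mulVec_eq hM, ContinuousLinearMap.intervalIntegral_apply
    (hc.intervalIntegrable 0 1), h2]
  simp

theorem dotProduct_outputY (M : Matrix (Fin 3) (Fin 3) ℝ) (δ : ℝ) (ζ : State) (ues v w : Vec3) :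
    w ⬝ᵥ outputY M δ ζ ues v = (gD M δ ζ ues v *ᵥ w) ⬝ᵥ
      discGrad M (nextState M δ ζ ues) (nextState M δ ζ (ues + v)) := by
  rw [outputY, Matrix.mulVec_transpose, dotProduct_comm, ← Matrix.dotProduct_mulVec,
    dotProduct_comm]

theorem discGrad_nextState {M : Matrix (Fin 3) (Fin 3) ℝ} (hM : M.PosDef) (δ : ℝ) (ζ : State)
    (u : Vec3) : discGrad M ζ (nextState M δ ζ u) =
      weightP M *ᵥ (ζ - zetaStar + (δ / 2) • sampledF M δ ζ u) := by
  rw [nextState_eq_add_smul_sampledF hM, discGrad, ← Matrix.mulVec_smul]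
  congr 1
  module

theorem dotProduct_mulVec_self_eq_zero_of_transpose_eq_neg {J : Matrix Idx Idx ℝ} (hJ : Jᵀ = -J)
    (x : State) : (J *ᵥ x) ⬝ᵥ x = 0 := by
  have h : (J *ᵥ x) ⬝ᵥ x = -((J *ᵥ x) ⬝ᵥ x) := by
    conv_lhs => rw [dotProduct_comm, Matrix.dotProduct_mulVec, ← Matrix.mulVec_transpose, hJ,
      Matrix.neg_mulVec, neg_dotProduct]
  linarith

theorem SolvesMatching.dotProduct_eq_zero {M : Matrix (Fin 3) (Fin 3) ℝ} {δ : ℝ} {ζ : State}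
    {ues : Vec3} {J : Matrix Idx Idx ℝ} (h : SolvesMatching M δ ζ ues J) :
    sampledF M δ ζ ues ⬝ᵥ (weightP M *ᵥ (ζ - zetaStar + (δ / 2) • sampledF M δ ζ ues)) = 0 := by
  have := dotProduct_mulVec_self_eq_zero_of_transpose_eq_neg h.1
    (weightP M *ᵥ (ζ - zetaStar + (δ / 2) • sampledF M δ ζ ues))
  rwa [h.2] at this

theorem nextState_eq_of_solvesMatching {M : Matrix (Fin 3) (Fin 3) ℝ} (hM : M.PosDef) {δ : ℝ}
    {ζ : State} {ues : Vec3} {J : Matrix Idx Idx ℝ} (h : SolvesMatching M δ ζ ues J) (v : Vec3) :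
    nextState M δ ζ (ues + v) = ζ + δ • (J *ᵥ discGrad M ζ (nextState M δ ζ ues)) +
      δ • (gD M δ ζ ues v *ᵥ v) := by
  rw [discGrad_nextState hM, h.2, gD_mulVec_self hM, nextState_eq_add_smul_sampledF hM]
  module

/-- Increments of the Hamiltonian under the energy-shaping feedback alone vanish by skew-symmetry;
the rest is the discrete gradient along the increment caused by `v`. -/
theorem hamD_nextState_sub_hamD {M : Matrix (Fin 3) (Fin 3) ℝ} (hM : M.PosDef) {δ : ℝ}
    {ζ : State} {ues : Vec3} {J : Matrix Idx Idx ℝ} (h : SolvesMatching M δ ζ ues J) (v : Vec3) :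
    hamD M (nextState M δ ζ (ues + v)) - hamD M ζ = δ * (v ⬝ᵥ outputY M δ ζ ues v) := by
  have h1 : hamD M (nextState M δ ζ ues) - hamD M ζ = 0 := by
    rw [hamD_sub_hamD hM, discGrad_nextState hM, nextState_eq_add_smul_sampledF hM,
      add_sub_cancel_left, smul_dotProduct, h.dotProduct_eq_zero, smul_zero]
  have h2 : nextState M δ ζ (ues + v) - nextState M δ ζ ues = δ • (gD M δ ζ ues v *ᵥ v) := by
    rw [gD_mulVec_self hM, nextState_eq_add_smul_sampledF hM, nextState_eq_add_smul_sampledF hM]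
    module
  have h3 := hamD_sub_hamD hM (nextState M δ ζ ues) (nextState M δ ζ (ues + v))
  rw [h2, smul_dotProduct, ← dotProduct_outputY, smul_eq_mul] at h3
  linarith

/-! ### The damping equality -/

/-- The conjugate output is an analytic function of the period, of the state and of the impulses
`δ ues` and `δ v`, equal to the angular velocity at period and impulses zero. -/
theorem exists_analyticAt_outputY_eq {M : Matrix (Fin 3) (Fin 3) ℝ} (hM : M.PosDef) :
    ∃ Y : ℝ × State × Vec3 × Vec3 → Vec3, (∀ ζ₀, AnalyticAt ℝ Y (0, ζ₀, 0, 0)) ∧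
      (∀ ζ, Y (0, ζ, 0, 0) = angvel ζ) ∧
      ∀ δ ζ ues v, outputY M δ ζ ues v = Y (δ, ζ, δ • ues, δ • v) := by
  obtain ⟨Q, hQ, hsF⟩ := exists_contDiff_sampledF_eq hM
  -- the derivative of `Q` in the impulse
  set R : ℝ × State × Vec3 → Vec3 →L[ℝ] State := fun q =>
    (fderiv ℝ Q (q.1, q.2.2, q.2.1)) ∘L
      (ContinuousLinearMap.inr ℝ ℝ (Vec3 × State) ∘L ContinuousLinearMap.inl ℝ Vec3 State) with hR
  have hRan : ∀ q, AnalyticAt ℝ R q := by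
    intro q
    have h1 : ContDiff ℝ ω (fderiv ℝ Q) := hQ.fderiv_right le_top
    have h2 : ContDiff ℝ ω R := by
      rw [hR]
      fun_prop
    exact h2.contDiffAt.analyticAt
  have hRc : Continuous R := continuous_iff_continuousAt.2 fun q => (hRan q).continuousAt
  let A : ℝ × State × Vec3 × Vec3 →L[ℝ] ℝ × State × Vec3 :=
    (ContinuousLinearMap.fst ℝ _ _).prod
      (((ContinuousLinearMap.fst ℝ _ _) ∘L (ContinuousLinearMap.snd ℝ _ _)).prod
        ((ContinuousLinearMap.fst ℝ _ _) ∘L (ContinuousLinearMap.snd ℝ _ _) ∘L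
          (ContinuousLinearMap.snd ℝ _ _)))
  let B : ℝ × State × Vec3 × Vec3 →L[ℝ] ℝ × State × Vec3 :=
    (0 : ℝ × State × Vec3 × Vec3 →L[ℝ] ℝ).prod
      ((0 : ℝ × State × Vec3 × Vec3 →L[ℝ] State).prod
        ((ContinuousLinearMap.snd ℝ _ _) ∘L (ContinuousLinearMap.snd ℝ _ _) ∘L
          (ContinuousLinearMap.snd ℝ _ _)))
  set I : ℝ × State × Vec3 × Vec3 → Vec3 →L[ℝ] State := fun q =>
    ∫ s in (0 : ℝ)..1, R (q.1, q.2.1, q.2.2.1 + s • q.2.2.2) with hI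
  have hIan : ∀ ζ₀, AnalyticAt ℝ I (0, ζ₀, 0, 0) := by
    intro ζ₀
    have := AnalyticAt.intervalIntegral_comp_affine A B (0, ζ₀, 0, 0) (hRan (0, ζ₀, 0))
    refine this.congr (Eventually.of_forall fun q => ?_)
    simp only [hI]
    refine intervalIntegral.integral_congr fun s _ => ?_
    have : ((0, ζ₀, 0) : ℝ × State × Vec3) + (A + s • B) (q - (0, ζ₀, 0, 0)) =
        (q.1, q.2.1, q.2.2.1 + s • q.2.2.2) := by
      simp [A, B]
    simp only [this]
  set D : ℝ × State × Vec3 × Vec3 → State := fun q => (1 / 2 : ℝ) • (weightP M *ᵥ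
    ((q.2.1 + (q.1 • Q (q.1, q.2.2.1 + q.2.2.2, q.2.1) + inputMap M (q.2.2.1 + q.2.2.2))) +
      (q.2.1 + (q.1 • Q (q.1, q.2.2.1, q.2.1) + inputMap M q.2.2.1)) - (2 : ℝ) • zetaStar))
    with hD
  have hDan : ContDiff ℝ ω D := by
    have h1 : ∀ f : ℝ × State × Vec3 × Vec3 → State, ContDiff ℝ ω f →
        ContDiff ℝ ω fun q => weightP M *ᵥ f q := fun f hf =>
      (LinearMap.toContinuousLinearMap (weightP M).mulVecLin).contDiff.comp hf
    have h2 : ContDiff ℝ ω fun q : ℝ × State × Vec3 × Vec3 =>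
        (q.2.1 + (q.1 • Q (q.1, q.2.2.1 + q.2.2.2, q.2.1) + inputMap M (q.2.2.1 + q.2.2.2))) +
          (q.2.1 + (q.1 • Q (q.1, q.2.2.1, q.2.1) + inputMap M q.2.2.1)) - (2 : ℝ) • zetaStar := by
      fun_prop
    exact (h1 _ h2).const_smul (1 / 2 : ℝ)
  refine ⟨fun q j => (inputMap M (Pi.single j 1) + q.1 • I q (Pi.single j 1)) ⬝ᵥ D q, ?_, ?_, ?_⟩
  · intro ζ₀
    rw [analyticAt_pi_iff]
    intro j
    simp only [dotProduct]
    have h1 : AnalyticAt ℝ (fun q : ℝ × State × Vec3 × Vec3 =>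
        inputMap M (Pi.single j 1) + q.1 • I q (Pi.single j 1)) (0, ζ₀, 0, 0) :=
      analyticAt_const.add (analyticAt_fst.smul
        ((ContinuousLinearMap.apply ℝ State (Pi.single j (1 : ℝ) : Vec3)).analyticAt _ |>.comp
          (hIan ζ₀)))
    have h2 : AnalyticAt ℝ D (0, ζ₀, 0, 0) := hDan.contDiffAt.analyticAt
    rw [analyticAt_pi_iff] at h1 h2
    exact Finset.analyticAt_fun_sum _ fun i _ => (h1 i).mul (h2 i)
  · intro ζ
    ext j
    have h1 : D (0, ζ, 0, 0) = weightP M *ᵥ (ζ - zetaStar) := by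
      simp only [hD, zero_smul, add_zero, map_zero]
      rw [← Matrix.mulVec_smul]
      congr 1
      module
    simp only [zero_smul, add_zero, h1]
    rw [weightP_mulVec, dotProduct_state, inputMap_apply]
    simp only [qvec_mkState, qscal_mkState, angvel_mkState, zero_dotProduct, zero_mul, zero_add,
      angvel_sub, angvel_zetaStar, sub_zero]
    rw [hM.dotProduct_mulVec_comm, hM.mulVec_inv_mulVec]
    simp
  · intro δ ζ ues v
    ext j
    have h0 : outputY M δ ζ ues v j = (Pi.single j 1 : Vec3) ⬝ᵥ outputY M δ ζ ues v := by simp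
    rw [h0, dotProduct_outputY, gD_mulVec_eq hM]
    have h1 : ∀ u, fderiv ℝ (fun u => sampledF M δ ζ u) u =
        δ • R (δ, ζ, δ • u) + inputMap M := by
      intro u
      have e1 : HasFDerivAt (fun u : Vec3 => (δ, δ • u, ζ))
          (δ • (ContinuousLinearMap.inr ℝ ℝ (Vec3 × State) ∘L
            ContinuousLinearMap.inl ℝ Vec3 State)) u := by
        have e2 := (δ • (ContinuousLinearMap.inr ℝ ℝ (Vec3 × State) ∘L
            ContinuousLinearMap.inl ℝ Vec3 State)).hasFDerivAt (x := u) |>.add_const (δ, 0, ζ)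
        convert! e2 using 1
        funext w
        simp
      have e3 := ((hQ.differentiable (by simp)) (δ, δ • u, ζ)).hasFDerivAt.comp u e1
      have e4 := (e3.add (inputMap M).hasFDerivAt).fderiv
      have e5 : (fun u => sampledF M δ ζ u) =
          ((Q ∘ fun u : Vec3 => (δ, δ • u, ζ)) + fun u => inputMap M u) :=
        funext fun u => hsF δ ζ u
      rw [e5, e4]
      ext w : 1
      simp [hR]
    have h2 : (∫ s in (0 : ℝ)..1, fderiv ℝ (fun u => sampledF M δ ζ u) (ues + s • v)) =
        inputMap M + δ • I (δ, ζ, δ • ues, δ • v) := by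
      simp only [h1, hI]
      rw [intervalIntegral.integral_add (Continuous.intervalIntegrable (by fun_prop) _ _)
        intervalIntegrable_const, intervalIntegral.integral_smul,
        intervalIntegral.integral_const, sub_zero, one_smul, add_comm]
      congr 2
      refine intervalIntegral.integral_congr fun s _ => ?_
      simp only [smul_add, smul_comm δ s]
    have h3 : discGrad M (nextState M δ ζ ues) (nextState M δ ζ (ues + v)) =
        D (δ, ζ, δ • ues, δ • v) := by
      simp only [discGrad, hD, nextState_eq_add_smul_sampledF hM, hsF, smul_add, map_add, map_smul]
    rw [h2, h3]
    rfl

/-- The implicit function theorem for analytic maps whose partial derivative in the unknown is the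
identity. -/
theorem exists_analyticAt_apply_eq_zero {E V : Type*} [NormedAddCommGroup E] [NormedSpace ℝ E]
    [CompleteSpace E] [NormedAddCommGroup V] [NormedSpace ℝ V] [CompleteSpace V]
    {G : E × V → V} {x₀ : E} {v₀ : V} (hG : AnalyticAt ℝ G (x₀, v₀)) (b : V)
    (hb : ∀ v, G (x₀, v) = v + b) (h0 : G (x₀, v₀) = 0) :
    ∃ φ : E → V, AnalyticAt ℝ φ x₀ ∧ ∀ᶠ x in 𝓝 x₀, G (x, φ x) = 0 := by
  have hcd : ContDiffAt ℝ ω G (x₀, v₀) := hG.contDiffAt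
  have hinv : (fderiv ℝ G (x₀, v₀) ∘L .inr ℝ E V).IsInvertible := by
    have hd : HasFDerivAt (fun v => G (x₀, v)) (ContinuousLinearMap.id ℝ V) v₀ := by
      simp only [hb]
      exact (hasFDerivAt_id v₀).add_const _
    have hd2 : HasFDerivAt (fun v => G (x₀, v)) (fderiv ℝ G (x₀, v₀) ∘L .inr ℝ E V) v₀ :=
      HasFDerivAt.comp (g := G) v₀ (hcd.differentiableAt (by simp)).hasFDerivAt
        (hasFDerivAt_prodMk_right x₀ v₀)
    rw [hd2.unique hd]
    exact ⟨ContinuousLinearEquiv.refl ℝ V, rfl⟩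
  refine ⟨hcd.implicitFunction (by simp) hinv,
    (hcd.contDiffAt_implicitFunction (by simp) hinv).analyticAt, ?_⟩
  have := hcd.eventually_apply_implicitFunction (by simp) hinv
  rwa [h0] at this

/-- Along solutions of the damping equality the Hamiltonian decreases at least by a multiple of
`δ ‖v‖²`. -/
theorem exists_pos_mul_sq_norm_le_of_dampingEq {M κ : Matrix (Fin 3) (Fin 3) ℝ} (hM : M.PosDef)
    (hκ : κ.PosDef) : ∃ c > 0, ∀ (δ : ℝ) (ζ : State) (ues v : Vec3) (J : Matrix Idx Idx ℝ), 0 ≤ δ →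
      SolvesMatching M δ ζ ues J → DampingEq M κ δ ζ ues v →
      c * δ * ‖v‖ ^ 2 ≤ hamD M ζ - hamD M (nextState M δ ζ (ues + v)) := by
  obtain ⟨c, hc, hcκ⟩ := hκ.exists_pos_mul_sq_norm_le
  obtain ⟨C, hC, hCκ⟩ := exists_norm_mulVec_le κ
  refine ⟨c / (C ^ 2 + 1), by positivity, fun δ ζ ues v J hδ hJ hv => ?_⟩
  have h1 := hamD_nextState_sub_hamD hM hJ v
  set y := outputY M δ ζ ues v
  have hv' : v = -(κ *ᵥ y) := eq_neg_of_add_eq_zero_left hv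
  have h2 : v ⬝ᵥ y = -(y ⬝ᵥ κ *ᵥ y) := by rw [hv', neg_dotProduct, dotProduct_comm]
  have h3 : ‖v‖ ≤ C * ‖y‖ := by rw [hv', norm_neg]; exact hCκ y
  have h4 : c / (C ^ 2 + 1) * ‖v‖ ^ 2 ≤ y ⬝ᵥ κ *ᵥ y := by
    refine le_trans ?_ (hcκ y)
    rw [div_mul_eq_mul_div, div_le_iff₀ (by positivity)]
    have : ‖v‖ ^ 2 ≤ (C * ‖y‖) ^ 2 := by gcongr
    have h5 : 0 ≤ c * ‖y‖ ^ 2 := by positivity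
    nlinarith
  rw [h2] at h1
  nlinarith

/-- Local unique solvability of the damping equality, with analytic solution. A solution `v` has
impulse `δ v` of order `√δ` by the energy balance, and for small impulses the damping equality is
a contraction in `v` because the output depends on `v` through `δ v` only. -/
theorem exists_analyticAt_dampingEq_iff {M κ : Matrix (Fin 3) (Fin 3) ℝ} (hM : M.PosDef)
    (hκ : κ.PosDef) {uEs : ℝ → State → Vec3} {ζ₀ : State}
    (hu : AnalyticAt ℝ (fun p : ℝ × State => uEs p.1 p.2) (0, ζ₀)) :
    ∃ φ : ℝ × State → Vec3, AnalyticAt ℝ φ (0, ζ₀) ∧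
      ∀ᶠ p : ℝ × State in 𝓝 (0, ζ₀), 0 ≤ p.1 →
        (∃ J, SolvesMatching M p.1 p.2 (uEs p.1 p.2) J) →
        ∀ v, DampingEq M κ p.1 p.2 (uEs p.1 p.2) v ↔ v = φ p := by
  obtain ⟨Y, hYan, hY0, hY⟩ := exists_analyticAt_outputY_eq hM
  obtain ⟨c, hc, hcκ⟩ := exists_pos_mul_sq_norm_le_of_dampingEq hM hκ
  set K := LinearMap.toContinuousLinearMap κ.mulVecLin with hK
  have hKa : ∀ v, K v = κ *ᵥ v := fun v => rfl
  set L : (ℝ × State) × Vec3 → ℝ × State × Vec3 × Vec3 := fun q =>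
    (q.1.1, q.1.2, q.1.1 • uEs q.1.1 q.1.2, q.1.1 • q.2) with hL
  have hLan : ∀ v, AnalyticAt ℝ L ((0, ζ₀), v) := by
    intro v
    have h1 : AnalyticAt ℝ (fun q : (ℝ × State) × Vec3 => uEs q.1.1 q.1.2) ((0, ζ₀), v) :=
      AnalyticAt.comp (g := fun p : ℝ × State => uEs p.1 p.2) hu analyticAt_fst
    have h2 : AnalyticAt ℝ (fun q : (ℝ × State) × Vec3 => q.1.1) ((0, ζ₀), v) :=
      ((ContinuousLinearMap.fst ℝ ℝ State) ∘L
        (ContinuousLinearMap.fst ℝ (ℝ × State) Vec3)).analyticAt _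
    have h3 : AnalyticAt ℝ (fun q : (ℝ × State) × Vec3 => q.1.2) ((0, ζ₀), v) :=
      ((ContinuousLinearMap.snd ℝ ℝ State) ∘L
        (ContinuousLinearMap.fst ℝ (ℝ × State) Vec3)).analyticAt _
    exact h2.prod (h3.prod ((h2.smul h1).prod (h2.smul analyticAt_snd)))
  have hL0 : ∀ v, L ((0, ζ₀), v) = (0, ζ₀, 0, 0) := by intro v; simp [hL]
  set G : (ℝ × State) × Vec3 → Vec3 := fun q => q.2 + K (Y (L q)) with hG
  have hGdamp : ∀ (p : ℝ × State) v, DampingEq M κ p.1 p.2 (uEs p.1 p.2) v ↔ G (p, v) = 0 := by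
    intro p v
    rw [DampingEq, hY]
    rfl
  have hGan : ∀ v, AnalyticAt ℝ G ((0, ζ₀), v) := by
    intro v
    have h1 : AnalyticAt ℝ (Y ∘ L) ((0, ζ₀), v) := by
      refine AnalyticAt.comp ?_ (hLan v)
      rw [hL0]
      exact hYan ζ₀
    exact analyticAt_snd.add ((K.analyticAt _).comp h1)
  have hG0 : ∀ v, G ((0, ζ₀), v) = v + κ *ᵥ angvel ζ₀ := by
    intro v
    simp only [hG, hL0, hY0, hKa]
  obtain ⟨φ, hφan, hφsol⟩ := exists_analyticAt_apply_eq_zero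
    (hGan (-(κ *ᵥ angvel ζ₀))) (κ *ᵥ angvel ζ₀) hG0 (by rw [hG0, neg_add_cancel])
  refine ⟨φ, hφan, ?_⟩
  -- the output is Lipschitz near the base point
  obtain ⟨k, U, hU, hk⟩ := ((hYan ζ₀).contDiffAt (n := 1)).exists_lipschitzOnWith
  obtain ⟨ε, hε, hεU⟩ := Metric.mem_nhds_iff.1 hU
  have hφc : Tendsto (fun p : ℝ × State => L (p, φ p)) (𝓝 (0, ζ₀)) (𝓝 (0, ζ₀, 0, 0)) := by
    have h1 : ContinuousAt (fun p : ℝ × State => L (p, φ p)) (0, ζ₀) :=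
      ContinuousAt.comp (g := L) (hLan _).continuousAt
        (continuousAt_id.prodMk hφan.continuousAt)
    have := h1.tendsto
    rwa [hL0] at this
  have hLc : Tendsto (fun p : ℝ × State => L (p, 0)) (𝓝 (0, ζ₀)) (𝓝 (0, ζ₀, 0, 0)) := by
    have h1 : ContinuousAt (fun p : ℝ × State => L (p, 0)) (0, ζ₀) :=
      ContinuousAt.comp (g := L) (hLan _).continuousAt
        (continuousAt_id.prodMk continuousAt_const)
    have := h1.tendsto
    rwa [hL0] at this
  have hH : Continuous (hamD M) := by
    have h1 : Continuous fun x : State => x - zetaStar := by fun_prop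
    have h2 : hamD M = fun x => (1 / 2 : ℝ) * ((x - zetaStar) ⬝ᵥ weightP M *ᵥ (x - zetaStar)) :=
      funext (hamD_eq M)
    rw [h2]
    fun_prop
  have hsmall : ∀ᶠ p : ℝ × State in 𝓝 (0, ζ₀), p.1 * hamD M p.2 < c * ε ^ 2 := by
    have h1 : Continuous fun p : ℝ × State => p.1 * hamD M p.2 := by fun_prop
    exact h1.continuousAt.eventually (gt_mem_nhds (by simp; positivity))
  have hcontr : ∀ᶠ p : ℝ × State in 𝓝 (0, ζ₀), ‖K‖ * (k * |p.1|) < 1 := by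
    have h1 : Continuous fun p : ℝ × State => ‖K‖ * (k * |p.1|) := by fun_prop
    exact h1.continuousAt.eventually (gt_mem_nhds (by simp))
  filter_upwards [hφsol, hφc.eventually hU, hLc.eventually (Metric.ball_mem_nhds _ hε), hsmall,
    hcontr] with p hp1 hp2 hp3 hp4 hp5 hδ hJ v
  obtain ⟨J, hJ⟩ := hJ
  refine ⟨fun hv => ?_, fun hv => by rw [hv, hGdamp]; exact hp1⟩
  have hvs : ‖p.1 • v‖ < ε := by
    have h1 := hcκ p.1 p.2 (uEs p.1 p.2) v J hδ hJ hv
    have h2 := hamD_nonneg hM (nextState M p.1 p.2 (uEs p.1 p.2 + v))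
    have h3 : c * ‖p.1 • v‖ ^ 2 ≤ p.1 * hamD M p.2 := by
      rw [norm_smul, Real.norm_eq_abs, abs_of_nonneg hδ]
      have : p.1 * (c * p.1 * ‖v‖ ^ 2) ≤ p.1 * hamD M p.2 := by gcongr; linarith
      linarith
    have h4 : ‖p.1 • v‖ ^ 2 < ε ^ 2 := lt_of_mul_lt_mul_left (h3.trans_lt hp4) hc.le
    exact lt_of_pow_lt_pow_left₀ 2 hε.le h4
  have hvU : L (p, v) ∈ U := by
    apply hεU
    rw [Metric.mem_ball]
    simp only [hL, smul_zero, Prod.dist_eq, max_lt_iff] at hp3 ⊢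
    exact ⟨hp3.1, hp3.2.1, hp3.2.2.1, by simpa using hvs⟩
  rw [hGdamp] at hv
  have h1 : v - φ p = K (Y (L (p, φ p)) - Y (L (p, v))) := by
    rw [map_sub]
    have e1 : v = -K (Y (L (p, v))) := eq_neg_of_add_eq_zero_left hv
    have e2 : φ p = -K (Y (L (p, φ p))) := eq_neg_of_add_eq_zero_left hp1
    calc v - φ p = -K (Y (L (p, v))) - -K (Y (L (p, φ p))) := by rw [← e1, ← e2]
      _ = _ := by abel
  have h2 : ‖v - φ p‖ ≤ ‖K‖ * (k * |p.1|) * ‖v - φ p‖ := by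
    have h3 : ‖Y (L (p, φ p)) - Y (L (p, v))‖ ≤ k * (|p.1| * ‖v - φ p‖) := by
      have h4 := hk.dist_le_mul _ hp2 _ hvU
      rw [dist_eq_norm] at h4
      refine h4.trans ?_
      gcongr
      simp only [hL, Prod.dist_eq, dist_self]
      rw [max_eq_right dist_nonneg, max_eq_right dist_nonneg, max_eq_right dist_nonneg,
        dist_smul₀, Real.norm_eq_abs, dist_comm, dist_eq_norm]
    conv_lhs => rw [h1]
    refine (K.le_opNorm _).trans ?_
    calc ‖K‖ * ‖Y (L (p, φ p)) - Y (L (p, v))‖ ≤ ‖K‖ * (k * (|p.1| * ‖v - φ p‖)) := by gcongr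
      _ = _ := by ring
  have h3 : ‖v - φ p‖ = 0 := by
    by_contra hne
    have : 0 < ‖v - φ p‖ := lt_of_le_of_ne (norm_nonneg _) (Ne.symm hne)
    nlinarith
  exact sub_eq_zero.1 (norm_eq_zero.1 h3)

theorem dampingEq_zero_iff {M κ : Matrix (Fin 3) (Fin 3) ℝ} (hM : M.PosDef) (ζ : State)
    (ues v : Vec3) : DampingEq M κ 0 ζ ues v ↔ v = -(κ *ᵥ angvel ζ) := by
  obtain ⟨Y, -, hY0, hY⟩ := exists_analyticAt_outputY_eq hM
  rw [DampingEq, hY, zero_smul, zero_smul, hY0, eq_neg_iff_add_eq_zero]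

/-! ### Asymptotic stability of the closed loop -/

/-- A discrete-time Lyapunov criterion: a function comparable to the squared distance that is
contracted by a factor `q < 1` near `z`. -/
theorem asympStableOn_of_lyapunov {X : Set State} {T : State → State} {z : State} {V : State → ℝ}
    {r q c C : ℝ} (hz : z ∈ X) (hT : MapsTo T X X) (hTz : T z = z) (hr : 0 < r) (hq0 : 0 ≤ q)
    (hq1 : q < 1) (hc : 0 < c) (hC : 0 < C) (hlow : ∀ x, c * dist x z ^ 2 ≤ V x)
    (hup : ∀ x, V x ≤ C * dist x z ^ 2)
    (hdec : ∀ x ∈ X, dist x z < r → V (T x) ≤ q * V x) : AsympStableOn X T z := by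
  have hV0 : ∀ x, 0 ≤ V x := fun x => le_trans (by positivity) (hlow x)
  have key : ∀ ε > 0, ε ≤ r → ∃ η > 0, ∀ x ∈ X, dist x z < η → ∀ k : ℕ,
      T^[k] x ∈ X ∧ V (T^[k] x) ≤ q ^ k * V x ∧ dist (T^[k] x) z < ε := by
    intro ε hε hεr
    refine ⟨ε * Real.sqrt (c / C), by positivity, fun x hx hxη => ?_⟩
    have hVx : V x < c * ε ^ 2 := by
      have h1 : dist x z ^ 2 < (ε * Real.sqrt (c / C)) ^ 2 := by gcongr
      rw [mul_pow, Real.sq_sqrt (by positivity)] at h1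
      calc V x ≤ C * dist x z ^ 2 := hup x
        _ < C * (ε ^ 2 * (c / C)) := by gcongr
        _ = c * ε ^ 2 := by field_simp
    have hstep : ∀ y, V y ≤ V x → dist y z < ε := by
      intro y hy
      have h1 : c * dist y z ^ 2 < c * ε ^ 2 := (hlow y).trans_lt (hy.trans_lt hVx)
      exact lt_of_pow_lt_pow_left₀ 2 hε.le (lt_of_mul_lt_mul_left h1 hc.le)
    have hpow : ∀ k : ℕ, q ^ k * V x ≤ V x := fun k =>
      mul_le_of_le_one_left (hV0 x) (pow_le_one₀ hq0 hq1.le)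
    intro k
    induction k with
    | zero => exact ⟨hx, by simp, hstep x le_rfl⟩
    | succ k ih =>
      obtain ⟨h1, h2, h3⟩ := ih
      rw [Function.iterate_succ_apply']
      have h4 : V (T (T^[k] x)) ≤ q ^ (k + 1) * V x := by
        refine (hdec _ h1 (h3.trans_le hεr)).trans ?_
        rw [pow_succ', mul_assoc]
        gcongr
      exact ⟨hT h1, h4, hstep _ (h4.trans (hpow _))⟩
  refine ⟨hz, hT, hTz, fun ε hε => ?_, ?_⟩
  · obtain ⟨η, hη, h⟩ := key (min ε r) (lt_min hε hr) (min_le_right _ _)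
    exact ⟨η, hη, fun x hx hxη k => (h x hx hxη k).2.2.trans_le (min_le_left _ _)⟩
  · obtain ⟨η, hη, h⟩ := key r hr le_rfl
    refine ⟨η, hη, fun x hx hxη => ?_⟩
    have h1 : Tendsto (fun k : ℕ => q ^ k * V x / c) atTop (𝓝 0) := by
      simpa using ((tendsto_pow_atTop_nhds_zero_of_lt_one hq0 hq1).mul_const (V x)).div_const c
    have h2 : Tendsto (fun k : ℕ => dist (T^[k] x) z ^ 2) atTop (𝓝 0) := by
      refine squeeze_zero (fun k => by positivity) (fun k => ?_) h1
      rw [le_div_iff₀ hc, mul_comm]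
      exact (hlow _).trans (h x hx hxη k).2.1
    rw [tendsto_iff_dist_tendsto_zero]
    have h3 := h2.sqrt
    simpa [Real.sqrt_sq dist_nonneg] using h3

/-- The Hamiltonian with a cross term between attitude and momentum, which makes it decrease
strictly away from the equilibrium. -/
noncomputable def lyapV (M : Matrix (Fin 3) (Fin 3) ℝ) (η : ℝ) (x : State) : ℝ :=
  hamD M x + η * (qvec x ⬝ᵥ M *ᵥ angvel x)

/-- The directional derivative of `lyapV` at `x` along `y`. -/
noncomputable def lyapDeriv (M : Matrix (Fin 3) (Fin 3) ℝ) (η : ℝ) (x y : State) : ℝ :=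
  y ⬝ᵥ weightP M *ᵥ (x - zetaStar) +
    η * (qvec y ⬝ᵥ M *ᵥ angvel x + qvec x ⬝ᵥ M *ᵥ angvel y)

theorem lyapV_add_smul {M : Matrix (Fin 3) (Fin 3) ℝ} (hM : M.PosDef) (η : ℝ) (x y : State)
    (δ : ℝ) : lyapV M η (x + δ • y) = lyapV M η x + δ * lyapDeriv M η x y +
      δ ^ 2 * ((1 / 2 : ℝ) * (y ⬝ᵥ weightP M *ᵥ y) + η * (qvec y ⬝ᵥ M *ᵥ angvel y)) := by
  have h1 : x + δ • y - zetaStar = (x - zetaStar) + δ • y := by abel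
  simp only [lyapV, lyapDeriv, hamD_eq, h1, qvec_add, qvec_smul, angvel_add, angvel_smul,
    Matrix.mulVec_add, Matrix.mulVec_smul, dotProduct_add, add_dotProduct, smul_dotProduct,
    dotProduct_smul, smul_eq_mul]
  rw [weightP_dotProduct_comm hM (x - zetaStar) y]
  ring

theorem exists_abs_qvec_dotProduct_le (M : Matrix (Fin 3) (Fin 3) ℝ) :
    ∃ C > 0, ∀ x y : State, |qvec x ⬝ᵥ M *ᵥ angvel y| ≤ C * ‖x‖ * ‖y‖ := by
  obtain ⟨C, hC, h⟩ := exists_norm_mulVec_le M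
  refine ⟨3 * C + 1, by positivity, fun x y => ?_⟩
  calc |qvec x ⬝ᵥ M *ᵥ angvel y| ≤ 3 * ‖qvec x‖ * ‖M *ᵥ angvel y‖ := abs_dotProduct_le _ _
    _ ≤ 3 * ‖x‖ * (C * ‖y‖) := by
        gcongr
        · exact norm_qvec_le x
        · exact (h _).trans (by gcongr; exact norm_angvel_le y)
    _ ≤ (3 * C + 1) * ‖x‖ * ‖y‖ := by
        have : 0 ≤ ‖x‖ * ‖y‖ := by positivity
        nlinarith

theorem norm_skewS_mulVec_le (w x : Vec3) : ‖skewS w *ᵥ x‖ ≤ 2 * ‖w‖ * ‖x‖ := by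
  have key : ∀ a b : ℝ, ∀ i j : Fin 3, |a| ≤ ‖w‖ → |b| ≤ ‖w‖ → |a * x i + b * x j| ≤
      2 * ‖w‖ * ‖x‖ := by
    intro a b i j ha hb
    have h1 : |x i| ≤ ‖x‖ := norm_le_pi_norm x i
    have h2 : |x j| ≤ ‖x‖ := norm_le_pi_norm x j
    calc |a * x i + b * x j| ≤ |a * x i| + |b * x j| := abs_add_le _ _
      _ ≤ ‖w‖ * ‖x‖ + ‖w‖ * ‖x‖ := by rw [abs_mul, abs_mul]; gcongr
      _ = 2 * ‖w‖ * ‖x‖ := by ring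
  have hw : ∀ i, |w i| ≤ ‖w‖ := fun i => norm_le_pi_norm w i
  have hw' : ∀ i, |-w i| ≤ ‖w‖ := fun i => by rw [abs_neg]; exact hw i
  refine (pi_norm_le_iff_of_nonneg (by positivity)).2 fun i => ?_
  fin_cases i
  · simpa [skewS, Matrix.mulVec, dotProduct, Fin.sum_univ_three] using key _ _ 1 2 (hw' 2) (hw 1)
  · simpa [skewS, Matrix.mulVec, dotProduct, Fin.sum_univ_three] using key _ _ 0 2 (hw 2) (hw' 0)
  · simpa [skewS, Matrix.mulVec, dotProduct, Fin.sum_univ_three] using key _ _ 0 1 (hw' 1) (hw 0)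

/-- On unit quaternions near the equilibrium the deviation of the scalar part is controlled by the
vector part. -/
theorem abs_qscal_sub_one_le {x : State} (hx : x ∈ unitStates) (h : ‖x - zetaStar‖ ≤ 1 / 2) :
    |qscal x - 1| ≤ 2 * ‖qvec x‖ := by
  have h1 : |qscal x - 1| ≤ 1 / 2 := (abs_qscal_le (x - zetaStar)).trans h
  have h2 : ‖qvec x‖ ≤ 1 / 2 := by
    have := (norm_qvec_le (x - zetaStar)).trans h
    simpa using this
  have h3 : qvec x ⬝ᵥ qvec x + qscal x ^ 2 = 1 := hx
  have h4 := abs_dotProduct_le (qvec x) (qvec x)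
  have h5 := (abs_le.1 h4).2
  have h6 := abs_le.1 h1
  have h7 := norm_nonneg (qvec x)
  have h8 : 0 ≤ qvec x ⬝ᵥ qvec x := (sq_nonneg _).trans (sq_norm_le_dotProduct _)
  rw [abs_le]
  constructor <;> nlinarith

set_option maxHeartbeats 800000 in
/-- Strict decrease of the Lyapunov function along the continuous-time closed loop, for any
energy-shaping feedback `-ε₀/2 + g` whose additional part `g` is workless and of the order of the
angular velocity. -/
theorem exists_lyapDeriv_errField_le {M κ : Matrix (Fin 3) (Fin 3) ℝ} (hM : M.PosDef)
    (hκ : κ.PosDef) (C₀ : ℝ) : ∃ η > 0, ∃ c > 0, ∃ a > 0,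
      (∀ x, c * ‖x - zetaStar‖ ^ 2 ≤ lyapV M η x) ∧
      ∀ x ∈ unitStates, ‖x - zetaStar‖ ≤ 1 / 2 → ∀ g : Vec3, ‖g‖ ≤ C₀ * ‖angvel x‖ →
        angvel x ⬝ᵥ g = 0 →
        lyapDeriv M η x (errField M (-(1 / 2 : ℝ) • qvec x + g - κ *ᵥ angvel x) x) ≤
          -a * ‖x - zetaStar‖ ^ 2 := by
  obtain ⟨b, hb, hbκ⟩ := hκ.exists_pos_mul_sq_norm_le
  obtain ⟨Cκ, hCκ, hCκ'⟩ := exists_norm_mulVec_le κ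
  obtain ⟨CM, hCM, hCM'⟩ := exists_norm_mulVec_le M
  obtain ⟨p, hp, hpM⟩ := exists_pos_mul_sq_norm_le_weightP hM
  obtain ⟨N, hN, hN'⟩ := exists_abs_qvec_dotProduct_le M
  set K₁ := 12 * CM + 9 * (C₀ + Cκ) ^ 2 with hK₁
  have hK₁0 : 0 ≤ K₁ := by positivity
  set η := min (b / (2 * (K₁ + 1))) (p / (4 * N)) with hη
  have hη0 : 0 < η := by positivity
  have hη1 : η * K₁ ≤ b / 2 := by
    have h1 : η * (K₁ + 1) ≤ b / (2 * (K₁ + 1)) * (K₁ + 1) := by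
      gcongr; exact min_le_left _ _
    have h2 : b / (2 * (K₁ + 1)) * (K₁ + 1) = b / 2 := by field_simp
    nlinarith
  have hη2 : η * N ≤ p / 4 := by
    have h1 : η * N ≤ p / (4 * N) * N := by gcongr; exact min_le_right _ _
    have h2 : p / (4 * N) * N = p / 4 := by field_simp
    linarith
  refine ⟨η, hη0, p / 4, by positivity, min (b / 2) (η / 20), by positivity, ?_, ?_⟩
  · intro x
    have h1 := hpM (x - zetaStar)
    have h2 := hN' (x - zetaStar) (x - zetaStar)
    simp only [qvec_sub, qvec_zetaStar, angvel_sub, angvel_zetaStar, sub_zero] at h2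
    have h3 := (abs_le.1 h2).1
    have h4 : η * -(N * ‖x - zetaStar‖ * ‖x - zetaStar‖) ≤ η * (qvec x ⬝ᵥ M *ᵥ angvel x) := by
      gcongr
    have h5 : η * N * ‖x - zetaStar‖ ^ 2 ≤ p / 4 * ‖x - zetaStar‖ ^ 2 := by gcongr
    rw [lyapV, hamD_eq]
    nlinarith
  · intro x hx hx2 g hg hgo
    set q := qvec x with hq
    set w := angvel x with hw
    set f := errField M (-(1 / 2 : ℝ) • q + g - κ *ᵥ w) x with hf
    have hq1 : ‖q‖ ≤ 1 / 2 := by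
      have := (norm_qvec_le (x - zetaStar)).trans hx2
      simpa using this
    have hr1 : |qscal x - 1| ≤ 1 / 2 := (abs_qscal_le (x - zetaStar)).trans hx2
    -- the Hamiltonian part
    have hpart1 : f ⬝ᵥ weightP M *ᵥ (x - zetaStar) = -(w ⬝ᵥ κ *ᵥ w) := by
      rw [weightP_dotProduct_comm hM, weightP_mulVec, dotProduct_state]
      simp only [qvec_mkState, qscal_mkState, angvel_mkState, qvec_sub, qscal_sub, angvel_sub,
        qvec_zetaStar, qscal_zetaStar, angvel_zetaStar, sub_zero]
      have e1 := qvec_dotProduct_errField M (-(1 / 2 : ℝ) • q + g - κ *ᵥ w) x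
      have e2 := angvel_dotProduct_errField hM (-(1 / 2 : ℝ) • q + g - κ *ᵥ w) x
      have e3 := qscal_errField M (-(1 / 2 : ℝ) • q + g - κ *ᵥ w) x
      rw [← hf] at e1 e2 e3
      rw [dotProduct_sub, dotProduct_add, dotProduct_smul, hgo, smul_eq_mul] at e2
      simp only [← hq, ← hw] at e1 e2 e3 ⊢
      rw [e2]
      linarith
    -- the cross term
    have hqf : qvec f = (1 / 2 : ℝ) • (skewS w *ᵥ q) + (1 / 2 : ℝ) • (qscal x • w) := rfl
    have hwf : M *ᵥ angvel f = skewS w *ᵥ (M *ᵥ w) + (-(1 / 2 : ℝ) • q + g - κ *ᵥ w) := by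
      rw [hf, errField, angvel_mkState, hM.mulVec_inv_mulVec]
    have hn1 : ‖qvec f‖ ≤ 2 * ‖w‖ := by
      rw [hqf]
      refine (norm_add_le _ _).trans ?_
      rw [norm_smul, norm_smul, norm_smul, Real.norm_eq_abs, Real.norm_eq_abs,
        abs_of_pos (by norm_num : (0 : ℝ) < 1 / 2)]
      have h1 := norm_skewS_mulVec_le w q
      have h2 : |qscal x| ≤ 2 := by
        rw [abs_le] at hr1 ⊢; constructor <;> linarith [hr1.1, hr1.2]
      have h3 : |qscal x| * ‖w‖ ≤ 2 * ‖w‖ := by gcongr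
      have h4 : 2 * ‖w‖ * ‖q‖ ≤ 2 * ‖w‖ * (1 / 2) := by gcongr
      linarith [norm_nonneg w]
    have hc1 : qvec f ⬝ᵥ M *ᵥ w ≤ 6 * CM * ‖w‖ ^ 2 := by
      refine (le_abs_self _).trans ((abs_dotProduct_le _ _).trans ?_)
      calc 3 * ‖qvec f‖ * ‖M *ᵥ w‖ ≤ 3 * (2 * ‖w‖) * (CM * ‖w‖) := by
            gcongr; exact hCM' w
        _ = _ := by ring
    have hc2 : q ⬝ᵥ skewS w *ᵥ (M *ᵥ w) ≤ 6 * CM * ‖w‖ ^ 2 := by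
      refine (le_abs_self _).trans ((abs_dotProduct_le _ _).trans ?_)
      calc 3 * ‖q‖ * ‖skewS w *ᵥ (M *ᵥ w)‖ ≤ 3 * 1 * (2 * ‖w‖ * (CM * ‖w‖)) := by
            gcongr
            · linarith
            · exact (norm_skewS_mulVec_le _ _).trans (by gcongr; exact hCM' w)
        _ = _ := by ring
    have hc3 : q ⬝ᵥ (g - κ *ᵥ w) ≤ 1 / 4 * ‖q‖ ^ 2 + 9 * (C₀ + Cκ) ^ 2 * ‖w‖ ^ 2 := by
      refine (le_abs_self _).trans ((abs_dotProduct_le _ _).trans ?_)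
      have h1 : ‖g - κ *ᵥ w‖ ≤ (C₀ + Cκ) * ‖w‖ := by
        refine (norm_sub_le _ _).trans ?_
        rw [add_mul]
        exact add_le_add hg (hCκ' w)
      calc 3 * ‖q‖ * ‖g - κ *ᵥ w‖ ≤ 3 * ‖q‖ * ((C₀ + Cκ) * ‖w‖) := by gcongr
        _ ≤ _ := by nlinarith [sq_nonneg (‖q‖ / 2 - 3 * ((C₀ + Cκ) * ‖w‖))]
    have hc4 := sq_norm_le_dotProduct q
    have hcross : qvec f ⬝ᵥ M *ᵥ w + q ⬝ᵥ M *ᵥ angvel f ≤ K₁ * ‖w‖ ^ 2 - 1 / 4 * ‖q‖ ^ 2 := by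
      rw [hwf, dotProduct_add, add_sub_assoc, dotProduct_add, dotProduct_smul, smul_eq_mul, hK₁]
      linarith
    have hs := abs_qscal_sub_one_le hx hx2
    have hz : ‖x - zetaStar‖ ^ 2 ≤ 5 * ‖q‖ ^ 2 + ‖w‖ ^ 2 := by
      have h1 : ‖x - zetaStar‖ ≤ max (2 * ‖q‖) ‖w‖ := by
        refine norm_state_le (by positivity) ?_ (hs.trans (le_max_left _ _)) ?_
        · rw [qvec_sub, qvec_zetaStar, sub_zero]
          exact le_trans (by linarith [norm_nonneg q]) (le_max_left _ _)
        · rw [angvel_sub, angvel_zetaStar, sub_zero]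
          exact le_max_right _ _
      rcases le_max_iff.1 h1 with h | h
      · have : ‖x - zetaStar‖ ^ 2 ≤ (2 * ‖q‖) ^ 2 := by gcongr
        nlinarith [sq_nonneg ‖q‖, sq_nonneg ‖w‖]
      · have : ‖x - zetaStar‖ ^ 2 ≤ ‖w‖ ^ 2 := by gcongr
        nlinarith [sq_nonneg ‖q‖]
    have hfin : lyapDeriv M η x f ≤ -(b / 2) * ‖w‖ ^ 2 - η / 4 * ‖q‖ ^ 2 := by
      rw [lyapDeriv, hpart1]
      have h1 := hbκ w
      have h2 := mul_le_mul_of_nonneg_left hcross hη0.le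
      have h3 : η * K₁ * ‖w‖ ^ 2 ≤ b / 2 * ‖w‖ ^ 2 := by gcongr
      nlinarith
    refine hfin.trans ?_
    have h1 : min (b / 2) (η / 20) * ‖x - zetaStar‖ ^ 2 ≤
        min (b / 2) (η / 20) * (5 * ‖q‖ ^ 2 + ‖w‖ ^ 2) := by gcongr
    have h2 : min (b / 2) (η / 20) * ‖q‖ ^ 2 ≤ η / 20 * ‖q‖ ^ 2 := by
      gcongr; exact min_le_right _ _
    have h3 : min (b / 2) (η / 20) * ‖w‖ ^ 2 ≤ b / 2 * ‖w‖ ^ 2 := by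
      gcongr; exact min_le_left _ _
    linarith

theorem analyticAt_sampledF {M : Matrix (Fin 3) (Fin 3) ℝ} (hM : M.PosDef) {E : Type*}
    [NormedAddCommGroup E] [NormedSpace ℝ E] {a : E → ℝ} {x : E → State} {u : E → Vec3} {e : E}
    (ha : AnalyticAt ℝ a e) (hx : AnalyticAt ℝ x e) (hu : AnalyticAt ℝ u e) :
    AnalyticAt ℝ (fun e => sampledF M (a e) (x e) (u e)) e := by
  obtain ⟨Q, hQ, h⟩ := exists_contDiff_sampledF_eq hM
  simp only [h]
  have h1 : AnalyticAt ℝ (fun e => (a e, a e • u e, x e)) e := ha.prod ((ha.smul hu).prod hx)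
  have h2 : AnalyticAt ℝ Q (a e, a e • u e, x e) := hQ.contDiffAt.analyticAt
  exact (AnalyticAt.comp (g := Q) (f := fun e => (a e, a e • u e, x e)) h2 h1).add
    (AnalyticAt.comp (g := inputMap M) (f := u) ((inputMap M).analyticAt _) hu)

theorem lyapDeriv_add (M : Matrix (Fin 3) (Fin 3) ℝ) (η : ℝ) (x y z : State) :
    lyapDeriv M η x (y + z) = lyapDeriv M η x y + lyapDeriv M η x z := by
  simp only [lyapDeriv, add_dotProduct, qvec_add, angvel_add, Matrix.mulVec_add, dotProduct_add]
  ring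

theorem exists_lyapV_bounds (M : Matrix (Fin 3) (Fin 3) ℝ) {η : ℝ} (hη : 0 < η) : ∃ K > 0,
    (∀ x, lyapV M η x ≤ K * ‖x - zetaStar‖ ^ 2) ∧
    (∀ x y, lyapDeriv M η x y ≤ K * ‖x - zetaStar‖ * ‖y‖) ∧
    ∀ y : State, (1 / 2 : ℝ) * (y ⬝ᵥ weightP M *ᵥ y) + η * (qvec y ⬝ᵥ M *ᵥ angvel y) ≤
      K * ‖y‖ ^ 2 := by
  obtain ⟨C, hC, hC'⟩ := exists_dotProduct_weightP_le M
  obtain ⟨N, hN, hN'⟩ := exists_abs_qvec_dotProduct_le M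
  have hq : ∀ y : State, (1 / 2 : ℝ) * (y ⬝ᵥ weightP M *ᵥ y) + η * (qvec y ⬝ᵥ M *ᵥ angvel y) ≤
      (C + 2 * η * N) * ‖y‖ ^ 2 := by
    intro y
    have h1 := (abs_le.1 (hC' y y)).2
    have h2 := mul_le_mul_of_nonneg_left (abs_le.1 (hN' y y)).2 hη.le
    have h3 : 0 ≤ C * ‖y‖ * ‖y‖ := by positivity
    have h4 : 0 ≤ η * (N * ‖y‖ * ‖y‖) := by positivity
    nlinarith
  refine ⟨C + 2 * η * N, by positivity, fun x => ?_, fun x y => ?_, hq⟩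
  · have := hq (x - zetaStar)
    simpa only [lyapV, hamD_eq, qvec_sub, qvec_zetaStar, angvel_sub, angvel_zetaStar, sub_zero]
      using this
  · have h1 := (abs_le.1 (hC' y (x - zetaStar))).2
    have h2 := (abs_le.1 (hN' y (x - zetaStar))).2
    have h3 := (abs_le.1 (hN' (x - zetaStar) y)).2
    simp only [qvec_sub, qvec_zetaStar, angvel_sub, angvel_zetaStar, sub_zero] at h2 h3
    rw [lyapDeriv]
    have h4 := mul_le_mul_of_nonneg_left (add_le_add h2 h3) hη.le
    nlinarith

/-- At the equilibrium the matching equation forces the sampled velocity to vanish. -/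
theorem SolvesMatching.sampledF_zetaStar {M : Matrix (Fin 3) (Fin 3) ℝ} (hM : M.PosDef) {δ : ℝ}
    {ues : Vec3} {J : Matrix Idx Idx ℝ} (h : SolvesMatching M δ zetaStar ues J) :
    sampledF M δ zetaStar ues = 0 := by
  by_cases hδ : δ = 0
  · have := h.2
    simpa [hδ] using this.symm
  · have h1 := h.dotProduct_eq_zero
    rw [sub_self, zero_add, Matrix.mulVec_smul, dotProduct_smul, smul_eq_mul] at h1
    have h2 := (mul_eq_zero.1 h1).resolve_left (by simpa using hδ)
    obtain ⟨c, hc, hcP⟩ := exists_pos_mul_sq_norm_le_weightP hM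
    have h3 := hcP (sampledF M δ zetaStar ues)
    rw [h2] at h3
    have h4 : ‖sampledF M δ zetaStar ues‖ ^ 2 ≤ 0 := by nlinarith
    exact norm_eq_zero.1 (pow_eq_zero_iff two_ne_zero |>.1 (le_antisymm h4 (by positivity)))

theorem outputY_zetaStar_zero {M : Matrix (Fin 3) (Fin 3) ℝ} (hM : M.PosDef) {δ : ℝ}
    {ues : Vec3} (h : sampledF M δ zetaStar ues = 0) : outputY M δ zetaStar ues 0 = 0 := by
  have h1 : nextState M δ zetaStar ues = zetaStar := by
    rw [nextState_eq_add_smul_sampledF hM, h, smul_zero, add_zero]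
  have h2 : discGrad M zetaStar zetaStar = 0 := by
    rw [discGrad, two_smul, sub_self, Matrix.mulVec_zero, smul_zero]
  rw [outputY, add_zero, h1, h2, Matrix.mulVec_zero]

/-- At period zero the matching equation says that the energy-shaping feedback differs from
`-ε₀/2` by a workless term, which therefore vanishes to first order in the angular velocity. -/
theorem IsEnergyShaping.exists_norm_add_le {M : Matrix (Fin 3) (Fin 3) ℝ} (hM : M.PosDef)
    {D : Set State} {uEs : ℝ → State → Vec3} {Jd : ℝ → State → Matrix Idx Idx ℝ}
    (hz : zetaStar ∈ D) (hE : IsEnergyShaping M D uEs Jd) :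
    ∃ C : ℝ, ∃ r > 0, ∀ ζ ∈ unitStates, dist ζ zetaStar < r →
      ‖uEs 0 ζ + (1 / 2 : ℝ) • qvec ζ‖ ≤ C * ‖angvel ζ‖ ∧
        angvel ζ ⬝ᵥ (uEs 0 ζ + (1 / 2 : ℝ) • qvec ζ) = 0 := by
  have hzX : zetaStar ∈ unitStates := by simp [unitStates]
  obtain ⟨k, U, hU, hk⟩ :=
    ((hE.analytic zetaStar ⟨hz, hzX⟩).contDiffAt (n := 1)).exists_lipschitzOnWith
  have hm := hE.matching zetaStar ⟨hz, hzX⟩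
  rw [eventually_nhdsWithin_iff] at hm
  obtain ⟨r, hr, hrU⟩ := Metric.mem_nhds_iff.1 (inter_mem hU hm)
  have hball : ∀ ζ : State, dist ζ zetaStar < r → ((0 : ℝ), ζ) ∈ Metric.ball ((0 : ℝ), zetaStar) r :=
    fun ζ h => by simpa [Prod.dist_eq, hr] using h
  have hwork : ∀ ζ ∈ unitStates, dist ζ zetaStar < r →
      angvel ζ ⬝ᵥ (uEs 0 ζ + (1 / 2 : ℝ) • qvec ζ) = 0 := by
    intro ζ hζ hd
    have h1 : SolvesMatching M 0 ζ (uEs 0 ζ) (Jd 0 ζ) :=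
      (hrU (hball ζ hd)).2 ⟨(le_refl (0 : ℝ) : (0 : ℝ) ∈ Ici 0), hζ⟩
    have h2 := h1.dotProduct_eq_zero
    rw [sampledF_zero hM, zero_div, zero_smul, add_zero, weightP_dotProduct_comm hM,
      weightP_mulVec, dotProduct_state] at h2
    simp only [qvec_mkState, qscal_mkState, angvel_mkState, qvec_sub, qscal_sub, angvel_sub,
      qvec_zetaStar, qscal_zetaStar, angvel_zetaStar, sub_zero] at h2
    have e1 := qvec_dotProduct_errField M (uEs 0 ζ) ζ
    have e2 := angvel_dotProduct_errField hM (uEs 0 ζ) ζ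
    have e3 := qscal_errField M (uEs 0 ζ) ζ
    rw [dotProduct_add, dotProduct_smul, smul_eq_mul]
    linarith
  refine ⟨k, r, hr, fun ζ hζ hd => ⟨?_, hwork ζ hζ hd⟩⟩
  have hscale : ∀ w : Vec3, ‖w‖ < r →
      mkState (qvec ζ) (qscal ζ) w ∈ unitStates ∧
        dist (mkState (qvec ζ) (qscal ζ) w) zetaStar < r := by
    intro w hw
    refine ⟨hζ, ?_⟩
    rw [dist_eq_norm] at hd ⊢
    have h1 := norm_qvec_le (ζ - zetaStar)
    have h2 := abs_qscal_le (ζ - zetaStar)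
    refine lt_of_le_of_lt (norm_state_le (a := max ‖ζ - zetaStar‖ ‖w‖) (by positivity)
      (h1.trans (le_max_left _ _)) (h2.trans (le_max_left _ _)) ?_) (max_lt hd hw)
    simp
  have hlip : ∀ w w' : Vec3, ‖w‖ < r → ‖w'‖ < r →
      ‖uEs 0 (mkState (qvec ζ) (qscal ζ) w) - uEs 0 (mkState (qvec ζ) (qscal ζ) w')‖ ≤
        k * ‖w - w'‖ := by
    intro w w' hw hw'
    have h1 := hk.dist_le_mul _ (hrU (hball _ (hscale w hw).2)).1 _
      (hrU (hball _ (hscale w' hw').2)).1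
    rw [dist_eq_norm] at h1
    refine h1.trans ?_
    gcongr
    rw [Prod.dist_eq, dist_self, max_eq_right dist_nonneg, dist_eq_norm]
    exact norm_state_le (norm_nonneg _) (by simp) (by simp) (by simp)
  set g₀ := uEs 0 (mkState (qvec ζ) (qscal ζ) 0) + (1 / 2 : ℝ) • qvec ζ with hg₀
  have hg0 : g₀ = 0 := by
    by_contra hne
    have hpos : 0 < ‖g₀‖ := norm_pos_iff.2 hne
    -- testing the workless condition along `s g₀` for a small `s > 0`
    have hev : ∀ᶠ s : ℝ in 𝓝[>] 0, ‖s • g₀‖ < r ∧ 3 * k * s < 1 := by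
      have h1 : ∀ᶠ s : ℝ in 𝓝 0, ‖s • g₀‖ < r ∧ 3 * k * s < 1 := by
        have c1 : Continuous fun s : ℝ => ‖s • g₀‖ := by fun_prop
        have c2 : Continuous fun s : ℝ => 3 * (k : ℝ) * s := by fun_prop
        exact (c1.continuousAt.eventually (gt_mem_nhds (by simpa using hr))).and
          (c2.continuousAt.eventually (gt_mem_nhds (by simp)))
      exact h1.filter_mono nhdsWithin_le_nhds
    obtain ⟨s, ⟨hs1, hs2⟩, hs0⟩ := (hev.and self_mem_nhdsWithin).exists
    have hs0' : 0 < s := hs0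
    have h1 := hwork _ (hscale _ hs1).1 (hscale _ hs1).2
    rw [angvel_mkState, qvec_mkState, smul_dotProduct, smul_eq_mul] at h1
    have h2 := (mul_eq_zero.1 h1).resolve_left hs0'.ne'
    have h3 := hlip 0 (s • g₀) (by simpa using hr) hs1
    rw [zero_sub, norm_neg, norm_smul, Real.norm_eq_abs, abs_of_pos hs0'] at h3
    have h4 : g₀ ⬝ᵥ g₀ = g₀ ⬝ᵥ (uEs 0 (mkState (qvec ζ) (qscal ζ) 0) -
        uEs 0 (mkState (qvec ζ) (qscal ζ) (s • g₀))) := by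
      have : uEs 0 (mkState (qvec ζ) (qscal ζ) 0) -
        uEs 0 (mkState (qvec ζ) (qscal ζ) (s • g₀)) =
        g₀ - (uEs 0 (mkState (qvec ζ) (qscal ζ) (s • g₀)) + (1 / 2 : ℝ) • qvec ζ) := by
        rw [hg₀]; abel
      rw [this, dotProduct_sub, h2, sub_zero]
    have h5 := (abs_le.1 (abs_dotProduct_le g₀ (uEs 0 (mkState (qvec ζ) (qscal ζ) 0) -
        uEs 0 (mkState (qvec ζ) (qscal ζ) (s • g₀))))).2
    rw [← h4] at h5
    have h6 := sq_norm_le_dotProduct g₀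
    have h7 : 3 * ‖g₀‖ * ‖uEs 0 (mkState (qvec ζ) (qscal ζ) 0) -
        uEs 0 (mkState (qvec ζ) (qscal ζ) (s • g₀))‖ ≤ 3 * ‖g₀‖ * (k * (s * ‖g₀‖)) := by gcongr
    have h8 : 3 * k * s * ‖g₀‖ ^ 2 < 1 * ‖g₀‖ ^ 2 := by gcongr
    nlinarith
  have hw : ‖angvel ζ‖ < r := by
    have := norm_angvel_le (ζ - zetaStar)
    rw [angvel_sub, angvel_zetaStar, sub_zero] at this
    rw [dist_eq_norm] at hd
    linarith
  have h1 := hlip (angvel ζ) 0 hw (by simpa using hr)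
  rw [mkState_eta, sub_zero] at h1
  have h2 : uEs 0 ζ + (1 / 2 : ℝ) • qvec ζ =
      uEs 0 ζ - uEs 0 (mkState (qvec ζ) (qscal ζ) 0) + g₀ := by rw [hg₀]; abel
  rw [h2, hg0, add_zero]
  exact h1

/-- Asymptotic stability for all small periods. The averaged velocity `Φ(δ, ζ)` of the closed loop
vanishes at the equilibrium for every `δ` and is strictly differentiable at `(0, ζ⋆)`; so near `ζ⋆`
it is a relatively small perturbation of the continuous-time closed loop, along which the Lyapunov
function decreases quadratically. -/
theorem exists_asympStableOn_closedLoop {M κ : Matrix (Fin 3) (Fin 3) ℝ} (hM : M.PosDef)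
    (hκ : κ.PosDef) {D : Set State} {uEs : ℝ → State → Vec3} {Jd : ℝ → State → Matrix Idx Idx ℝ}
    (hz : zetaStar ∈ D) (hE : IsEnergyShaping M D uEs Jd) {φ : ℝ × State → Vec3}
    (hφ : AnalyticAt ℝ φ (0, zetaStar))
    (hφd : ∀ᶠ p : ℝ × State in 𝓝 (0, zetaStar), 0 ≤ p.1 → p.2 ∈ unitStates →
      ∀ v, DampingEq M κ p.1 p.2 (uEs p.1 p.2) v ↔ v = φ p) :
    ∃ T > 0, ∀ δ ∈ Ioo (0 : ℝ) T, ∀ uDi : State → Vec3,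
      (∀ᶠ ζ in 𝓝[unitStates] zetaStar, uDi ζ = φ (δ, ζ)) →
      AsympStableOn unitStates (fun ζ => nextState M δ ζ (uEs δ ζ + uDi ζ)) zetaStar := by
  have hzX : zetaStar ∈ unitStates := by simp [unitStates]
  obtain ⟨C₀, r₀, hr₀, hg⟩ := hE.exists_norm_add_le hM hz
  obtain ⟨η, hη, c, hc, a, ha, hVlow, hdec⟩ := exists_lyapDeriv_errField_le hM hκ C₀
  obtain ⟨K, hK, hVup, hWup, hQup⟩ := exists_lyapV_bounds M hη
  set Φ : ℝ × State → State := fun p => sampledF M p.1 p.2 (uEs p.1 p.2 + φ p) with hΦ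
  have hΦan : AnalyticAt ℝ Φ (0, zetaStar) := by
    exact analyticAt_sampledF hM analyticAt_fst analyticAt_snd ((hE.analytic _ ⟨hz, hzX⟩).add hφ)
  have hm := hE.matching zetaStar ⟨hz, hzX⟩
  rw [eventually_nhdsWithin_iff] at hm
  -- the closed loop rests at the equilibrium
  have hrest : ∀ p : ℝ × State, (p ∈ Ici (0 : ℝ) ×ˢ unitStates →
      SolvesMatching M p.1 p.2 (uEs p.1 p.2) (Jd p.1 p.2)) → (0 ≤ p.1 → p.2 ∈ unitStates →
      ∀ v, DampingEq M κ p.1 p.2 (uEs p.1 p.2) v ↔ v = φ p) → 0 ≤ p.1 → p.2 = zetaStar →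
      φ p = 0 ∧ Φ p = 0 := by
    rintro ⟨δ, ζ⟩ h1 h2 h3 h4
    simp only at h1 h2 h3 h4
    subst h4
    have e1 := (h1 ⟨h3, hzX⟩).sampledF_zetaStar hM
    have e2 : DampingEq M κ δ zetaStar (uEs δ zetaStar) 0 := by
      rw [DampingEq, outputY_zetaStar_zero hM e1, Matrix.mulVec_zero, add_zero]
    have e3 := ((h2 h3 hzX 0).1 e2).symm
    exact ⟨e3, by simp only [hΦ, e3, add_zero, e1]⟩
  set ρ : ℝ := a / (8 * K) with hρ
  have hρ0 : 0 < ρ := by positivity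
  set Φ' := fderiv ℝ Φ (0, zetaStar) with hΦ'
  have hstrict : HasStrictFDerivAt Φ Φ' (0, zetaStar) := hΦan.hasStrictFDerivAt
  have hlin := hstrict.isLittleO.def hρ0
  rw [nhds_prod_eq] at hlin
  obtain ⟨S, hS, hSS⟩ := (eventually_prod_self_iff (r := fun x y : ℝ × State =>
    ‖Φ x - Φ y - Φ' (x - y)‖ ≤ ρ * ‖x - y‖)).1 hlin
  obtain ⟨r₁, hr₁, hr₁S⟩ := Metric.mem_nhds_iff.1 (inter_mem (inter_mem hS hm) hφd)
  set r := min (min r₀ r₁) (1 / 2) with hr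
  have hr0 : 0 < r := by positivity
  set L := ‖Φ'‖ + ρ with hL
  have hL0 : 0 < L := by positivity
  set T := min r₁ (min (a / (4 * K * L ^ 2)) (K / a)) with hT
  have hT0 : 0 < T := by positivity
  refine ⟨T, hT0, fun δ hδ uDi huDi => ?_⟩
  have hδ1 : δ < r₁ := hδ.2.trans_le (min_le_left _ _)
  have hδ2 : K * L ^ 2 * δ ≤ a / 4 := by
    have h1 : δ ≤ a / (4 * K * L ^ 2) :=
      hδ.2.le.trans ((min_le_right _ _).trans (min_le_left _ _))
    calc K * L ^ 2 * δ ≤ K * L ^ 2 * (a / (4 * K * L ^ 2)) := by gcongr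
      _ = a / 4 := by field_simp
  have hδ3 : a * δ ≤ K := by
    have h1 : δ ≤ K / a := hδ.2.le.trans ((min_le_right _ _).trans (min_le_right _ _))
    calc a * δ ≤ a * (K / a) := by gcongr
      _ = K := by field_simp
  have hmem : ∀ s ζ, 0 ≤ s → s < r₁ → dist ζ zetaStar < r₁ →
      ((s, ζ) : ℝ × State) ∈ Metric.ball ((0 : ℝ), zetaStar) r₁ := by
    intro s ζ h1 h2 h3
    rw [Metric.mem_ball, Prod.dist_eq, max_lt_iff]
    exact ⟨by simpa [abs_of_nonneg h1] using h2, h3⟩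
  have hzs : ∀ s, 0 ≤ s → s < r₁ → φ (s, zetaStar) = 0 ∧ Φ (s, zetaStar) = 0 := by
    intro s h1 h2
    have h3 := hr₁S (hmem s zetaStar h1 h2 (by simpa using hr₁))
    exact hrest (s, zetaStar) h3.1.2 h3.2 h1 rfl
  have hexp : ∀ s ζ, 0 ≤ s → s < r₁ → dist ζ zetaStar < r₁ →
      ‖Φ (s, ζ) - Φ' (0, ζ - zetaStar)‖ ≤ ρ * ‖ζ - zetaStar‖ := by
    intro s ζ h1 h2 h3
    have h4 := hSS _ (hr₁S (hmem s ζ h1 h2 h3)).1.1 _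
      (hr₁S (hmem s zetaStar h1 h2 (by simpa using hr₁))).1.1
    simpa [(hzs s h1 h2).2, Prod.norm_def] using h4
  have hstep : ∀ ζ ∈ unitStates, dist ζ zetaStar < r →
      lyapV M η (ζ + δ • Φ (δ, ζ)) ≤ (1 - a * δ / (2 * K)) * lyapV M η ζ := by
    intro ζ hζ hd
    have hd0 : dist ζ zetaStar < r₀ := hd.trans_le ((min_le_left _ _).trans (min_le_left _ _))
    have hd1 : dist ζ zetaStar < r₁ := hd.trans_le ((min_le_left _ _).trans (min_le_right _ _))
    have hd2 : ‖ζ - zetaStar‖ ≤ 1 / 2 := by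
      rw [← dist_eq_norm]; exact hd.le.trans (min_le_right _ _)
    set z := ‖ζ - zetaStar‖ with hzdef
    have hz0 : 0 ≤ z := norm_nonneg _
    have e1 := hexp δ ζ hδ.1.le hδ1 hd1
    have e2 := hexp 0 ζ le_rfl hr₁ hd1
    have e3 : ‖Φ (δ, ζ) - Φ (0, ζ)‖ ≤ 2 * ρ * z := by
      have : Φ (δ, ζ) - Φ (0, ζ) = (Φ (δ, ζ) - Φ' (0, ζ - zetaStar)) -
        (Φ (0, ζ) - Φ' (0, ζ - zetaStar)) := by abel
      rw [this]
      refine (norm_sub_le _ _).trans ?_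
      linarith
    have e4 : ‖Φ (δ, ζ)‖ ≤ L * z := by
      have : Φ (δ, ζ) = (Φ (δ, ζ) - Φ' (0, ζ - zetaStar)) + Φ' (0, ζ - zetaStar) := by abel
      rw [this]
      refine (norm_add_le _ _).trans ?_
      have h5 := Φ'.le_opNorm (0, ζ - zetaStar)
      have h6 : ‖((0 : ℝ), ζ - zetaStar)‖ = z := by simp [Prod.norm_def, hzdef]
      rw [h6] at h5
      rw [hL, add_mul]
      linarith
    -- the continuous-time closed loop
    have e5 : lyapDeriv M η ζ (Φ (0, ζ)) ≤ -a * z ^ 2 := by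
      obtain ⟨g1, g2⟩ := hg ζ hζ hd0
      have h1 := hdec ζ hζ hd2 _ g1 g2
      have h2 : φ (0, ζ) = -(κ *ᵥ angvel ζ) := by
        have h3 := (hr₁S (hmem 0 ζ le_rfl hr₁ hd1)).2 le_rfl hζ (φ (0, ζ))
        exact (dampingEq_zero_iff hM ζ _ _).1 (h3.2 rfl)
      have h3 : Φ (0, ζ) = errField M (-(1 / 2 : ℝ) • qvec ζ +
          (uEs 0 ζ + (1 / 2 : ℝ) • qvec ζ) - κ *ᵥ angvel ζ) ζ := by
        simp only [hΦ, sampledF_zero hM, h2]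
        congr 1
        module
      rw [h3]
      exact h1
    have e6 : lyapDeriv M η ζ (Φ (δ, ζ)) ≤ -(3 / 4) * a * z ^ 2 := by
      have h1 : Φ (δ, ζ) = Φ (0, ζ) + (Φ (δ, ζ) - Φ (0, ζ)) := by abel
      rw [h1, lyapDeriv_add]
      have h2 := hWup ζ (Φ (δ, ζ) - Φ (0, ζ))
      have h3 : K * z * ‖Φ (δ, ζ) - Φ (0, ζ)‖ ≤ K * z * (2 * ρ * z) := by gcongr
      have h4 : K * z * (2 * ρ * z) = a / 4 * z ^ 2 := by rw [hρ]; field_simp; ring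
      linarith
    have e7 := hQup (Φ (δ, ζ))
    have e8 : K * ‖Φ (δ, ζ)‖ ^ 2 ≤ K * (L * z) ^ 2 := by gcongr
    have e9 : δ * (K * (L * z) ^ 2) ≤ a / 4 * z ^ 2 := by
      have : K * L ^ 2 * δ * z ^ 2 ≤ a / 4 * z ^ 2 := by gcongr
      linarith
    have e10 := hVup ζ
    rw [lyapV_add_smul hM]
    have e11 : δ * lyapDeriv M η ζ (Φ (δ, ζ)) ≤ δ * (-(3 / 4) * a * z ^ 2) :=
      mul_le_mul_of_nonneg_left e6 hδ.1.le
    have e12 : δ ^ 2 * ((1 / 2 : ℝ) * (Φ (δ, ζ) ⬝ᵥ weightP M *ᵥ Φ (δ, ζ)) +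
        η * (qvec (Φ (δ, ζ)) ⬝ᵥ M *ᵥ angvel (Φ (δ, ζ)))) ≤ δ * (a / 4 * z ^ 2) := by
      rw [pow_two, mul_assoc]
      have := hδ.1.le
      exact mul_le_mul_of_nonneg_left
        ((mul_le_mul_of_nonneg_left (e7.trans e8) this).trans e9) this
    have e13 : a * δ / (2 * K) * lyapV M η ζ ≤ a * δ / (2 * K) * (K * z ^ 2) := by
      have := hδ.1.le
      gcongr
    have e14 : a * δ / (2 * K) * (K * z ^ 2) = a * δ / 2 * z ^ 2 := by field_simp
    linarith
  rw [eventually_nhdsWithin_iff] at huDi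
  obtain ⟨r₂, hr₂, hr₂S⟩ := Metric.mem_nhds_iff.1 huDi
  have hnext : ∀ ζ ∈ unitStates, dist ζ zetaStar < r₂ →
      nextState M δ ζ (uEs δ ζ + uDi ζ) = ζ + δ • Φ (δ, ζ) := by
    intro ζ hζ hd
    rw [nextState_eq_add_smul_sampledF hM, hr₂S hd hζ]
  have hq : a * δ / (2 * K) ≤ 1 / 2 := by
    rw [div_le_iff₀ (by positivity)]; linarith
  have hq' : 0 < a * δ / (2 * K) := by have := hδ.1; positivity
  refine asympStableOn_of_lyapunov (V := lyapV M η) (r := min r r₂) (q := 1 - a * δ / (2 * K))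
    (c := c) (C := K) hzX (fun ζ hζ => flow_mem_unitStates hM _ hζ δ) ?_ (lt_min hr0 hr₂)
    (by linarith) (by linarith) hc hK ?_ ?_ ?_
  · rw [hnext zetaStar hzX (by simpa using hr₂), (hzs δ hδ.1.le hδ1).2, smul_zero, add_zero]
  · intro x; rw [dist_eq_norm]; exact hVlow x
  · intro x; rw [dist_eq_norm]; exact hVup x
  · intro ζ hζ hd
    rw [hnext ζ hζ (hd.trans_le (min_le_right _ _))]
    exact hstep ζ hζ (hd.trans_le (min_le_left _ _))

/-! ### Existence of energy-shaping feedbacks -/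

/-- A vector orthogonal to `a`, zero if `a` is, is the image of `a` under a skew-symmetric
matrix. -/
theorem exists_transpose_eq_neg_mulVec_eq {F a : State} (h : F ⬝ᵥ a = 0) (h0 : a = 0 → F = 0) :
    ∃ J : Matrix Idx Idx ℝ, Jᵀ = -J ∧ J *ᵥ a = F := by
  by_cases ha : a = 0
  · exact ⟨0, by simp, by simp [h0 ha]⟩
  · have hne : a ⬝ᵥ a ≠ 0 := fun h1 => ha (dotProduct_self_eq_zero.1 h1)
    refine ⟨(a ⬝ᵥ a)⁻¹ • (Matrix.vecMulVec F a - Matrix.vecMulVec a F), ?_, ?_⟩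
    · rw [Matrix.transpose_smul, Matrix.transpose_sub, Matrix.transpose_vecMulVec,
        Matrix.transpose_vecMulVec, ← smul_neg, neg_sub]
    · rw [Matrix.smul_mulVec, Matrix.sub_mulVec, Matrix.vecMulVec_mulVec,
        Matrix.vecMulVec_mulVec, h]
      simp [hne]

/-- Hadamard's lemma in the angular velocity, for a function of the period, the state and the input
vanishing with the angular velocity: it is the pairing of the angular velocity with an analytic
map. -/
theorem exists_analyticAt_eq_angvel_dotProduct {e : ℝ × State × Vec3 → ℝ} (he : ContDiff ℝ ω e)
    (h0 : ∀ δ ξ u, angvel ξ = 0 → e (δ, ξ, u) = 0)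
    (h1 : ∀ ξ u, e (0, ξ, u) = angvel ξ ⬝ᵥ (u + (1 / 2 : ℝ) • qvec ξ)) :
    ∃ E : ℝ × State × Vec3 → Vec3, AnalyticAt ℝ E (0, zetaStar, 0) ∧
      (∀ δ ξ u, e (δ, ξ, u) = angvel ξ ⬝ᵥ E (δ, ξ, u)) ∧
      ∀ ξ u, E (0, ξ, u) = u + (1 / 2 : ℝ) • qvec ξ := by
  -- the inclusion of the angular velocities into the states
  let ι : Vec3 →L[ℝ] State := LinearMap.toContinuousLinearMap
    { toFun := fun w => mkState 0 0 w
      map_add' := fun u v => state_ext (by simp) (by simp) (by simp)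
      map_smul' := fun c u => state_ext (by simp) (by simp) (by simp) }
  have hι : ∀ w, ι w = mkState 0 0 w := fun _ => rfl
  let Ω : ℝ × State × Vec3 →L[ℝ] State :=
    ι ∘L angvelL ∘L ContinuousLinearMap.fst ℝ State Vec3 ∘L ContinuousLinearMap.snd ℝ ℝ _
  let B : ℝ × State × Vec3 →L[ℝ] ℝ × State × Vec3 :=
    (0 : ℝ × State × Vec3 →L[ℝ] ℝ).prod (Ω.prod 0)
  let A : ℝ × State × Vec3 →L[ℝ] ℝ × State × Vec3 := ContinuousLinearMap.id ℝ _ - B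
  let j : Vec3 →L[ℝ] ℝ × State × Vec3 :=
    (ContinuousLinearMap.inr ℝ ℝ (State × Vec3)) ∘L (ContinuousLinearMap.inl ℝ State Vec3) ∘L ι
  have hB : ∀ p, B p = j (angvel p.2.1) := fun p => rfl
  have hAB : ∀ (s : ℝ) δ ξ u, (A + s • B) (δ, ξ, u) =
      (δ, mkState (qvec ξ) (qscal ξ) (s • angvel ξ), u) := by
    intro s δ ξ u
    have h2 : (A + s • B) (δ, ξ, u) = (δ - 0 + s • 0, ξ - ι (angvel ξ) + s • ι (angvel ξ),
        u - 0 + s • 0) := rfl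
    rw [h2, hι]
    simp only [sub_zero, smul_zero, add_zero, Prod.mk.injEq, true_and, and_true]
    exact state_ext (by simp) (by simp) (by simp)
  set f : ℝ × State × Vec3 → Vec3 := fun p k => fderiv ℝ e p (j (Pi.single k 1)) with hf
  have hfc : ContDiff ℝ ω f := by
    have h2 : ContDiff ℝ ω (fderiv ℝ e) := he.fderiv_right le_top
    rw [contDiff_pi]
    intro k
    exact h2.clm_apply contDiff_const
  have hfw : ∀ p w, fderiv ℝ e p (j w) = w ⬝ᵥ f p := by
    intro p w
    have hw : w = ∑ k, w k • (Pi.single k 1 : Vec3) := by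
      ext i; simp [Finset.sum_apply, Pi.single_apply]
    conv_lhs => rw [hw, map_sum, map_sum]
    simp only [map_smul, smul_eq_mul, dotProduct, hf]
  have hfcont : Continuous f := hfc.continuous
  have hABc : ∀ p : ℝ × State × Vec3, Continuous fun s : ℝ => (A + s • B) p := fun p => by
    fun_prop
  refine ⟨fun p => ∫ s in (0 : ℝ)..1, f ((A + s • B) p), ?_, ?_, ?_⟩
  · have h2 := AnalyticAt.intervalIntegral_comp_affine A B (0, zetaStar, 0)
      (hfc.contDiffAt.analyticAt : AnalyticAt ℝ f (0, zetaStar, 0))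
    refine h2.congr (Eventually.of_forall fun p => ?_)
    refine intervalIntegral.integral_congr fun s _ => ?_
    have h3 : (A + s • B) ((0, zetaStar, 0) : ℝ × State × Vec3) = (0, zetaStar, 0) := by
      rw [hAB, angvel_zetaStar, smul_zero]; rfl
    simp only [map_sub, h3, add_sub_cancel]
  · intro δ ξ u
    have h2 : ∀ s ∈ uIcc (0 : ℝ) 1, HasDerivAt (fun s : ℝ => e ((A + s • B) (δ, ξ, u)))
        (angvel ξ ⬝ᵥ f ((A + s • B) (δ, ξ, u))) s := by
      intro s _
      have h3 : HasDerivAt (fun s : ℝ => (A + s • B) (δ, ξ, u)) (B (δ, ξ, u)) s := by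
        simpa using ((hasDerivAt_id s).smul_const (B (δ, ξ, u))).const_add (A (δ, ξ, u))
      have h4 := ((he.differentiable (by simp)) ((A + s • B) (δ, ξ, u))).hasFDerivAt.comp_hasDerivAt
        s h3
      rw [hB, hfw] at h4
      exact h4
    have hc : Continuous fun s : ℝ => f ((A + s • B) (δ, ξ, u)) := hfcont.comp (hABc _)
    have hc' : Continuous fun s : ℝ => angvel ξ ⬝ᵥ f ((A + s • B) (δ, ξ, u)) := by
      fun_prop
    have h5 := intervalIntegral.integral_eq_sub_of_hasDerivAt h2 (hc'.intervalIntegrable _ _)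
    rw [hAB, hAB, one_smul, zero_smul, mkState_eta, h0 δ _ u (angvel_mkState _ _ _), sub_zero] at h5
    let d : Vec3 →L[ℝ] ℝ := LinearMap.toContinuousLinearMap
      { toFun := fun w => angvel ξ ⬝ᵥ w
        map_add' := fun u v => dotProduct_add _ _ _
        map_smul' := fun c u => dotProduct_smul _ _ _ }
    rw [← h5]
    exact d.intervalIntegral_comp_comm (μ := MeasureTheory.volume) (hc.intervalIntegrable 0 1)
  · intro ξ u
    have h2 : ∀ s : ℝ, f ((A + s • B) (0, ξ, u)) = u + (1 / 2 : ℝ) • qvec ξ := by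
      intro s
      ext k
      rw [hAB]
      set x := mkState (qvec ξ) (qscal ξ) (s • angvel ξ) with hx
      set b := u + (1 / 2 : ℝ) • qvec ξ with hb
      have h3 : HasDerivAt (fun t : ℝ => (0, x, u) + t • j (Pi.single k 1))
          (j (Pi.single k 1)) 0 := by
        simpa using ((hasDerivAt_id (0 : ℝ)).smul_const (j (Pi.single k 1))).const_add
          ((0, x, u) : ℝ × State × Vec3)
      have h4 := ((he.differentiable (by simp)) ((0, x, u) + (0 : ℝ) • j (Pi.single k
        1))).hasFDerivAt.comp_hasDerivAt (0 : ℝ) h3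
      rw [zero_smul, add_zero] at h4
      have h5 : (e ∘ fun t : ℝ => (0, x, u) + t • j (Pi.single k 1)) =
          fun t => angvel x ⬝ᵥ b + t * b k := by
        funext t
        have h6 : ((0, x, u) : ℝ × State × Vec3) + t • j (Pi.single k 1) =
            (0, x + t • mkState 0 0 (Pi.single k 1), u) := by
          have : ((0, x, u) : ℝ × State × Vec3) + t • j (Pi.single k 1) =
            (0 + t • 0, x + t • mkState 0 0 (Pi.single k 1), u + t • 0) := rfl
          rw [this]; simp
        simp only [Function.comp, h6, h1]
        simp only [qvec_add, angvel_add, qvec_smul, angvel_smul, qvec_mkState, angvel_mkState,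
          smul_zero, add_zero, add_dotProduct, smul_dotProduct, smul_eq_mul, hx, hb]
        simp
      rw [h5] at h4
      have h7 : HasDerivAt (fun t : ℝ => angvel x ⬝ᵥ b + t * b k) (b k) 0 := by
        simpa using ((hasDerivAt_id (0 : ℝ)).mul_const (b k)).const_add (angvel x ⬝ᵥ b)
      exact h4.unique h7
    simp only [h2]
    simp

/-- The rate of energy change over one sampling period, as a function of the state `ξ` at the middle
of the period. -/
noncomputable def midpointPower (M : Matrix (Fin 3) (Fin 3) ℝ) (δ : ℝ) (ξ : State) (u : Vec3) : ℝ :=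
  ((1 / 2 : ℝ) • (sampledF M (δ / 2) ξ u + sampledF M (-(δ / 2)) ξ u)) ⬝ᵥ
    weightP M *ᵥ (ξ - zetaStar +
      (δ / 4) • (sampledF M (δ / 2) ξ u - sampledF M (-(δ / 2)) ξ u))

/-- The half-periods before and after the midpoint `ξ` start at `ξ` and run over times `-δ/2` and
`δ/2`. -/
theorem midpointPower_nextState {M : Matrix (Fin 3) (Fin 3) ℝ} (hM : M.PosDef) (δ : ℝ) (ζ : State)
    (u : Vec3) : midpointPower M δ (nextState M (δ / 2) ζ u) u =
      sampledF M δ ζ u ⬝ᵥ weightP M *ᵥ (ζ - zetaStar + (δ / 2) • sampledF M δ ζ u) := by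
  by_cases hδ : δ = 0
  · subst hδ
    simp only [midpointPower, nextState, zero_div, neg_zero, flow_zero hM, zero_smul, add_zero]
    congr 1
    module
  · set ξ := nextState M (δ / 2) ζ u with hξ
    have h1 : ζ = ξ + (-(δ / 2)) • sampledF M (-(δ / 2)) ξ u := by
      rw [← nextState_eq_add_smul_sampledF hM, hξ, nextState, nextState, flow_flow hM,
        add_neg_cancel, flow_zero hM]
    have h2 : ζ + δ • sampledF M δ ζ u = ξ + (δ / 2) • sampledF M (δ / 2) ξ u := by
      rw [← nextState_eq_add_smul_sampledF hM, ← nextState_eq_add_smul_sampledF hM, hξ, nextState,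
        nextState, nextState, flow_flow hM, add_halves]
    have h3 : sampledF M δ ζ u =
        (1 / 2 : ℝ) • (sampledF M (δ / 2) ξ u + sampledF M (-(δ / 2)) ξ u) := by
      have h4 : δ • sampledF M δ ζ u =
          δ • ((1 / 2 : ℝ) • (sampledF M (δ / 2) ξ u + sampledF M (-(δ / 2)) ξ u)) := by
        have h5 : δ • sampledF M δ ζ u = ξ + (δ / 2) • sampledF M (δ / 2) ξ u - ζ := by
          rw [← h2]; abel
        rw [h5]
        conv_lhs => rw [h1]
        module
      exact smul_right_injective State hδ h4
    rw [midpointPower, h3]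
    congr 2
    conv_rhs => rw [h1]
    module

/-- A midpoint at rest is exchanged with itself by time reversal, so the energies at the two ends
of the period agree. -/
theorem midpointPower_eq_zero {M : Matrix (Fin 3) (Fin 3) ℝ} (hM : M.PosDef) (δ : ℝ) {ξ : State}
    (u : Vec3) (hξ : angvel ξ = 0) : midpointPower M δ ξ u = 0 := by
  have h1 : revVel ξ = ξ := by
    rw [revVel, hξ, neg_zero, ← hξ, mkState_eta]
  have h2 := sampledF_revVel hM (δ / 2) ξ u
  rw [h1] at h2
  rw [midpointPower, h2, ← sub_eq_add_neg, sub_neg_eq_add, weightP_mulVec, dotProduct_state]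
  simp [revVel, hξ]

theorem midpointPower_zero {M : Matrix (Fin 3) (Fin 3) ℝ} (hM : M.PosDef) (ξ : State)
    (u : Vec3) : midpointPower M 0 ξ u = angvel ξ ⬝ᵥ (u + (1 / 2 : ℝ) • qvec ξ) := by
  have h1 := midpointPower_nextState hM 0 ξ u
  rw [zero_div, nextState, flow_zero hM, sampledF_zero hM, zero_smul, add_zero] at h1
  rw [h1, weightP_dotProduct_comm hM, weightP_mulVec, dotProduct_state]
  have e1 := qvec_dotProduct_errField M u ξ
  have e2 := angvel_dotProduct_errField hM u ξ
  have e3 := qscal_errField M u ξ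
  simp only [qvec_mkState, qscal_mkState, angvel_mkState, qvec_sub, qscal_sub, angvel_sub,
    qvec_zetaStar, qscal_zetaStar, angvel_zetaStar, sub_zero]
  rw [dotProduct_add, dotProduct_smul, smul_eq_mul]
  linarith

theorem contDiff_midpointPower {M : Matrix (Fin 3) (Fin 3) ℝ} (hM : M.PosDef) :
    ContDiff ℝ ω fun p : ℝ × State × Vec3 => midpointPower M p.1 p.2.1 p.2.2 := by
  obtain ⟨F, hF, hFs⟩ : ∃ F : ℝ × State × Vec3 → State, ContDiff ℝ ω F ∧
      ∀ δ ζ u, sampledF M δ ζ u = F (δ, ζ, u) := ⟨_, contDiff_sampledF hM, fun _ _ _ => rfl⟩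
  simp only [midpointPower, hFs]
  have h1 : ContDiff ℝ ω fun x => weightP M *ᵥ x :=
    (LinearMap.toContinuousLinearMap (weightP M).mulVecLin).contDiff
  have h2 : ContDiff ℝ ω fun p : ℝ × State × Vec3 => F (p.1 / 2, p.2.1, p.2.2) := by fun_prop
  have h3 : ContDiff ℝ ω fun p : ℝ × State × Vec3 => F (-(p.1 / 2), p.2.1, p.2.2) := by fun_prop
  have h4 : ContDiff ℝ ω fun p : ℝ × State × Vec3 => (1 / 2 : ℝ) •
      (F (p.1 / 2, p.2.1, p.2.2) + F (-(p.1 / 2), p.2.1, p.2.2)) := by fun_prop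
  have h5 : ContDiff ℝ ω fun p : ℝ × State × Vec3 => weightP M *ᵥ (p.2.1 - zetaStar + (p.1 / 4) •
      (F (p.1 / 2, p.2.1, p.2.2) - F (-(p.1 / 2), p.2.1, p.2.2))) := h1.comp (by fun_prop)
  rw [contDiff_pi] at h4 h5
  simp only [dotProduct]
  exact ContDiff.sum fun i _ => (h4 i).mul (h5 i)

/-- Energy shaping: a control value making the energy change over each sampling period vanish
depends analytically on the period and on the state. -/
theorem exists_analyticAt_sampledF_dotProduct_eq_zero {M : Matrix (Fin 3) (Fin 3) ℝ}
    (hM : M.PosDef) : ∃ φ : ℝ × State → Vec3, AnalyticAt ℝ φ (0, zetaStar) ∧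
      (∀ᶠ p : ℝ × State in 𝓝 (0, zetaStar), sampledF M p.1 p.2 (φ p) ⬝ᵥ
        weightP M *ᵥ (p.2 - zetaStar + (p.1 / 2) • sampledF M p.1 p.2 (φ p)) = 0) ∧
      ∀ᶠ ζ in 𝓝 zetaStar, φ (0, ζ) = -(1 / 2 : ℝ) • qvec ζ := by
  obtain ⟨E, hE, hmid, hE0⟩ := exists_analyticAt_eq_angvel_dotProduct (contDiff_midpointPower hM)
    (fun δ ξ u h => midpointPower_eq_zero hM δ u h) (fun ξ u => midpointPower_zero hM ξ u)
  set N : (ℝ × State) × Vec3 → State := fun q => q.1.2 + (q.1.1 / 2) •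
    sampledF M (q.1.1 / 2) q.1.2 q.2 with hN
  have hN' : ∀ δ ζ u, N ((δ, ζ), u) = nextState M (δ / 2) ζ u := fun δ ζ u =>
    (nextState_eq_add_smul_sampledF hM _ _ _).symm
  have hNan : ∀ q, AnalyticAt ℝ N q := by
    intro q
    have h2 : AnalyticAt ℝ (fun q : (ℝ × State) × Vec3 => q.1.1 / 2) q :=
      (((ContinuousLinearMap.fst ℝ ℝ State) ∘L
        (ContinuousLinearMap.fst ℝ (ℝ × State) Vec3)).analyticAt _).div_const
    have h3 : AnalyticAt ℝ (fun q : (ℝ × State) × Vec3 => q.1.2) q :=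
      ((ContinuousLinearMap.snd ℝ ℝ State) ∘L
        (ContinuousLinearMap.fst ℝ (ℝ × State) Vec3)).analyticAt _
    exact h3.add (h2.smul (analyticAt_sampledF hM h2 h3 analyticAt_snd))
  have hN0 : ∀ ζ u, N ((0, ζ), u) = ζ := fun ζ u => by simp [hN]
  set G : (ℝ × State) × Vec3 → Vec3 := fun q => E (q.1.1, N q, q.2) with hG
  have hG0 : ∀ ζ u, G ((0, ζ), u) = u + (1 / 2 : ℝ) • qvec ζ := by
    intro ζ u
    simp only [hG, hN0, hE0]
  have hGan : AnalyticAt ℝ G ((0, zetaStar), 0) := by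
    have h1 : AnalyticAt ℝ (fun q : (ℝ × State) × Vec3 => (q.1.1, N q, q.2)) ((0, zetaStar), 0) :=
      (((ContinuousLinearMap.fst ℝ ℝ State) ∘L
        (ContinuousLinearMap.fst ℝ (ℝ × State) Vec3)).analyticAt _).prod
        ((hNan _).prod analyticAt_snd)
    refine AnalyticAt.comp (g := E) (f := fun q : (ℝ × State) × Vec3 => (q.1.1, N q, q.2)) ?_ h1
    simp only [hN0]
    exact hE
  obtain ⟨φ, hφ, hφ0⟩ := exists_analyticAt_apply_eq_zero hGan ((1 / 2 : ℝ) • qvec zetaStar)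
    (fun u => hG0 _ u) (by simp [hG0])
  refine ⟨φ, hφ, ?_, ?_⟩
  · filter_upwards [hφ0] with p hp
    rw [← midpointPower_nextState hM]
    have h1 := hmid p.1 (nextState M (p.1 / 2) p.2 (φ p)) (φ p)
    simp only at h1
    rw [h1, ← hN']
    have h2 : E (p.1, N ((p.1, p.2), φ p), φ p) = 0 := hp
    rw [h2, dotProduct_zero]
  · have h1 : Tendsto (fun ζ : State => ((0 : ℝ), ζ)) (𝓝 zetaStar) (𝓝 (0, zetaStar)) :=
      (Continuous.prodMk_right (0 : ℝ)).tendsto zetaStar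
    filter_upwards [h1.eventually hφ0] with ζ hζ
    rw [hG0] at hζ
    rw [eq_neg_of_add_eq_zero_left hζ, neg_smul]

/-- A workless sampled velocity admits an interconnection matrix. The degenerate case is a vanishing
midpoint gradient; as the closed loop rests at the equilibrium, this leaves only the equilibrium
when the period is small compared with the Lipschitz constant of the closed loop. -/
theorem exists_isEnergyShaping {M : Matrix (Fin 3) (Fin 3) ℝ} (hM : M.PosDef) :
    ∃ (D : Set State) (uEs : ℝ → State → Vec3) (Jd : ℝ → State → Matrix Idx Idx ℝ),
      IsOpen D ∧ zetaStar ∈ D ∧ IsEnergyShaping M D uEs Jd ∧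
        ∀ ζ ∈ D, uEs 0 ζ = -(1 / 2 : ℝ) • qvec ζ := by
  classical
  obtain ⟨φ, hφ, hwork, hφ0⟩ := exists_analyticAt_sampledF_dotProduct_eq_zero hM
  obtain ⟨c, hc, hcP⟩ := exists_pos_mul_sq_norm_le_weightP hM
  have hPinj : ∀ x : State, x ⬝ᵥ weightP M *ᵥ x = 0 → x = 0 := by
    intro x hx
    have h1 := hcP x
    rw [hx] at h1
    have h2 : ‖x‖ ^ 2 ≤ 0 := by nlinarith
    exact norm_eq_zero.1 (pow_eq_zero_iff two_ne_zero |>.1 (le_antisymm h2 (by positivity)))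
  set Φ : ℝ × State → State := fun p => sampledF M p.1 p.2 (φ p) with hΦ
  have hΦan : AnalyticAt ℝ Φ (0, zetaStar) :=
    analyticAt_sampledF hM analyticAt_fst analyticAt_snd hφ
  obtain ⟨k, U, hU, hk⟩ := (hΦan.contDiffAt (n := 1)).exists_lipschitzOnWith
  have hrest : ∀ᶠ p : ℝ × State in 𝓝 (0, zetaStar), Φ (p.1, zetaStar) = 0 ∧
      (p.1, zetaStar) ∈ U := by
    have h1 : Tendsto (fun p : ℝ × State => (p.1, zetaStar)) (𝓝 (0, zetaStar))
        (𝓝 ((0 : ℝ), zetaStar)) :=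
      (show Continuous fun p : ℝ × State => (p.1, zetaStar) by fun_prop).tendsto _
    filter_upwards [h1.eventually hwork, h1.eventually hU] with p hp hpU
    refine ⟨?_, hpU⟩
    by_cases hδ : p.1 = 0
    · simp only [hΦ, hδ, sampledF_zero hM, hφ0.self_of_nhds]
      rw [errField_eq_add]
      refine state_ext ?_ ?_ ?_ <;> simp [driftBilin, inputMap_apply]
    · rw [sub_self, zero_add, Matrix.mulVec_smul, dotProduct_smul, smul_eq_mul] at hp
      exact hPinj _ ((mul_eq_zero.1 hp).resolve_left (by simpa using hδ))
  have hsmall : ∀ᶠ p : ℝ × State in 𝓝 (0, zetaStar), |p.1 / 2| * k < 1 := by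
    have h1 : Continuous fun p : ℝ × State => |p.1 / 2| * (k : ℝ) := by fun_prop
    exact h1.continuousAt.eventually (gt_mem_nhds (by simp))
  have hJ : ∀ᶠ p : ℝ × State in 𝓝 (0, zetaStar), ∃ J, SolvesMatching M p.1 p.2 (φ p) J := by
    filter_upwards [hwork, hrest, hsmall, hU] with p hp hr hs hpU
    refine exists_transpose_eq_neg_mulVec_eq hp fun ha => ?_
    have h1 := hPinj (p.2 - zetaStar + (p.1 / 2) • Φ p) (by rw [ha, dotProduct_zero])
    have h2 : ‖Φ p‖ ≤ k * ‖p.2 - zetaStar‖ := by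
      have h3 := hk.dist_le_mul _ hpU _ hr.2
      rw [hr.1, dist_zero_right] at h3
      refine h3.trans ?_
      rw [Prod.dist_eq, dist_self, max_eq_right dist_nonneg, dist_eq_norm]
    have h3 : ‖p.2 - zetaStar‖ = |p.1 / 2| * ‖Φ p‖ := by
      rw [eq_neg_of_add_eq_zero_left h1, norm_neg, norm_smul, Real.norm_eq_abs]
    have h4 : ‖p.2 - zetaStar‖ ≤ |p.1 / 2| * k * ‖p.2 - zetaStar‖ := by
      conv_lhs => rw [h3]
      rw [mul_assoc]
      gcongr
    have h5 : ‖p.2 - zetaStar‖ = 0 := by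
      by_contra hne
      have : 0 < ‖p.2 - zetaStar‖ := lt_of_le_of_ne (norm_nonneg _) (Ne.symm hne)
      nlinarith
    rw [h5, mul_zero] at h2
    exact norm_eq_zero.1 (le_antisymm h2 (norm_nonneg _))
  have hslice : Tendsto (fun ζ : State => ((0 : ℝ), ζ)) (𝓝 zetaStar) (𝓝 (0, zetaStar)) :=
    (Continuous.prodMk_right (0 : ℝ)).tendsto zetaStar
  obtain ⟨D, hDsub, hDopen, hzD⟩ := mem_nhds_iff.1 ((hslice.eventually
    hφ.eventually_analyticAt).and ((hslice.eventually hJ.eventually_nhds).and hφ0))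
  refine ⟨D, fun δ ζ => φ (δ, ζ), fun δ ζ => if h : ∃ J, SolvesMatching M δ ζ (φ (δ, ζ)) J then
    h.choose else 0, hDopen, hzD, ⟨fun ζ hζ => (hDsub hζ.1).1, fun ζ hζ => ?_⟩,
    fun ζ hζ => (hDsub hζ).2.2⟩
  refine Eventually.filter_mono nhdsWithin_le_nhds ?_
  filter_upwards [(hDsub hζ.1).2.1] with p hp
  have hp' : ∃ J, SolvesMatching M p.1 p.2 (φ (p.1, p.2)) J := hp
  simp only [dif_pos hp']
  exact hp'.choose_spec

/-! ### The series of the damping feedback and the closed loop -/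

theorem exists_hasSum_div_factorial_of_analyticAt {V : Type*} [NormedAddCommGroup V]
    [NormedSpace ℝ V] {ψ : ℝ → V} (hψ : AnalyticAt ℝ ψ 0) : ∃ c : ℕ → V, c 0 = ψ 0 ∧
      ∀ᶠ δ in 𝓝 (0 : ℝ), HasSum (fun i : ℕ => (δ ^ i / ((i + 1).factorial : ℝ)) • c i) (ψ δ) := by
  obtain ⟨p, hp⟩ := hψ
  refine ⟨fun i => ((i + 1).factorial : ℝ) • p.coeff i, ?_, ?_⟩
  · change ((0 + 1).factorial : ℝ) • p.coeff 0 = ψ 0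
    rw [zero_add, Nat.factorial_one, Nat.cast_one, one_smul]
    exact hp.coeff_zero 1
  · filter_upwards [hasFPowerSeriesAt_iff.1 hp] with δ hδ
    rw [zero_add] at hδ
    refine hδ.congr_fun fun i => ?_
    rw [smul_smul, div_mul_cancel₀ _ (by positivity)]

theorem theorem1 (M κ : Matrix (Fin 3) (Fin 3) ℝ) (hM : M.PosDef) (hκ : κ.PosDef) :
    -- energy-shaping feedbacks around the continuous-time one exist near the equilibrium
    (∃ (D : Set State) (uEs : ℝ → State → Vec3) (Jd : ℝ → State → Matrix Idx Idx ℝ),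
      IsOpen D ∧ zetaStar ∈ D ∧ IsEnergyShaping M D uEs Jd ∧
        ∀ ζ ∈ D, uEs 0 ζ = -(1 / 2 : ℝ) • qvec ζ) ∧
    -- and every energy-shaping feedback has the following properties
    ∀ (D : Set State) (uEs : ℝ → State → Vec3) (Jd : ℝ → State → Matrix Idx Idx ℝ),
      IsOpen D → zetaStar ∈ D → IsEnergyShaping M D uEs Jd →
      -- (i) port-controlled Hamiltonian form and energy balance
      (∀ (δ : ℝ) (ζ : State), 0 ≤ δ → SolvesMatching M δ ζ (uEs δ ζ) (Jd δ ζ) →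
        ∀ v : Vec3,
          nextState M δ ζ (uEs δ ζ + v) =
              ζ + δ • (Jd δ ζ *ᵥ discGrad M ζ (nextState M δ ζ (uEs δ ζ)))
                + δ • (gD M δ ζ (uEs δ ζ) v *ᵥ v) ∧
          hamD M (nextState M δ ζ (uEs δ ζ + v)) - hamD M ζ =
              δ * (v ⬝ᵥ outputY M δ ζ (uEs δ ζ) v)) ∧
      ∃ (uDi : ℝ → State → Vec3) (c : ℕ → State → Vec3),
        -- (ii) unique solution of the damping equality, as a series in `δ` around `-κ ω`
        (∀ ζ ∈ D ∩ unitStates, c 0 ζ = -(κ *ᵥ angvel ζ) ∧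
          ∃ T > 0, ∀ δ ∈ Ico (0 : ℝ) T,
            (∀ v : Vec3, DampingEq M κ δ ζ (uEs δ ζ) v ↔ v = uDi δ ζ) ∧
            HasSum (fun i : ℕ => (δ ^ i / ((i + 1).factorial : ℝ)) • c i ζ) (uDi δ ζ)) ∧
        -- (iii) asymptotic stability of the closed loop, for every small sampling period
        (∃ T > 0, ∀ δ ∈ Ioo (0 : ℝ) T,
          (∀ᶠ ζ in 𝓝[unitStates] zetaStar,
            ∀ v : Vec3, DampingEq M κ δ ζ (uEs δ ζ) v ↔ v = uDi δ ζ) ∧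
          AsympStableOn unitStates
            (fun ζ => nextState M δ ζ (uEs δ ζ + uDi δ ζ)) zetaStar) := by
  classical
  refine ⟨exists_isEnergyShaping hM, fun D uEs Jd hD hz hE => ⟨fun δ ζ _ h v =>
    ⟨nextState_eq_of_solvesMatching hM h v, hamD_nextState_sub_hamD hM h v⟩, ?_⟩⟩
  have hzX : zetaStar ∈ unitStates := by simp [unitStates]
  have hloc : ∀ ζ₀ ∈ D ∩ unitStates, ∃ φ : ℝ × State → Vec3, AnalyticAt ℝ φ (0, ζ₀) ∧
      ∀ᶠ p : ℝ × State in 𝓝 (0, ζ₀), 0 ≤ p.1 → p.2 ∈ unitStates →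
        ∀ v, DampingEq M κ p.1 p.2 (uEs p.1 p.2) v ↔ v = φ p := by
    intro ζ₀ hζ₀
    obtain ⟨φ, hφ, h⟩ := exists_analyticAt_dampingEq_iff hM hκ (hE.analytic ζ₀ hζ₀)
    refine ⟨φ, hφ, ?_⟩
    filter_upwards [h, eventually_nhdsWithin_iff.1 (hE.matching ζ₀ hζ₀)] with p h1 h2 h3 h4
    exact h1 h3 ⟨_, h2 ⟨h3, h4⟩⟩
  -- where the damping equality is not uniquely solvable, the feedback takes the value `0`
  let uDi : ℝ → State → Vec3 := fun δ ζ =>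
    if h : ∃ a, ∀ v, DampingEq M κ δ ζ (uEs δ ζ) v ↔ v = a then h.choose else 0
  have huDi : ∀ δ ζ a, (∀ v, DampingEq M κ δ ζ (uEs δ ζ) v ↔ v = a) → uDi δ ζ = a := by
    intro δ ζ a ha
    have h : ∃ a, ∀ v, DampingEq M κ δ ζ (uEs δ ζ) v ↔ v = a := ⟨a, ha⟩
    have h1 : uDi δ ζ = h.choose := dif_pos h
    rw [h1]
    exact (ha _).1 ((h.choose_spec _).2 rfl)
  have hser : ∀ ζ, ∃ c : ℕ → Vec3, ζ ∈ D ∩ unitStates → c 0 = -(κ *ᵥ angvel ζ) ∧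
      ∃ T > 0, ∀ δ ∈ Ico (0 : ℝ) T,
        (∀ v : Vec3, DampingEq M κ δ ζ (uEs δ ζ) v ↔ v = uDi δ ζ) ∧
        HasSum (fun i : ℕ => (δ ^ i / ((i + 1).factorial : ℝ)) • c i) (uDi δ ζ) := by
    intro ζ
    by_cases hζ : ζ ∈ D ∩ unitStates
    · obtain ⟨φ, hφ, h⟩ := hloc ζ hζ
      have hslice : AnalyticAt ℝ (fun δ : ℝ => φ (δ, ζ)) 0 :=
        AnalyticAt.comp (g := φ) (f := fun δ : ℝ => (δ, ζ)) hφ (analyticAt_id.prod analyticAt_const)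
      obtain ⟨c, hc0, hc⟩ := exists_hasSum_div_factorial_of_analyticAt hslice
      have ht : Tendsto (fun δ : ℝ => (δ, ζ)) (𝓝 0) (𝓝 (0, ζ)) :=
        (Continuous.prodMk_left ζ).tendsto 0
      have hev := ht.eventually h
      refine ⟨c, fun _ => ⟨?_, ?_⟩⟩
      · rw [hc0]
        exact (dampingEq_zero_iff hM ζ _ _).1 ((hev.self_of_nhds le_rfl hζ.2 _).2 rfl)
      · obtain ⟨T, hT, hTs⟩ := Metric.eventually_nhds_iff.1 (hev.and hc)
        refine ⟨T, hT, fun δ hδ => ?_⟩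
        obtain ⟨h1, h2⟩ := hTs (y := δ) (by simpa [abs_of_nonneg hδ.1] using hδ.2)
        have h3 := h1 hδ.1 hζ.2
        rw [huDi δ ζ _ h3]
        exact ⟨h3, h2⟩
    · exact ⟨0, fun h => absurd h hζ⟩
  choose c hc using hser
  refine ⟨uDi, fun i ζ => c ζ i, fun ζ hζ => hc ζ hζ, ?_⟩
  obtain ⟨φ, hφ, h⟩ := hloc zetaStar ⟨hz, hzX⟩
  obtain ⟨T, hT, hTs⟩ := exists_asympStableOn_closedLoop hM hκ hz hE hφ h
  obtain ⟨r, hr, hrs⟩ := Metric.eventually_nhds_iff.1 h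
  refine ⟨min T r, lt_min hT hr, fun δ hδ => ?_⟩
  have hsol : ∀ᶠ ζ in 𝓝[unitStates] zetaStar,
      ∀ v : Vec3, DampingEq M κ δ ζ (uEs δ ζ) v ↔ v = φ (δ, ζ) := by
    rw [eventually_nhdsWithin_iff]
    filter_upwards [Metric.ball_mem_nhds zetaStar hr] with ζ hζ hζX
    refine hrs (y := (δ, ζ)) ?_ hδ.1.le hζX
    rw [Prod.dist_eq, max_lt_iff]
    exact ⟨by simpa [abs_of_pos hδ.1] using hδ.2.trans_le (min_le_right _ _), hζ⟩
  refine ⟨?_, hTs δ ⟨hδ.1, hδ.2.trans_le (min_le_left _ _)⟩ (uDi δ) ?_⟩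
  · filter_upwards [hsol] with ζ hζ
    rw [huDi δ ζ _ hζ]
    exact hζ
  · filter_upwards [hsol] with ζ hζ
    exact huDi δ ζ _ hζ
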